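/- Let $S=\{x_{11},x_{12},x_{21},x_{22},y_{11},z_{11}\}$ be the $6$-element semigroup with operation $a_{ij}b_{kl}=x_{il}$ for $a,b\in\{x,y,z\}$. Let $S^1=S\sqcup\{1\}$ be the monoid obtained by freely adjoining a unit, let $R=\mathbb{Z}S^1$ be its monoid ring, let $P=Rx_{11}$ (a left ideal), and regard $\mathbb{Z}$ as the trivial left $R$-module. Let $BS$ be the classifying space of $S$, that is, the geometric realization of the $\Delta$-set with one $n$-simplex for each $n$-tuple of elements of $S$ and with face maps $d_0(s_1,\dots,s_n)=(s_2,\dots,s_n)$, $d_i(s_1,\dots,s_n)=(s_1,\dots,s_is_{i+1},\dots,s_n)$ for $0<i<n$, and $d_n(s_1,\dots,s_n)=(s_1,\dots,s_{n-1})$. (1) Put $D=P\oplus(P\oplus R\oplus R)$ and define $R$-linear maps $$\varepsilon\colon P\to\mathbb{Z}\ \text{(augmentation)},\qquad \partial_1\colon R\to P,\quad r\mapsto r(x_{21}-x_{11}),$$ $$\partial_2\colon D\to R,\quad (q,p,a,b)\mapsto qx_{12}+px_{11}+ay_{11}+bz_{11},$$ $$\partial_3\colon D\oplus D\to D,\quad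 (u,v)\mapsto\bigl(0,\ \sigma(u)+\sigma(v),\ -\partial_2(u),\ -\partial_2(v)\bigr),$$ where $\sigma(q,p,a,b)=(q+p+a+b)x_{11}$. Then $$0\leftarrow\mathbb{Z}\xleftarrow{\varepsilon}P\xleftarrow{\partial_1}R\xleftarrow{\partial_2}D\xleftarrow{\partial_3}D^{2}\xleftarrow{\partial_3\oplus\partial_3}D^{4}\xleftarrow{\partial_3^{\oplus4}}D^{8}\leftarrow\cdots$$ is a resolution of $\mathbb{Z}$ by projective left $R$-modules; the term in degree $n+2$ is $D^{2^n}$. (2) The integral homology of $BS$ satisfies $H_1(BS;\mathbb{Z})=0$ and $H_i(BS;\mathbb{Z})\cong\mathbb{Z}^{2^{i-2}}$ for all $i\ge 2$. -/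

import Mathlib

universe u

/-- A `Δ`-set: sets of `n`-simplices with face maps `d_i` satisfying
`d_i d_{j+1} = d_j d_i` for `i ≤ j`. -/
structure DeltaSet where
  /-- The set of `n`-simplices. -/
  simplex : ℕ → Type u
  /-- The face maps `d_0, …, d_{n+1}` on `(n+1)`-simplices. -/
  face : ∀ {n : ℕ}, Fin (n + 2) → simplex (n + 1) → simplex n
  face_face : ∀ {n : ℕ} (i j : Fin (n + 2)), i ≤ j → ∀ x : simplex (n + 2),
    face i (face j.succ x) = face j (face i.castSucc x)

namespace DeltaSet

/-- The disjoint union of one standard topological `n`-simplex for each `n`-simplex of `X`. -/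
abbrev Cells (X : DeltaSet.{u}) : Type u :=
  Σ p : (Σ n : ℕ, X.simplex n), stdSimplex ℝ (Fin (p.1 + 1))

/-- The gluing: a point `t` of the simplex `d_i x` is identified with its image in the simplex `x`
under the inclusion of the face opposite to the `i`-th vertex. -/
inductive Glue (X : DeltaSet.{u}) : X.Cells → X.Cells → Prop
  | face {n : ℕ} (i : Fin (n + 2)) (x : X.simplex (n + 1)) (t : stdSimplex ℝ (Fin (n + 1))) :
      Glue X ⟨⟨n, X.face i x⟩, t⟩ ⟨⟨n + 1, x⟩, stdSimplex.map i.succAbove t⟩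

/-- The geometric realization of a `Δ`-set. -/
def Realization (X : DeltaSet.{u}) : Type u := Quot X.Glue

instance (X : DeltaSet.{u}) : TopologicalSpace X.Realization :=
  inferInstanceAs (TopologicalSpace (Quot X.Glue))

end DeltaSet

namespace Semigroup

/-- The faces of a tuple: `d_0` drops the first entry, `d_i` multiplies the `i`-th and the
`(i+1)`-st entries for `0 < i < n + 1`, and `d_{n+1}` drops the last entry
(`Fin.contractNth j` drops the last entry when `j = Fin.last n`). -/
def nerveFace (S : Type u) [Semigroup S] {n : ℕ} (i : Fin (n + 2)) (x : Fin (n + 1) → S) :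
    Fin n → S :=
  Fin.cases (motive := fun _ => Fin n → S) (Fin.tail x)
    (fun j => Fin.contractNth j (· * ·) x) i

theorem nerveFace_zero (S : Type u) [Semigroup S] {n : ℕ} (x : Fin (n + 1) → S) :
    nerveFace S 0 x = fun k => x k.succ := rfl

theorem nerveFace_last (S : Type u) [Semigroup S] {n : ℕ} (x : Fin (n + 1) → S) :
    nerveFace S (Fin.last (n + 1)) x = fun k => x k.castSucc := by
  rw [← Fin.succ_last]
  funext k
  exact Fin.contractNth_apply_of_lt _ _ _ _ k.isLt

theorem nerveFace_succ (S : Type u) [Semigroup S] {n : ℕ} (j : Fin (n + 1))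
    (x : Fin (n + 1) → S) :
    nerveFace S j.succ x = Fin.contractNth j (· * ·) x := rfl

/-- The nerve of a semigroup, whose `n`-simplices are the `n`-tuples of elements. -/
def nerve (S : Type u) [Semigroup S] : DeltaSet.{u} where
  simplex n := Fin n → S
  face i x := nerveFace S i x
  face_face i j h x := by
    induction i using Fin.cases with
    | zero =>
      induction j using Fin.cases with
      | zero => funext k; rfl
      | succ j =>
        funext k
        simp only [nerveFace_succ, nerveFace_zero, Fin.castSucc_zero, Fin.contractNth,
          Fin.val_succ, Fin.castSucc_succ]
        grind
    | succ i =>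
      induction j using Fin.cases with
      | zero => exact absurd h (by simp)
      | succ j =>
        funext k
        have hij : i.val ≤ j.val := by simpa using h
        simp only [nerveFace_succ, Fin.contractNth, Fin.val_succ, Fin.castSucc_succ,
          Fin.val_castSucc]
        split_ifs <;> first | rfl | omega | exact mul_assoc _ _ _ | exact (mul_assoc _ _ _).symm

/-- The classifying space of a semigroup. -/
def classifyingSpace (S : Type u) [Semigroup S] : TopCat.{u} :=
  TopCat.of (nerve S).Realization

/-- The singular homology group `H_i(BS; ℤ)`. -/
noncomputable def classifyingSpaceHomology (S : Type) [Semigroup S] (i : ℕ) : ModuleCat.{0} ℤ :=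
  ((AlgebraicTopology.singularHomologyFunctor (ModuleCat.{0} ℤ) i).obj (ModuleCat.of ℤ ℤ)).obj
    (classifyingSpace S)

end Semigroup

/-- The set `{x₁₁, x₁₂, x₂₁, x₂₂, y₁₁, z₁₁}`; the indices `1, 2` are `0, 1 : Fin 2`. -/
inductive S6 : Type
  | x (i j : Fin 2)
  | y
  | z

namespace S6

/-- The first index `i` of `a_{ij}`. -/
def row : S6 → Fin 2
  | x i _ => i
  | y => 0
  | z => 0

/-- The second index `j` of `a_{ij}`. -/
def col : S6 → Fin 2
  | x _ j => j
  | y => 0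
  | z => 0

/-- The operation `a_{ij} b_{kl} = x_{il}`. -/
instance : Semigroup S6 where
  mul a b := x a.row b.col
  mul_assoc _ _ _ := rfl

theorem mul_def (a b : S6) : a * b = x a.row b.col := rfl

/-- The monoid ring `ℤ S¹` of the monoid `S¹` obtained by freely adjoining a unit. -/
abbrev Ring1 : Type := MonoidAlgebra ℤ (WithOne S6)

/-- An element of `S` as an element of `ℤ S¹`. -/
noncomputable def el (a : S6) : Ring1 := MonoidAlgebra.of ℤ (WithOne S6) (a : WithOne S6)

theorem el_mul (a b : S6) : el a * el b = el (a * b) := by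
  simp only [el, ← map_mul, WithOne.coe_mul]

/-- The augmentation `ℤ S¹ → ℤ`. -/
noncomputable def augmentation : Ring1 →+* ℤ :=
  (MonoidAlgebra.lift ℤ ℤ (WithOne S6) 1 : Ring1 →ₐ[ℤ] ℤ).toRingHom

/-- The left ideal `ℤ S¹ x₁₁`, as a left `ℤ S¹`-module. -/
noncomputable abbrev P : Submodule Ring1 Ring1 := Submodule.span Ring1 {el (x 0 0)}

theorem el_mem_P (i : Fin 2) : el (x i 0) ∈ P :=
  Submodule.mem_span_singleton.2 ⟨el (x i 0), el_mul _ _⟩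

/-- The group `ℤ` with the trivial action of `S¹`. -/
def TrivialZ : Type := ℤ

instance : AddCommGroup TrivialZ := inferInstanceAs (AddCommGroup ℤ)

noncomputable instance : Module Ring1 TrivialZ := Module.compHom ℤ augmentation

/-- The augmentation `ε : ℤ S¹ x₁₁ → ℤ`. -/
noncomputable def eps : P →ₗ[Ring1] TrivialZ where
  toFun p := augmentation p.1
  map_add' p q := map_add augmentation p.1 q.1
  map_smul' r p := map_mul augmentation r p.1

/-- Right multiplication by `m`, i.e. the linear map `ℤ S¹ → M`, `r ↦ r m`. -/
noncomputable abbrev rmul {M : Type} [AddCommGroup M] [Module Ring1 M] (m : M) :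
    Ring1 →ₗ[Ring1] M := LinearMap.toSpanSingleton Ring1 M m

/-- `∂₁ : ℤ S¹ → ℤ S¹ x₁₁`, `r ↦ r (x₂₁ - x₁₁)`. -/
noncomputable def d1 : Ring1 →ₗ[Ring1] P :=
  rmul ((⟨el (x 1 0), el_mem_P 1⟩ : P) - ⟨el (x 0 0), el_mem_P 0⟩)

/-- The module `D = ℤ S¹ x₁₁ ⊕ (ℤ S¹ x₁₁ ⊕ ℤ S¹ ⊕ ℤ S¹)`. -/
abbrev D : Type := P × (P × Ring1 × Ring1)

/-- `∂₂ : D → ℤ S¹`, `(q, p, a, b) ↦ q x₁₂ + p x₁₁ + a y₁₁ + b z₁₁`. -/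
noncomputable def d2 : D →ₗ[Ring1] Ring1 :=
  (rmul (el (x 0 1)) ∘ₗ P.subtype).coprod
    ((rmul (el (x 0 0)) ∘ₗ P.subtype).coprod ((rmul (el y)).coprod (rmul (el z))))

/-- `σ : D → ℤ S¹ x₁₁`, `(q, p, a, b) ↦ q x₁₁ + p x₁₁ + a x₁₁ + b x₁₁`. -/
noncomputable def sigma : D →ₗ[Ring1] P :=
  (rmul (⟨el (x 0 0), el_mem_P 0⟩ : P) ∘ₗ P.subtype).coprod
    ((rmul (⟨el (x 0 0), el_mem_P 0⟩ : P) ∘ₗ P.subtype).coprod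
      ((rmul (⟨el (x 0 0), el_mem_P 0⟩ : P)).coprod (rmul (⟨el (x 0 0), el_mem_P 0⟩ : P))))

/-- `∂₃ : D ⊕ D → D`, `(u, v) ↦ (0, σ(u) + σ(v), -∂₂(u), -∂₂(v))`. Ordering the summands of `D ⊕ D`
as `q, q'; p, a, b; p', a', b'`, the matrix of right multipliers to the last three summands of `D` is
`(x₁₁ x₁₁ x₁₁ x₁₁ x₁₁ x₁₁ x₁₁ x₁₁; -x₁₂ 0 -x₁₁ -y₁₁ -z₁₁ 0 0 0; 0 -x₁₂ 0 0 0 -x₁₁ -y₁₁ -z₁₁)`. -/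
noncomputable def d3 : D × D →ₗ[Ring1] D :=
  (0 : D × D →ₗ[Ring1] P).prod
    ((sigma.coprod sigma).prod
      ((-(d2 ∘ₗ LinearMap.fst Ring1 D D)).prod (-(d2 ∘ₗ LinearMap.snd Ring1 D D))))

/-- The module in degree `n + 2`: a sum of `2 ^ n` copies of `D`, indexed by binary words of
length `n`. -/
abbrev C (n : ℕ) : Type := (Fin n → Bool) → D

/-- The first map out of the doubling part, `∂₂ : C 0 = D → ℤ S¹`. -/
noncomputable def d2C : C 0 →ₗ[Ring1] Ring1 :=
  d2 ∘ₗ LinearMap.proj (R := Ring1) (φ := fun _ : Fin 0 → Bool => D) default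

/-- The map `∂ₙ₊₃ : C (n + 1) → C n`, which is a direct sum of `2 ^ n` copies of `∂₃`: the summand
of the word `w` receives the summands of the two words that extend `w` by one letter. -/
noncomputable def dC (n : ℕ) : C (n + 1) →ₗ[Ring1] C n :=
  LinearMap.pi fun w =>
    d3 ∘ₗ (LinearMap.proj (R := Ring1) (φ := fun _ : Fin (n + 1) → Bool => D)
        (Fin.snoc (α := fun _ => Bool) w false)).prod
      (LinearMap.proj (R := Ring1) (φ := fun _ : Fin (n + 1) → Bool => D)
        (Fin.snoc (α := fun _ => Bool) w true))

end S6

/-! Let `I` be the ideal of the elements of `ℤ S¹` whose coefficient at `1` vanishes. For `b` in `S`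
the product `b a` depends only on the row of `b` and the column of `a`. Hence `I` kills `x₂₁ - x₁₁`
from the left, and `ker ∂₁ = I = im ∂₂`. If `(q, p, a, b)` lies in `ker ∂₂`, the coefficients at
`y₁₁`, `z₁₁` and `x₁₂`, `x₂₂` force `a, b ∈ I` and `q = 0`; then `p = -(a + b) x₁₁` is determined.
So `ker ∂₂ ≅ I ⊕ I`, which two copies of `∂₂` cover: this is `∂₃`, since `σ(u) = ∂₂(u) x₁₁`. From
here the resolution repeats itself with doubling (`exists_d3_eq_iff`, `d3_eq_zero_iff`). `P` is
projective because `x₁₁` is idempotent.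

For the homology of the nerve, take the double complex of bar chains of `S` with coefficients in the
resolution. Its rows are exact because the resolution is. Its columns resolve the coinvariants
because each term is a retract of a finite free module (`exact_bar_of_retract`). So the nerve has
the homology of the coinvariants, where `∂₁` becomes `0`, `∂₂` becomes the sum `s` of four integers
and `∂₃` becomes `(u, v) ↦ (0, s(u) + s(v), -s(u), -s(v))`. Cycles satisfy `s = 0` in every block,
boundaries have first coordinate `0` besides, and each of the `2 ^ n` blocks contributes one `ℤ`.

It remains to identify singular homology of the realization with homology of the nerve. Let `Marked
k` be the space of points with `k` marked vertices of positive weight, in increasing order. `Marked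
1` is étale over the realization and plays the role of the cover by open stars; `Marked (k + 1)`
plays the role of the ordered `(k + 1)`-fold intersections. The singular chains of these spaces form
a second double complex. The lifts of a singular simplex to `Marked 1` are totally ordered, and its
lifts to `Marked (k + 1)` are the increasing tuples of them, so a row is a sum of chain complexes of
full simplices; coning with the lowest lift makes it exact (`exact_boundary_maps`). The rows resolve
the chains of liftable simplices, which carry the homology by barycentric subdivision
(`exists_sub_boundary_mem`). For a nerve, `Marked (k + 1)` contracts onto one point for each
`k`-simplex, by moving a point to the barycenter of its marked face (`exists_contraction`), so the
columns resolve the chains of the nerve. -/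

/-! ### Homology of complexes and double complexes -/

/-- The homology `ker g / im f` of a pair of maps of abelian groups (meaningful if `g ∘ f = 0`). -/
abbrev MiddleHomology {A B C : Type*} [AddCommGroup A] [AddCommGroup B] [AddCommGroup C]
    (f : A →+ B) (g : B →+ C) : Type _ :=
  g.ker ⧸ f.range.addSubgroupOf g.ker

namespace MiddleHomology

/-- No map between the complexes is needed: both homologies are quotients of one group `Z` of
matched cycles, and `iff` makes the two kernels equal. -/
theorem nonempty_equiv_of_span {A B C A' B' C' Z : Type*}
    [AddCommGroup A] [AddCommGroup B] [AddCommGroup C]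
    [AddCommGroup A'] [AddCommGroup B'] [AddCommGroup C'] [AddCommGroup Z]
    (f : A →+ B) (g : B →+ C) (f' : A' →+ B') (g' : B' →+ C')
    (φ : Z →+ B) (φ' : Z →+ B') (hφ : ∀ z, g (φ z) = 0) (hφ' : ∀ z, g' (φ' z) = 0)
    (surj : ∀ y, g y = 0 → ∃ z, φ z - y ∈ f.range)
    (surj' : ∀ y, g' y = 0 → ∃ z, φ' z - y ∈ f'.range)
    (iff : ∀ z, φ z ∈ f.range ↔ φ' z ∈ f'.range) :
    Nonempty (MiddleHomology f g ≃+ MiddleHomology f' g') := by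
  let ψ : Z →+ MiddleHomology f g :=
    (QuotientAddGroup.mk' _).comp (φ.codRestrict g.ker hφ)
  let ψ' : Z →+ MiddleHomology f' g' :=
    (QuotientAddGroup.mk' _).comp (φ'.codRestrict g'.ker hφ')
  have h1 : Function.Surjective ψ := by
    intro y
    obtain ⟨⟨y, hy⟩, rfl⟩ := QuotientAddGroup.mk_surjective y
    obtain ⟨z, hz⟩ := surj y hy
    refine ⟨z, ?_⟩
    refine (QuotientAddGroup.eq_iff_sub_mem).2 ?_
    exact AddSubgroup.mem_addSubgroupOf.2 hz
  have h2 : Function.Surjective ψ' := by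
    intro y
    obtain ⟨⟨y, hy⟩, rfl⟩ := QuotientAddGroup.mk_surjective y
    obtain ⟨z, hz⟩ := surj' y hy
    refine ⟨z, ?_⟩
    refine (QuotientAddGroup.eq_iff_sub_mem).2 ?_
    exact AddSubgroup.mem_addSubgroupOf.2 hz
  have h3 : ψ.ker = ψ'.ker := by
    ext z
    have e1 : z ∈ ψ.ker ↔ φ z ∈ f.range := by
      rw [AddMonoidHom.mem_ker]
      exact (QuotientAddGroup.eq_zero_iff _).trans Iff.rfl
    have e2 : z ∈ ψ'.ker ↔ φ' z ∈ f'.range := by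
      rw [AddMonoidHom.mem_ker]
      exact (QuotientAddGroup.eq_zero_iff _).trans Iff.rfl
    rw [e1, e2, iff]
  exact ⟨(QuotientAddGroup.quotientKerEquivOfSurjective ψ h1).symm.trans
    ((QuotientAddGroup.quotientAddEquivOfEq h3).trans
      (QuotientAddGroup.quotientKerEquivOfSurjective ψ' h2))⟩

end MiddleHomology

/-- If the rows of a double complex `D` augmented by `A` and its columns augmented by `B` are
exact, then `A` and `B` have the same homology. -/
theorem nonempty_homology_equiv_of_doubleComplex (n : ℕ) : ∀ {D : ℕ → ℕ → Type} {A B : ℕ → Type}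
    [∀ k q, AddCommGroup (D k q)] [∀ q, AddCommGroup (A q)] [∀ k, AddCommGroup (B k)]
    (dv : ∀ k q, D k (q + 1) →+ D k q) (dh : ∀ k q, D (k + 1) q →+ D k q)
    (dA : ∀ q, A (q + 1) →+ A q) (dB : ∀ k, B (k + 1) →+ B k)
    (a : ∀ q, D 0 q →+ A q) (b : ∀ k, D k 0 →+ B k)
    (_ : ∀ k q z, dv k q (dh k (q + 1) z) = dh k q (dv (k + 1) q z))
    (_ : ∀ q z, dA q (a (q + 1) z) = a q (dv 0 q z))
    (_ : ∀ k z, dB k (b (k + 1) z) = b k (dh k 0 z))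
    (_ : ∀ q, Function.Surjective (a q)) (_ : ∀ q, Function.Exact (dh 0 q) (a q))
    (_ : ∀ k q, Function.Exact (dh (k + 1) q) (dh k q))
    (_ : ∀ k, Function.Surjective (b k)) (_ : ∀ k, Function.Exact (dv k 0) (b k))
    (_ : ∀ k q, Function.Exact (dv k (q + 1)) (dv k q)),
    Nonempty (MiddleHomology (dA (n + 1)) (dA n) ≃+ MiddleHomology (dB (n + 1)) (dB n)) := by
  induction n with
  | zero =>
    intro D A B _ _ _ dv dh dA dB a b comm ca cb sa ea er sb eb ec
    -- In degree 1 the classes correspond through zigzags: elements of `D 0 1` and `D 1 0` with the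
    -- same image in `D 0 0`.
    let Z : AddSubgroup (D 0 1 × D 1 0) :=
      ((dv 0 0).comp (AddMonoidHom.fst _ _) - (dh 0 0).comp (AddMonoidHom.snd _ _)).ker
    have hZ : ∀ z : Z, dv 0 0 z.1.1 = dh 0 0 z.1.2 := fun z => sub_eq_zero.1 z.2
    have mk : ∀ (z : D 0 1) (w : D 1 0), dv 0 0 z = dh 0 0 w → (z, w) ∈ Z :=
      fun z w h => sub_eq_zero.2 h
    refine MiddleHomology.nonempty_equiv_of_span _ _ _ _
      ((a 1).comp ((AddMonoidHom.fst _ _).comp Z.subtype))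
      ((b 1).comp ((AddMonoidHom.snd _ _).comp Z.subtype)) ?_ ?_ ?_ ?_ ?_
    · intro z
      change dA 0 (a 1 z.1.1) = 0
      rw [ca, hZ, (ea 0).apply_apply_eq_zero]
    · intro z
      change dB 0 (b 1 z.1.2) = 0
      rw [cb, ← hZ, (eb 0).apply_apply_eq_zero]
    · intro y hy
      obtain ⟨z, rfl⟩ := sa 1 y
      rw [ca] at hy
      obtain ⟨w, hw⟩ := (ea 0 _).1 hy
      refine ⟨⟨(z, w), mk z w hw.symm⟩, ?_⟩
      simp
    · intro y hy
      obtain ⟨w, rfl⟩ := sb 1 y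
      rw [cb] at hy
      obtain ⟨z, hz⟩ := (eb 0 _).1 hy
      refine ⟨⟨(z, w), mk z w hz⟩, ?_⟩
      simp
    · rintro ⟨⟨z, w⟩, hzw⟩
      have hzw : dv 0 0 z = dh 0 0 w := hZ ⟨(z, w), hzw⟩
      change a 1 z ∈ _ ↔ b 1 w ∈ _
      constructor
      · rintro ⟨y, hy⟩
        obtain ⟨y, rfl⟩ := sa 2 y
        obtain ⟨v, hv⟩ := (ea 1 (z - dv 0 1 y)).1 (by rw [map_sub, ← ca, hy, sub_self])
        obtain ⟨u, hu⟩ := (er 0 0 (w - dv 1 0 v)).1 (by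
          rw [map_sub, ← comm, hv, map_sub, (ec 0 0).apply_apply_eq_zero, hzw, sub_zero, sub_self])
        refine ⟨b 2 u, ?_⟩
        change dB 1 (b 2 u) = b 1 w
        rw [cb, hu, map_sub, (eb 1).apply_apply_eq_zero, sub_zero]
      · rintro ⟨y, hy⟩
        obtain ⟨u, rfl⟩ := sb 2 y
        obtain ⟨v, hv⟩ := (eb 1 (w - dh 1 0 u)).1 (by rw [map_sub, ← cb, hy, sub_self])
        obtain ⟨y, hy⟩ := (ec 0 0 (z - dh 0 1 v)).1 (by
          rw [map_sub, comm, hv, map_sub, (er 0 0).apply_apply_eq_zero, hzw, sub_zero, sub_self])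
        refine ⟨a 2 y, ?_⟩
        change dA 1 (a 2 y) = a 1 z
        rw [ca, hy, map_sub, (ea 1).apply_apply_eq_zero, sub_zero]
  | succ n ih =>
    intro D A B _ _ _ dv dh dA dB a b comm ca cb sa ea er sb eb ec
    -- Dimension shift: `K` is the kernel of column 0 over `A`, and that column is exact in positive
    -- degrees, so degree `n + 2` of `A` becomes degree `n + 1` of `K`. By exactness of the rows,
    -- `K` is resolved by the columns from 1 on.
    let K : ℕ → Type := fun q => (a q).ker
    let _ : ∀ q, AddCommGroup (K q) := fun q => inferInstanceAs (AddCommGroup (a q).ker)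
    let dK : ∀ q, K (q + 1) →+ K q := fun q =>
      ((dv 0 q).comp (a (q + 1)).ker.subtype).codRestrict (a q).ker (fun z => by
        change a q (dv 0 q z.1) = 0
        rw [← ca, z.2, map_zero])
    let aK : ∀ q, D 1 q →+ K q := fun q =>
      (dh 0 q).codRestrict (a q).ker (fun z => (ea q).apply_apply_eq_zero z)
    obtain ⟨e⟩ := ih (D := fun k q => D (k + 1) q) (A := K) (B := fun k => B (k + 1))
      (fun k q => dv (k + 1) q) (fun k q => dh (k + 1) q) dK (fun k => dB (k + 1))
      aK (fun k => b (k + 1)) (fun k q z => comm (k + 1) q z)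
      (fun q z => Subtype.ext (comm 0 q z)) (fun k z => cb (k + 1) z)
      (fun q => by
        rintro ⟨z, hz⟩
        obtain ⟨w, hw⟩ := (ea q z).1 hz
        exact ⟨w, Subtype.ext hw⟩)
      (fun q z => by
        rw [← er 0 q z]
        exact Subtype.ext_iff)
      (fun k q => er (k + 1) q) (fun k => sb (k + 1)) (fun k => eb (k + 1))
      (fun k q => ec (k + 1) q)
    let Z : AddSubgroup (D 0 (n + 2)) := ((a (n + 1)).comp (dv 0 (n + 1))).ker
    let φ' : Z →+ K (n + 1) :=
      ((dv 0 (n + 1)).comp Z.subtype).codRestrict (a (n + 1)).ker (fun z => z.2)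
    have key : Nonempty (MiddleHomology (dA (n + 2)) (dA (n + 1)) ≃+
        MiddleHomology (dK (n + 1)) (dK n)) := by
      refine MiddleHomology.nonempty_equiv_of_span _ _ _ _ ((a (n + 2)).comp Z.subtype) φ'
        ?_ ?_ ?_ ?_ ?_
      · intro z
        change dA (n + 1) (a (n + 2) z.1) = 0
        rw [ca]
        exact z.2
      · intro z
        exact Subtype.ext ((ec 0 n).apply_apply_eq_zero z.1)
      · intro y hy
        obtain ⟨z, rfl⟩ := sa _ y
        rw [ca] at hy
        exact ⟨⟨z, hy⟩, by simp⟩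
      · rintro ⟨y, hy⟩ h
        obtain ⟨z, hz⟩ := (ec 0 n y).1 (congrArg Subtype.val h)
        refine ⟨⟨z, ?_⟩, ?_⟩
        · change a (n + 1) (dv 0 (n + 1) z) = 0
          rw [hz]; exact hy
        · have : φ' ⟨z, by change a (n + 1) (dv 0 (n + 1) z) = 0; rw [hz]; exact hy⟩ = ⟨y, hy⟩ :=
            Subtype.ext hz
          rw [this, sub_self]
          exact zero_mem _
      · rintro ⟨z, hz⟩
        change a (n + 2) z ∈ _ ↔ _
        constructor
        · rintro ⟨y, hy⟩
          obtain ⟨y, rfl⟩ := sa _ y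
          refine ⟨⟨z - dv 0 (n + 2) y, ?_⟩, Subtype.ext ?_⟩
          · change a (n + 2) (z - dv 0 (n + 2) y) = 0
            rw [map_sub, ← ca, hy, sub_self]
          · change dv 0 (n + 1) (z - dv 0 (n + 2) y) = dv 0 (n + 1) z
            rw [map_sub, (ec 0 (n + 1)).apply_apply_eq_zero, sub_zero]
        · rintro ⟨⟨y, hy⟩, h⟩
          have h : dv 0 (n + 1) y = dv 0 (n + 1) z := congrArg Subtype.val h
          obtain ⟨w, hw⟩ := (ec 0 (n + 1) (z - y)).1 (by rw [map_sub, h, sub_self])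
          refine ⟨a _ w, ?_⟩
          rw [ca, hw, map_sub, show a (n + 2) y = 0 from hy, sub_zero]
    obtain ⟨f⟩ := key
    exact ⟨f.trans e⟩

/-- A variant of `nonempty_homology_equiv_of_doubleComplex` where the augmentation of the rows is
surjective up to homology only. -/
theorem nonempty_homology_equiv_of_doubleComplex_of_small (n : ℕ) {D : ℕ → ℕ → Type}
    {A B : ℕ → Type}
    [∀ k q, AddCommGroup (D k q)] [∀ q, AddCommGroup (A q)] [∀ k, AddCommGroup (B k)]
    (dv : ∀ k q, D k (q + 1) →+ D k q) (dh : ∀ k q, D (k + 1) q →+ D k q)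
    (dA : ∀ q, A (q + 1) →+ A q) (dB : ∀ k, B (k + 1) →+ B k)
    (a : ∀ q, D 0 q →+ A q) (b : ∀ k, D k 0 →+ B k)
    (comm : ∀ k q z, dv k q (dh k (q + 1) z) = dh k q (dv (k + 1) q z))
    (ca : ∀ q z, dA q (a (q + 1) z) = a q (dv 0 q z))
    (cb : ∀ k z, dB k (b (k + 1) z) = b k (dh k 0 z))
    (dAdA : ∀ q z, dA q (dA (q + 1) z) = 0)
    (small : ∀ q z, dA q z ∈ (a q).range → ∃ w, z - dA (q + 1) w ∈ (a (q + 1)).range)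
    (ea : ∀ q, Function.Exact (dh 0 q) (a q))
    (er : ∀ k q, Function.Exact (dh (k + 1) q) (dh k q))
    (sb : ∀ k, Function.Surjective (b k)) (eb : ∀ k, Function.Exact (dv k 0) (b k))
    (ec : ∀ k q, Function.Exact (dv k (q + 1)) (dv k q)) :
    Nonempty (MiddleHomology (dA (n + 1)) (dA n) ≃+ MiddleHomology (dB (n + 1)) (dB n)) := by
  -- The rows resolve the image subcomplex `R` of `A`. Its inclusion preserves homology by `small`:
  -- applied to cycles this gives surjectivity, applied to a chain whose boundary lies in `R` it
  -- gives injectivity.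
  let R : ℕ → Type := fun q => (a q).range
  let _ : ∀ q, AddCommGroup (R q) := fun q => inferInstanceAs (AddCommGroup (a q).range)
  have hR : ∀ q (z : R (q + 1)), dA q z.1 ∈ (a q).range := by
    rintro q ⟨_, z, rfl⟩
    exact ⟨_, (ca q z).symm⟩
  let dR : ∀ q, R (q + 1) →+ R q := fun q =>
    ((dA q).comp (a (q + 1)).range.subtype).codRestrict (a q).range (hR q)
  obtain ⟨e⟩ := nonempty_homology_equiv_of_doubleComplex n dv dh dR dB
    (fun q => (a q).rangeRestrict) b comm (fun q z => Subtype.ext (ca q z)) cb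
    (fun q => (a q).rangeRestrict_surjective) (fun q z => by
      rw [← ea q z]
      exact Subtype.ext_iff) er sb eb ec
  have key : Nonempty (MiddleHomology (dA (n + 1)) (dA n) ≃+
      MiddleHomology (dR (n + 1)) (dR n)) := by
    refine MiddleHomology.nonempty_equiv_of_span _ _ _ _
      ((a (n + 1)).range.subtype.comp (dR n).ker.subtype) (dR n).ker.subtype
      (fun z => congrArg Subtype.val z.2) (fun z => z.2) ?_ ?_ ?_
    · intro y hy
      obtain ⟨w, hw⟩ := small n y (by rw [hy]; exact zero_mem _)
      refine ⟨⟨⟨_, hw⟩, Subtype.ext ?_⟩, ⟨-w, ?_⟩⟩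
      · change dA n (y - dA (n + 1) w) = 0
        rw [map_sub, dAdA, hy, sub_zero]
      · change _ = (y - dA (n + 1) w) - y
        rw [map_neg]; abel
    · intro y hy
      exact ⟨⟨y, hy⟩, by simp⟩
    · rintro ⟨z, hz⟩
      change z.1 ∈ _ ↔ z ∈ _
      constructor
      · rintro ⟨y, hy⟩
        obtain ⟨w, hw⟩ := small (n + 1) y (by rw [hy]; exact z.2)
        refine ⟨⟨_, hw⟩, Subtype.ext ?_⟩
        change dA (n + 1) (y - dA (n + 2) w) = _
        rw [map_sub, dAdA, hy, sub_zero]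
      · rintro ⟨y, rfl⟩
        exact ⟨y.1, rfl⟩
  obtain ⟨f⟩ := key
  exact ⟨f.trans e⟩

/-! ### Contracting homotopies, alternating sums and chains of `Δ`-sets -/

theorem AddMonoidHom.exact_of_contraction {A B C : Type*} [AddCommGroup A] [AddCommGroup B]
    [AddCommGroup C] (f : A →+ B) (g : B →+ C) (h : B →+ A) (h' : C →+ B)
    (gf : ∀ a, g (f a) = 0) (H : ∀ b, f (h b) + h' (g b) = b) : Function.Exact f g := by
  intro b
  refine ⟨fun hb => ⟨h b, ?_⟩, ?_⟩
  · simpa [hb] using H b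
  · rintro ⟨a, rfl⟩
    exact gf a

/-- The alternating sum of a finite sequence of homomorphisms. -/
def alternatingSum {A B : Type*} [AddCommGroup A] [AddCommGroup B] {n : ℕ} (δ : Fin n → A →+ B) :
    A →+ B :=
  ∑ i : Fin n, (-1 : ℤ) ^ (i : ℕ) • δ i

theorem alternatingSum_apply {A B : Type*} [AddCommGroup A] [AddCommGroup B] {n : ℕ}
    (δ : Fin n → A →+ B) (x : A) : alternatingSum δ x = ∑ i : Fin n, (-1 : ℤ) ^ (i : ℕ) • δ i x := by
  simp [alternatingSum, AddMonoidHom.finsetSum_apply]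

/-- For `j ≤ i` the term with indices `(i, j)` equals, with opposite sign, the one with indices `(j,
i + 1)`; this pairs off all terms. -/
theorem alternatingSum_alternatingSum {A B C : Type*} [AddCommGroup A] [AddCommGroup B]
    [AddCommGroup C] {n : ℕ} (δ : Fin (n + 2) → B →+ C) (δ' : Fin (n + 3) → A →+ B)
    (h : ∀ i j : Fin (n + 2), i ≤ j → ∀ x, δ i (δ' j.succ x) = δ j (δ' i.castSucc x)) (x : A) :
    alternatingSum δ (alternatingSum δ' x) = 0 := by
  simp only [alternatingSum_apply, map_sum, map_zsmul, Finset.smul_sum, smul_smul]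
  rw [Finset.sum_comm, ← Finset.sum_product']
  let P := Fin (n + 2) × Fin (n + 3)
  let S : Finset P := {ij : P | (ij.2 : ℕ) ≤ (ij.1 : ℕ)}
  rw [Finset.univ_product_univ, ← Finset.sum_add_sum_compl S, ← eq_neg_iff_add_eq_zero,
    ← Finset.sum_neg_distrib]
  let φ : ∀ ij : P, ij ∈ S → P := fun ij hij =>
    (Fin.castLT ij.2 (lt_of_le_of_lt (Finset.mem_filter.mp hij).right (Fin.is_lt ij.1)), ij.1.succ)
  apply Finset.sum_bij φ
  · intro ij hij
    simp_rw [S, φ, Finset.compl_filter, Finset.mem_filter_univ, Fin.val_succ,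
      Fin.val_castLT] at hij ⊢
    lia
  · rintro ⟨i, j⟩ hij ⟨i', j'⟩ hij' h
    rw [Prod.mk_inj]
    exact ⟨by simpa [φ] using! congr_arg Prod.snd h,
      by simpa [φ, Fin.castSucc_castLT] using! congr_arg Fin.castSucc (congr_arg Prod.fst h)⟩
  · rintro ⟨i', j'⟩ hij'
    simp_rw [S, Finset.compl_filter, Finset.mem_filter_univ, not_le] at hij'
    refine ⟨(j'.pred <| ?_, Fin.castSucc i'), ?_, ?_⟩
    · rintro rfl
      simp only [Fin.val_zero, not_lt_zero] at hij'
    · simpa [S] using! Nat.le_sub_one_of_lt hij'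
    · simp only [φ, Fin.castLT_castSucc, Fin.succ_pred]
  · rintro ⟨i, j⟩ hij
    have hij' : (j : ℕ) ≤ i := (Finset.mem_filter.mp hij).2
    have := h (Fin.castLT j (lt_of_le_of_lt hij' i.isLt)) i hij' x
    simp only [φ, this, Fin.castSucc_castLT, Fin.val_succ, Fin.val_castLT, ← neg_smul]
    congr 1
    ring

theorem map_alternatingSum {A B A' B' : Type*} [AddCommGroup A] [AddCommGroup B]
    [AddCommGroup A'] [AddCommGroup B'] {n : ℕ} (δ : Fin n → A →+ B) (δ' : Fin n → A' →+ B')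
    (f : A →+ A') (g : B →+ B') (h : ∀ i x, g (δ i x) = δ' i (f x)) (x : A) :
    g (alternatingSum δ x) = alternatingSum δ' (f x) := by
  simp [alternatingSum_apply, h]

namespace DeltaSet

/-- The differential on the simplicial chains of a `Δ`-set. -/
noncomputable def boundary (X : DeltaSet.{0}) (n : ℕ) :
    (X.simplex (n + 1) →₀ ℤ) →+ (X.simplex n →₀ ℤ) :=
  alternatingSum fun i => Finsupp.mapDomain.addMonoidHom (X.face i)

theorem boundary_single (X : DeltaSet.{0}) (n : ℕ) (x : X.simplex (n + 1)) :
    X.boundary n (Finsupp.single x 1) =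
      ∑ i : Fin (n + 2), (-1 : ℤ) ^ (i : ℕ) • Finsupp.single (X.face i x) 1 := by
  simp [boundary, alternatingSum_apply]

theorem boundary_boundary (X : DeltaSet.{0}) (n : ℕ) (x : X.simplex (n + 2) →₀ ℤ) :
    X.boundary n (X.boundary (n + 1) x) = 0 := by
  refine alternatingSum_alternatingSum _ _ (fun i j hij x => ?_) x
  simp only [Finsupp.mapDomain.addMonoidHom_apply, ← Finsupp.mapDomain_comp]
  congr 1
  funext x
  exact X.face_face i j hij x

theorem mapDomain_boundary (X Y : DeltaSet.{0}) (f : ∀ n, X.simplex n → Y.simplex n)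
    (hf : ∀ n (i : Fin (n + 2)) x, f n (X.face i x) = Y.face i (f (n + 1) x)) (n : ℕ)
    (x : X.simplex (n + 1) →₀ ℤ) :
    Finsupp.mapDomain (f n) (X.boundary n x) = Y.boundary n (Finsupp.mapDomain (f (n + 1)) x) := by
  refine map_alternatingSum (A := _ →₀ ℤ) (B := _ →₀ ℤ) (A' := _ →₀ ℤ) (B' := _ →₀ ℤ) _ _
    (Finsupp.mapDomain.addMonoidHom (f (n + 1)))
    (Finsupp.mapDomain.addMonoidHom (f n)) (fun i x => ?_) x
  simp only [Finsupp.mapDomain.addMonoidHom_apply, ← Finsupp.mapDomain_comp]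
  congr 1
  funext x
  exact hf n i x

end DeltaSet

theorem Finsupp.addHom_eq_of_single {X A : Type*} [AddCommGroup A] {f g : (X →₀ ℤ) →+ A}
    (h : ∀ x, f (Finsupp.single x 1) = g (Finsupp.single x 1)) (y : X →₀ ℤ) : f y = g y := by
  refine DFunLike.congr_fun (?_ : f = g) y
  ext x
  exact h x

/-- The homomorphism on a free abelian group with prescribed values on the basis. -/
noncomputable def Finsupp.freeLift {X A : Type*} [AddCommGroup A] (f : X → A) : (X →₀ ℤ) →+ A :=
  Finsupp.liftAddHom fun x => zmultiplesHom A (f x)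

@[simp]
theorem Finsupp.freeLift_single {X A : Type*} [AddCommGroup A] (f : X → A) (x : X) :
    Finsupp.freeLift f (Finsupp.single x 1) = f x := by
  simp [Finsupp.freeLift]

/-! ### The projective resolution over `ℤ S¹` -/

namespace S6

open MonoidAlgebra (coeff)

theorem coeff_el [DecidableEq S6] (a b : S6) :
    (el a).coeff (b : WithOne S6) = if a = b then 1 else 0 := by
  classical
  rw [el, MonoidAlgebra.of_apply, MonoidAlgebra.coeff_single, Finsupp.single_apply]
  simp only [WithOne.coe_inj]

theorem coeff_el_one (a : S6) : (el a).coeff (1 : WithOne S6) = 0 := by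
  simp [-zsmul_eq_mul, el]

theorem induction_ring1 {motive : Ring1 → Prop} (r : Ring1) (one : motive 1)
    (el : ∀ a, motive (el a)) (add : ∀ r s, motive r → motive s → motive (r + s))
    (neg : ∀ r, motive r → motive (-r)) : motive r := by
  have zero : motive 0 := by simpa using add _ _ one (neg _ one)
  have zsmul : ∀ (n : ℤ) r, motive r → motive (n • r) := by
    intro n r hr
    induction n with
    | zero => simpa using zero
    | succ n ih => rw [add_smul, one_smul]; exact add _ _ ih hr
    | pred n ih => rw [sub_smul, one_smul, sub_eq_add_neg]; exact add _ _ ih (neg _ hr)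
  induction r using MonoidAlgebra.induction_linear with
  | zero => exact zero
  | add r s hr hs => exact add r s hr hs
  | single g n =>
    have : MonoidAlgebra.single g n = n • MonoidAlgebra.of ℤ (WithOne S6) g := by simp
    rw [this]
    refine zsmul _ _ ?_
    refine WithOne.cases_on g ?_ el
    exact one

/-- The coefficients of `r` summed over the elements of `S` with first index `i`. -/
noncomputable def rowSum (i : Fin 2) (r : Ring1) : ℤ :=
  coeff r (x i 0) + coeff r (x i 1) + if i = 0 then coeff r y + coeff r z else 0

theorem eq_sum_coeff (r : Ring1) :
    r = coeff r 1 • (1 : Ring1) + coeff r (x 0 0) • el (x 0 0) + coeff r (x 0 1) • el (x 0 1)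
      + coeff r (x 1 0) • el (x 1 0) + coeff r (x 1 1) • el (x 1 1) + coeff r y • el y
      + coeff r z • el z := by
  classical
  induction r using induction_ring1 with
  | one => simp [-zsmul_eq_mul, MonoidAlgebra.one_def]
  | el a =>
    simp only [coeff_el, coeff_el_one]
    match a with
    | x 0 0 => simp
    | x 0 1 => simp
    | x 1 0 => simp
    | x 1 1 => simp
    | y => simp
    | z => simp
  | add r s hr hs =>
    nth_rewrite 1 [hr, hs]
    simp only [MonoidAlgebra.coeff_add, Finsupp.add_apply, add_smul]
    abel
  | neg r hr =>
    nth_rewrite 1 [hr]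
    simp only [MonoidAlgebra.coeff_neg, Finsupp.neg_apply, neg_smul]
    abel

/-- Left multiplication by an element of `S` remembers only its row, so of `r` only the coefficient
at `1` and the two row sums matter. All kernels and images below are computed from this formula. -/
theorem mul_el (r : Ring1) (a : S6) :
    r * el a = coeff r 1 • el a + rowSum 0 r • el (x 0 a.col) + rowSum 1 r • el (x 1 a.col) := by
  nth_rewrite 1 [eq_sum_coeff r]
  simp only [add_mul, smul_mul_assoc, one_mul, el_mul, mul_def, row, rowSum, add_smul, if_true,
    if_neg (one_ne_zero : (1 : Fin 2) ≠ 0), add_zero]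
  abel

theorem augmentation_el (a : S6) : augmentation (el a) = 1 := by
  simp [-zsmul_eq_mul, augmentation, el]

theorem augmentation_zsmul_el (n : ℤ) (a : S6) : augmentation (n • el a) = n := by
  rw [map_zsmul, augmentation_el]; simp

theorem eq_of_mem_P {p : Ring1} (hp : p ∈ P) :
    p = coeff p (x 0 0) • el (x 0 0) + coeff p (x 1 0) • el (x 1 0) := by
  classical
  obtain ⟨r, rfl⟩ := Submodule.mem_span_singleton.1 hp
  rw [smul_eq_mul, mul_el]
  simp [-zsmul_eq_mul, coeff_el, col, add_smul]

theorem mul_el_of_mem_P {p : Ring1} (hp : p ∈ P) (j : Fin 2) :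
    p * el (x 0 j) = coeff p (x 0 0) • el (x 0 j) + coeff p (x 1 0) • el (x 1 j) := by
  nth_rewrite 1 [eq_of_mem_P hp]
  simp [-zsmul_eq_mul, add_mul, el_mul, mul_def, row, col]

theorem mul_el_self_of_mem_P {p : Ring1} (hp : p ∈ P) : p * el (x 0 0) = p := by
  rw [mul_el_of_mem_P hp, ← eq_of_mem_P hp]

theorem coeff_one_of_mem_P {p : Ring1} (hp : p ∈ P) : coeff p 1 = 0 := by
  rw [eq_of_mem_P hp]
  simp [-zsmul_eq_mul, coeff_el_one]

theorem zsmul_add_zsmul_mem_P (m n : ℤ) : m • el (x 0 0) + n • el (x 1 0) ∈ P :=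
  add_mem (zsmul_mem (el_mem_P 0) m) (zsmul_mem (el_mem_P 1) n)

/-- The row sum terms of `r x₂₁` and `r x₁₁` agree because both factors have column 1; only the
coefficient at `1` survives. -/
theorem d1_apply (r : Ring1) : (d1 r : Ring1) = coeff r 1 • (el (x 1 0) - el (x 0 0)) := by
  have : (d1 r : Ring1) = r * el (x 1 0) - r * el (x 0 0) := by
    simp [-zsmul_eq_mul, d1, mul_sub]
  rw [this, mul_el, mul_el, smul_sub]
  simp only [col]
  abel

theorem d1_eq_zero_iff (r : Ring1) : d1 r = 0 ↔ coeff r 1 = 0 := by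
  classical
  constructor
  · intro h
    have h := congrArg (fun p : P => coeff p.1 (x 1 0)) h
    simpa [-zsmul_eq_mul, d1_apply, coeff_el] using h
  · intro h
    ext1
    rw [d1_apply, h, zero_smul]
    rfl

theorem eps_surjective : Function.Surjective eps := by
  intro n
  refine ⟨⟨HSMul.hSMul (α := ℤ) n (el (x 0 0)), zsmul_mem (el_mem_P 0) _⟩, ?_⟩
  exact augmentation_zsmul_el n _

theorem exact_d1_eps : Function.Exact d1 eps := by
  intro p
  constructor
  · intro h
    have h : augmentation p.1 = 0 := h
    rw [eq_of_mem_P p.2, map_add, augmentation_zsmul_el, augmentation_zsmul_el] at h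
    refine ⟨coeff p.1 (x 1 0) • 1, ?_⟩
    ext1
    rw [d1_apply]
    nth_rewrite 2 [eq_of_mem_P p.2]
    rw [eq_neg_of_add_eq_zero_left h]
    simp [-zsmul_eq_mul, MonoidAlgebra.one_def, sub_eq_neg_add]
  · rintro ⟨r, rfl⟩
    change augmentation (d1 r).1 = 0
    rw [d1_apply, map_zsmul, map_sub, augmentation_el, augmentation_el]
    simp [-zsmul_eq_mul]

theorem d2_apply (u : D) :
    d2 u = u.1.1 * el (x 0 1) + u.2.1.1 + u.2.2.1 * el y + u.2.2.2 * el z := by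
  simp [-zsmul_eq_mul, d2, mul_el_self_of_mem_P u.2.1.2, add_assoc]

/-- Each of `x₁₂`, `x₁₁`, `y₁₁`, `z₁₁` becomes `x₁₁` when multiplied by `x₁₁` on the right. Thus `σ`
vanishes where `∂₂` does, and `∂₃` has kernel `ker ∂₂ ⊕ ker ∂₂`. -/
theorem sigma_apply (u : D) : (sigma u : Ring1) = d2 u * el (x 0 0) := by
  simp [-zsmul_eq_mul, sigma, d2_apply, mul_el_self_of_mem_P u.2.1.2, add_mul, mul_assoc, el_mul, mul_def, row,
    col, add_assoc]

theorem sigma_eq_zero_of_d2_eq_zero {u : D} (h : d2 u = 0) : sigma u = 0 := by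
  ext1
  rw [sigma_apply, h, zero_mul]
  rfl

/-- The image of `∂₂` is `I = ℤ S`: the first copy of `P` supplies column 2, the second copy the `x`
in column 1, and the two free summands supply `y` and `z`. -/
theorem exists_d2_eq_iff (r : Ring1) : (∃ u, d2 u = r) ↔ coeff r 1 = 0 := by
  constructor
  · rintro ⟨u, rfl⟩
    rw [d2_apply, mul_el, mul_el, mul_el]
    simp [-zsmul_eq_mul, coeff_el_one, coeff_one_of_mem_P u.2.1.2]
  · intro h
    refine ⟨(⟨_, zsmul_add_zsmul_mem_P (coeff r (x 0 1)) (coeff r (x 1 1))⟩,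
      ⟨_, zsmul_add_zsmul_mem_P (coeff r (x 0 0)) (coeff r (x 1 0))⟩, coeff r y • 1,
      coeff r z • 1), ?_⟩
    rw [d2_apply]
    conv_rhs => rw [eq_sum_coeff r]
    simp only [add_mul, smul_mul_assoc, el_mul, mul_def, row, col, one_mul, h]
    simp [-zsmul_eq_mul]
    abel

theorem d3_apply (u v : D) : d3 (u, v) = (0, sigma u + sigma v, -d2 u, -d2 v) := by
  simp [-zsmul_eq_mul, d3]

theorem d3_eq_zero_iff (w : D × D) : d3 w = 0 ↔ d2 w.1 = 0 ∧ d2 w.2 = 0 := by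
  obtain ⟨u, v⟩ := w
  rw [d3_apply]
  constructor
  · intro h
    simpa using (Prod.ext_iff.1 (Prod.ext_iff.1 (Prod.ext_iff.1 h).2).2)
  · rintro ⟨hu, hv⟩
    dsimp only at hu hv
    simp [-zsmul_eq_mul, hu, hv, sigma_eq_zero_of_d2_eq_zero]

/-- In `q x₁₂ + p + a y + b z = 0` the coefficients at `y` and `z` give `a, b ∈ I`. Then `a y` and
`b z` lie in column 1, so the coefficients at column 2 give `q = 0`. Choose `u`, `v` with `∂₂ u =
-a` and `∂₂ v = -b`; the equation itself then says that `p = σ(u) + σ(v)`, because `r y = r z = r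
x₁₁` for `r ∈ I`. -/
theorem exists_d3_eq_iff (w : D) : (∃ u, d3 u = w) ↔ d2 w = 0 := by
  classical
  constructor
  · rintro ⟨⟨u, v⟩, rfl⟩
    rw [d3_apply, d2_apply]
    obtain ⟨r, hr⟩ : ∃ r, r = d2 u := ⟨_, rfl⟩
    obtain ⟨s, hs⟩ : ∃ s, s = d2 v := ⟨_, rfl⟩
    have hr1 : coeff r 1 = 0 := (exists_d2_eq_iff r).1 ⟨u, hr.symm⟩
    have hs1 : coeff s 1 = 0 := (exists_d2_eq_iff s).1 ⟨v, hs.symm⟩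
    simp only [Submodule.coe_add, sigma_apply, ← hr, ← hs, neg_mul]
    rw [mul_el r, mul_el s, mul_el r y, mul_el s z]
    simp only [hr1, hs1, col]
    simp [-zsmul_eq_mul]
    abel
  · obtain ⟨q, p, a, b⟩ := w
    intro h
    rw [d2_apply, mul_el_of_mem_P q.2, mul_el, mul_el] at h
    dsimp only at h
    have hc : ∀ g, coeff (coeff q.1 (x 0 0) • el (x 0 1) + coeff q.1 (x 1 0) • el (x 1 1) + p.1 +
        (coeff a 1 • el y + rowSum 0 a • el (x 0 y.col) + rowSum 1 a • el (x 1 y.col)) +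
        (coeff b 1 • el z + rowSum 0 b • el (x 0 z.col) + rowSum 1 b • el (x 1 z.col))) g = 0 := by
      intro g
      rw [h]
      rfl
    rw [eq_of_mem_P p.2] at hc
    have ha : coeff a 1 = 0 := by simpa [-zsmul_eq_mul, coeff_el, col] using hc y
    have hb : coeff b 1 = 0 := by simpa [-zsmul_eq_mul, coeff_el, col] using hc z
    have hq0 : coeff q.1 (x 0 0) = 0 := by simpa [-zsmul_eq_mul, coeff_el, col] using hc (x 0 1)
    have hq1 : coeff q.1 (x 1 0) = 0 := by simpa [-zsmul_eq_mul, coeff_el, col] using hc (x 1 1)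
    obtain ⟨u, hu⟩ := (exists_d2_eq_iff (-a)).2 (by simpa using ha)
    obtain ⟨v, hv⟩ := (exists_d2_eq_iff (-b)).2 (by simpa using hb)
    have hq : q = 0 := by
      ext1
      rw [eq_of_mem_P q.2, hq0, hq1]
      simp [-zsmul_eq_mul]
    refine ⟨(u, v), ?_⟩
    rw [d3_apply, hu, hv, hq, neg_neg, neg_neg]
    refine Prod.ext rfl (Prod.ext (Subtype.ext ?_) rfl)
    have : (sigma u + sigma v : Ring1) = -(a * el y) - b * el z := by
      rw [sigma_apply, sigma_apply, hu, hv, neg_mul, neg_mul, mul_el a, mul_el b, mul_el a y,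
        mul_el b z]
      simp [-zsmul_eq_mul, ha, hb, col]
      abel
    change (sigma u + sigma v : Ring1) = p
    rw [this, mul_el, mul_el]
    rw [hq0, hq1] at h
    rw [zero_smul, zero_smul, zero_add, zero_add] at h
    rw [add_assoc] at h
    rw [eq_neg_of_add_eq_zero_left h]
    abel

theorem exact_d2C_d1 : Function.Exact d2C d1 := by
  intro r
  rw [d1_eq_zero_iff, ← exists_d2_eq_iff]
  constructor
  · rintro ⟨u, rfl⟩
    exact ⟨fun _ => u, rfl⟩
  · rintro ⟨f, rfl⟩
    exact ⟨f default, rfl⟩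

theorem dC_apply (n : ℕ) (f : C (n + 1)) (w : Fin n → Bool) :
    dC n f w = d3 (f (Fin.snoc (α := fun _ => Bool) w false),
      f (Fin.snoc (α := fun _ => Bool) w true)) := rfl

theorem forall_word_succ {n : ℕ} {p : (Fin (n + 1) → Bool) → Prop} :
    (∀ w, p w) ↔ ∀ w : Fin n → Bool, p (Fin.snoc (α := fun _ => Bool) w false) ∧
      p (Fin.snoc (α := fun _ => Bool) w true) := by
  refine ⟨fun h w => ⟨h _, h _⟩, fun h w => ?_⟩
  rw [← Fin.snoc_init_self (α := fun _ => Bool) w]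
  cases w (Fin.last n)
  · exact (h _).1
  · exact (h _).2

theorem dC_eq_zero_iff (n : ℕ) (f : C (n + 1)) : dC n f = 0 ↔ ∀ w, d2 (f w) = 0 := by
  rw [forall_word_succ, funext_iff]
  exact forall_congr' fun w => d3_eq_zero_iff _

theorem exists_dC_eq_iff (n : ℕ) (f : C n) : (∃ g, dC n g = f) ↔ ∀ w, d2 (f w) = 0 := by
  constructor
  · rintro ⟨g, rfl⟩ w
    exact (exists_d3_eq_iff _).1 ⟨_, rfl⟩
  · intro h
    choose u hu using fun w => (exists_d3_eq_iff _).2 (h w)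
    -- The last letter selects which half of the preimage pair belonging to the shortened word is
    -- used.
    refine ⟨fun w => bif w (Fin.last n) then (u (Fin.init w)).2 else (u (Fin.init w)).1, ?_⟩
    funext w
    simp [-zsmul_eq_mul, dC_apply, ← hu w]

theorem exact_dC_d2C : Function.Exact (dC 0) d2C := by
  intro f
  refine Iff.trans ?_ (exists_dC_eq_iff 0 f).symm
  exact ⟨fun h w => by rwa [Subsingleton.elim w default], fun h => h default⟩

theorem exact_dC_dC (n : ℕ) : Function.Exact (dC (n + 1)) (dC n) := fun f =>
  (dC_eq_zero_iff n f).trans (exists_dC_eq_iff (n + 1) f).symm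

/-- The retraction `r ↦ r x₁₁` of `ℤ S¹` onto `P`. -/
noncomputable def toP : Ring1 →ₗ[Ring1] P := rmul (⟨el (x 0 0), el_mem_P 0⟩ : P)

theorem toP_apply_coe (p : P) : toP p = p := by
  ext1
  exact mul_el_self_of_mem_P p.2

instance projective_P : Module.Projective Ring1 P :=
  Module.Projective.of_split P.subtype toP (LinearMap.ext toP_apply_coe)

theorem projective_C (n : ℕ) : Module.Projective Ring1 (C n) :=
  Module.Projective.of_equiv (DirectSum.linearEquivFunOnFintype Ring1 (Fin n → Bool) fun _ => D)

end S6

/-! ### The bar complex with coefficients -/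

theorem Function.Exact.finsupp_mapRange {I A B C : Type*} [AddCommGroup A] [AddCommGroup B]
    [AddCommGroup C] {f : A →+ B} {g : B →+ C} (h : Function.Exact f g) :
    Function.Exact (Finsupp.mapRange.addMonoidHom (ι := I) f)
      (Finsupp.mapRange.addMonoidHom (ι := I) g) := by
  classical
  intro z
  constructor
  · intro hz
    -- Preimages are chosen to be `0` wherever `z` is `0`, so that the chosen family has finite
    -- support.
    have hz' : ∀ i, ∃ a, f a = z i ∧ (z i = 0 → a = 0) := by
      intro i
      by_cases h0 : z i = 0
      · exact ⟨0, by simp [h0], fun _ => rfl⟩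
      · obtain ⟨a, ha⟩ := (h (z i)).1 (by simpa using DFunLike.congr_fun hz i)
        exact ⟨a, ha, fun h => absurd h h0⟩
    choose a ha ha0 using hz'
    refine ⟨Finsupp.onFinset z.support a fun i hi => ?_, ?_⟩
    · rw [Finsupp.mem_support_iff]
      exact fun h => hi (ha0 i h)
    · ext i
      simp [ha]
  · rintro ⟨y, rfl⟩
    ext i
    simp [h.apply_apply_eq_zero]

theorem Finsupp.mapRange_addMonoidHom_surjective {I A B : Type*} [AddCommGroup A] [AddCommGroup B]
    {f : A →+ B} (h : Function.Surjective f) :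
    Function.Surjective (Finsupp.mapRange.addMonoidHom (ι := I) f) :=
  Finsupp.mapRange_surjective f f.map_zero h

theorem MiddleHomology.nonempty_equiv_of_ker {A B C M : Type*}
    [AddCommGroup A] [AddCommGroup B] [AddCommGroup C] [AddCommGroup M]
    (f : A →+ B) (g : B →+ C) (φ : B →+ M) (surj : ∀ m, ∃ y, g y = 0 ∧ φ y = m)
    (iff : ∀ y, g y = 0 → (φ y = 0 ↔ y ∈ f.range)) : Nonempty (MiddleHomology f g ≃+ M) := by
  have h : f.range.addSubgroupOf g.ker = (φ.comp g.ker.subtype).ker := by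
    ext y
    exact (iff y.1 y.2).symm
  have hs : Function.Surjective (φ.comp g.ker.subtype) := by
    intro m
    obtain ⟨y, hy, rfl⟩ := surj m
    exact ⟨⟨y, hy⟩, rfl⟩
  exact ⟨(QuotientAddGroup.quotientAddEquivOfEq h).trans
    (QuotientAddGroup.quotientKerEquivOfSurjective _ hs)⟩

namespace Semigroup

variable {S : Type} [Semigroup S]

theorem nerveFace_castSucc_last {n : ℕ} (i : Fin (n + 2)) (s : Fin (n + 2) → S) :
    nerveFace S i.castSucc s (Fin.last n) =
      if i = Fin.last (n + 1) then s (Fin.last n).castSucc * s (Fin.last (n + 1))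
      else s (Fin.last (n + 1)) := by
  induction i using Fin.cases with
  | zero =>
    rw [if_neg (by simp [Fin.ext_iff])]
    rfl
  | succ i =>
    rw [← Fin.succ_castSucc, nerveFace_succ]
    simp only [Fin.contractNth, Fin.val_castSucc, Fin.val_last, Fin.ext_iff, Fin.val_succ]
    have := i.isLt
    split_ifs <;> first | omega | rfl

theorem nerveFace_snoc {n : ℕ} (i : Fin (n + 1)) (s : Fin (n + 1) → S) (a : S) :
    nerveFace S i.castSucc.castSucc (Fin.snoc (α := fun _ => S) s a) =
      Fin.snoc (α := fun _ => S) (nerveFace S i.castSucc s) a := by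
  funext k
  induction i using Fin.cases with
  | zero =>
    change Fin.snoc (α := fun _ => S) s a k.succ = _
    simp only [Fin.snoc, Fin.val_succ]
    split_ifs with h1 h2 h2
    · rfl
    · omega
    · omega
    · rfl
  | succ i =>
    rw [← Fin.succ_castSucc, ← Fin.succ_castSucc, nerveFace_succ, nerveFace_succ]
    have := i.isLt
    simp only [Fin.contractNth, Fin.snoc, Fin.val_castSucc, Fin.val_succ, Fin.val_castLT, cast_eq]
    split_ifs <;> first | omega | rfl

theorem nerveFace_last_castSucc_snoc {n : ℕ} (s : Fin (n + 1) → S) (a : S) :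
    nerveFace S (Fin.last (n + 1)).castSucc (Fin.snoc (α := fun _ => S) s a) =
      Fin.snoc (α := fun _ => S) (nerveFace S (Fin.last (n + 1)) s) (s (Fin.last n) * a) := by
  funext k
  rw [nerveFace_last, ← Fin.succ_last, ← Fin.succ_castSucc, nerveFace_succ]
  simp only [Fin.contractNth, Fin.snoc, Fin.val_castSucc, Fin.val_succ, cast_eq, Fin.val_last]
  have := k.isLt
  split_ifs <;> first | omega | rfl | skip
  all_goals
    congr 2
    ext
    simp
    omega

theorem nerveFace_last_snoc {n : ℕ} (s : Fin n → S) (a : S) :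
    nerveFace S (Fin.last (n + 1)) (Fin.snoc (α := fun _ => S) s a) = s := by
  funext k
  rw [nerveFace_last]
  simp

end Semigroup

namespace S6

open MonoidAlgebra (coeff)
open Semigroup

section Bar

variable {F : Type} [AddCommGroup F] [Module Ring1 F]

/-- The action of the `i`-th face of the tuple `s` on coefficients: the last face multiplies by the
last entry of `s`, the other faces act trivially. -/
noncomputable def barAct (F : Type) [AddCommGroup F] [Module Ring1 F] {q : ℕ} (i : Fin (q + 2))
    (s : Fin (q + 1) → S6) : F →+ F :=
  if i = Fin.last (q + 1) then DistribSMul.toAddMonoidHom F (el (s (Fin.last q)))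
  else AddMonoidHom.id F

theorem barAct_last {q : ℕ} (s : Fin (q + 1) → S6) (m : F) :
    barAct F (Fin.last (q + 1)) s m = el (s (Fin.last q)) • m := by
  simp [barAct]

theorem barAct_of_ne {q : ℕ} {i : Fin (q + 2)} (hi : i ≠ Fin.last (q + 1)) (s : Fin (q + 1) → S6)
    (m : F) : barAct F i s m = m := by
  simp [barAct, hi]

/-- The face maps of the bar complex of `S` with coefficients in `F`. -/
noncomputable def barFace (F : Type) [AddCommGroup F] [Module Ring1 F] {q : ℕ} (i : Fin (q + 2)) :
    ((Fin (q + 1) → S6) →₀ F) →+ ((Fin q → S6) →₀ F) :=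
  Finsupp.liftAddHom fun s => (Finsupp.singleAddHom (nerveFace S6 i s)).comp (barAct F i s)

theorem barFace_single {q : ℕ} (i : Fin (q + 2)) (s : Fin (q + 1) → S6) (m : F) :
    barFace F i (Finsupp.single s m) = Finsupp.single (nerveFace S6 i s) (barAct F i s m) := by
  simp [barFace]

/-- The coefficients matter most when `i` and `j` are both the last index: acting by the last two
entries in turn is acting by their product, which is the last entry after the face `i.castSucc`. -/
theorem barFace_barFace {q : ℕ} (i j : Fin (q + 2)) (h : i ≤ j) (z : (Fin (q + 2) → S6) →₀ F) :
    barFace F i (barFace F j.succ z) = barFace F j (barFace F i.castSucc z) := by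
  induction z using Finsupp.induction_linear with
  | zero => simp
  | add y z hy hz => simp only [map_add, hy, hz]
  | single s m =>
    simp only [barFace_single]
    rw [show nerveFace S6 i (nerveFace S6 j.succ s) = nerveFace S6 j (nerveFace S6 i.castSucc s)
      from (nerve S6).face_face i j h s]
    congr 1
    rw [barAct_of_ne (Fin.castSucc_lt_last i).ne]
    by_cases hj : j = Fin.last (q + 1)
    · subst hj
      rw [Fin.succ_last, barAct_last, barAct_last, nerveFace_castSucc_last]
      by_cases hi : i = Fin.last (q + 1)
      · subst hi
        rw [barAct_last, if_pos rfl, smul_smul, el_mul, nerveFace_last]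
      · rw [barAct_of_ne hi, if_neg hi]
    · have hi : i ≠ Fin.last (q + 1) := fun e => hj (Fin.last_le_iff.1 (e ▸ h))
      rw [barAct_of_ne hi, barAct_of_ne hj, barAct_of_ne]
      rw [← Fin.succ_last]
      exact fun e => hj (Fin.succ_injective _ e)

/-- The differential of the bar complex of `S` with coefficients in `F`. -/
noncomputable def barD (F : Type) [AddCommGroup F] [Module Ring1 F] (q : ℕ) :
    ((Fin (q + 1) → S6) →₀ F) →+ ((Fin q → S6) →₀ F) :=
  alternatingSum (barFace F)

theorem barD_barD (q : ℕ) (z : (Fin (q + 2) → S6) →₀ F) : barD F q (barD F (q + 1) z) = 0 :=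
  alternatingSum_alternatingSum _ _ barFace_barFace z

theorem barD_single (q : ℕ) (s : Fin (q + 1) → S6) (m : F) :
    barD F q (Finsupp.single s m) =
      (∑ i : Fin (q + 1), (-1 : ℤ) ^ (i : ℕ) • Finsupp.single (nerveFace S6 i.castSucc s) m) +
        (-1 : ℤ) ^ (q + 1) •
          Finsupp.single (nerveFace S6 (Fin.last (q + 1)) s) (el (s (Fin.last q)) • m) := by
  rw [barD, alternatingSum_apply, Fin.sum_univ_castSucc]
  simp only [barFace_single, barAct_last, barAct_of_ne (Fin.castSucc_lt_last _).ne,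
    Fin.val_castSucc, Fin.val_last]

theorem mapRange_barD {F' : Type} [AddCommGroup F'] [Module Ring1 F'] (φ : F →ₗ[Ring1] F') (q : ℕ)
    (z : (Fin (q + 1) → S6) →₀ F) :
    Finsupp.mapRange.addMonoidHom φ.toAddMonoidHom (barD F q z) =
      barD F' q (Finsupp.mapRange.addMonoidHom φ.toAddMonoidHom z) := by
  refine map_alternatingSum _ _ (Finsupp.mapRange.addMonoidHom φ.toAddMonoidHom)
    (Finsupp.mapRange.addMonoidHom φ.toAddMonoidHom) (fun i z => ?_) z
  induction z using Finsupp.induction_linear with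
  | zero => simp
  | add y z hy hz => simp only [map_add, hy, hz]
  | single s m =>
    simp only [barFace_single, Finsupp.mapRange.addMonoidHom_apply, Finsupp.mapRange_single]
    congr 1
    simp only [barAct]
    split_ifs <;> simp

/-- The contracting homotopy of the bar complex with coefficients in `ℤ S¹`, which sends `s ⊗ a` to
`(s, a) ⊗ 1` and `s ⊗ 1` to `0`. -/
noncomputable def barContraction (q : ℕ) :
    ((Fin q → S6) →₀ Ring1) →+ ((Fin (q + 1) → S6) →₀ Ring1) :=
  Finsupp.liftAddHom fun s =>
    (Finsupp.freeLift fun g : WithOne S6 => WithOne.recOneCoe (motive := fun _ => _ →₀ Ring1) 0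
      (fun a => Finsupp.single (Fin.snoc (α := fun _ => S6) s a) 1) g).comp
        MonoidAlgebra.coeffAddEquiv.toAddMonoidHom

theorem barContraction_single_one {q : ℕ} (s : Fin q → S6) :
    barContraction q (Finsupp.single s 1) = 0 := by
  simp [barContraction, MonoidAlgebra.one_def]

theorem barContraction_single_el {q : ℕ} (s : Fin q → S6) (a : S6) :
    barContraction q (Finsupp.single s (el a)) =
      Finsupp.single (Fin.snoc (α := fun _ => S6) s a) 1 := by
  simp [barContraction, el]

/-- The homotopy appends at the end of a tuple, whence the sign `(-1) ^ q`. On `s ⊗ 1` only the last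
face contributes, and appending restores `s`. On `s ⊗ a` the last face of `(s, a) ⊗ 1` returns `s ⊗
a`, and all other faces cancel against the homotopy of the faces of `s ⊗ a`. -/
theorem barD_barContraction_sub (q : ℕ) (z : (Fin (q + 1) → S6) →₀ Ring1) :
    barD Ring1 (q + 1) (barContraction (q + 1) z) - barContraction q (barD Ring1 q z) =
      (-1 : ℤ) ^ q • z := by
  induction z using Finsupp.induction_linear with
  | zero => simp
  | add y z hy hz =>
    simp only [map_add, smul_add, ← hy, ← hz]
    abel
  | single s r =>
    induction r using induction_ring1 with
    | add r r' hr hr' =>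
      simp only [Finsupp.single_add, map_add, smul_add, ← hr, ← hr']
      abel
    | neg r hr =>
      simp only [Finsupp.single_neg, map_neg, smul_neg, ← hr]
      abel
    | one =>
      rw [barContraction_single_one, barD_single]
      simp only [map_add, map_sum, map_zsmul, barContraction_single_one, smul_eq_mul, mul_one,
        barContraction_single_el, map_zero, smul_zero, Finset.sum_const_zero, zero_add, zero_sub,
        pow_succ, mul_neg, neg_smul, map_neg, neg_neg]
      rw [nerveFace_last]
      congr 2
      exact Fin.snoc_init_self s
    | el a =>
      rw [barContraction_single_el, barD_single, barD_single, Fin.sum_univ_castSucc]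
      simp only [map_add, map_sum, map_zsmul, smul_eq_mul, mul_one, el_mul, nerveFace_snoc,
        barContraction_single_el, Fin.val_castSucc, Fin.val_last, nerveFace_last_castSucc_snoc,
        nerveFace_last_snoc, Fin.snoc_last]
      rw [pow_add (-1 : ℤ) q 2, neg_one_sq, mul_one]
      abel

/-- In the lowest degree the boundary of `(a) ⊗ 1` is `1 - a`, so the homotopy contracts only the
augmentation ideal. -/
theorem barD_barContraction_zero (z : (Fin 0 → S6) →₀ Ring1) :
    barD Ring1 0 (barContraction 0 z) =
      Finsupp.single default (augmentation (z default) • 1) - z := by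
  induction z using Finsupp.induction_linear with
  | zero => simp
  | add y z hy hz =>
    simp only [map_add, hy, hz, Finsupp.add_apply, add_smul, Finsupp.single_add]
    abel
  | single s r =>
    obtain rfl : s = default := Subsingleton.elim _ _
    induction r using induction_ring1 with
    | add r r' hr hr' =>
      simp only [Finsupp.single_add, map_add, hr, hr', Finsupp.add_apply, add_smul]
      abel
    | neg r hr =>
      simp only [Finsupp.single_neg, map_neg, hr, Finsupp.neg_apply, neg_smul]
      abel
    | one => simp [barContraction_single_one]
    | el a =>
      rw [barContraction_single_el, barD_single]
      simp [augmentation_el]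
      rw [sub_eq_add_neg]
      congr 2
      · exact Subsingleton.elim _ _
      · congr 1
        exact Subsingleton.elim _ _

/-- If `F` is a retract of a finite free `ℤ S¹`-module, then the bar complex with coefficients in
`F` resolves the coinvariants of `F`. -/
theorem exact_bar_of_retract {J B : Type} [Fintype J] [AddCommGroup B] (ι : J → Ring1 →ₗ[Ring1] F)
    (π : J → F →ₗ[Ring1] Ring1) (hιπ : ∀ m, ∑ j, ι j (π j m) = m) (b : F →+ B)
    (hb : ∀ m, b m = 0 → ∀ j, augmentation (π j m) = 0) (hb' : ∀ s m, b (el s • m) = b m) :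
    Function.Exact (barD F 0) (b.comp (Finsupp.applyAddHom default)) ∧
      ∀ q, Function.Exact (barD F (q + 1)) (barD F q) := by
  -- It suffices to solve the equation in `ℤ S¹` after each projection `π j`: the maps `ι j` commute
  -- with the differentials and reassemble the solutions.
  have key : ∀ q (z : (Fin q → S6) →₀ F), (∀ j, ∃ w, barD Ring1 q w =
      Finsupp.mapRange.addMonoidHom (π j).toAddMonoidHom z) → ∃ w, barD F q w = z := by
    intro q z h
    choose w hw using h
    refine ⟨∑ j, Finsupp.mapRange.addMonoidHom (ι j).toAddMonoidHom (w j), ?_⟩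
    simp only [map_sum, ← mapRange_barD, hw]
    ext s
    simpa [Finsupp.finsetSum_apply] using hιπ (z s)
  constructor
  · intro z
    constructor
    · intro hz
      refine key 0 z fun j => ⟨-barContraction 0 (Finsupp.mapRange.addMonoidHom
        (π j).toAddMonoidHom z), ?_⟩
      have := hb _ hz j
      rw [map_neg, barD_barContraction_zero]
      simp at this
      simp [this]
    · rintro ⟨w, rfl⟩
      induction w using Finsupp.induction_linear with
      | zero => simp
      | add y z hy hz => rw [map_add, map_add, hy, hz, add_zero]
      | single s m =>
        rw [barD_single]
        simp [Subsingleton.elim _ (default : Fin 0 → S6), hb']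
  · intro q z
    constructor
    · intro hz
      refine key (q + 1) z fun j => ⟨(-1 : ℤ) ^ q • barContraction (q + 1)
        (Finsupp.mapRange.addMonoidHom (π j).toAddMonoidHom z), ?_⟩
      have := barD_barContraction_sub q (Finsupp.mapRange.addMonoidHom (π j).toAddMonoidHom z)
      rw [← mapRange_barD, hz, map_zero, map_zero, sub_zero] at this
      rw [map_zsmul, this, smul_smul, ← mul_pow]
      simp
    · rintro ⟨w, rfl⟩
      exact barD_barD q w

end Bar

end S6

/-! ### Homology of the nerve through the coinvariants of the resolution -/

namespace S6

open Semigroup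

/-- The terms of the resolution. -/
def Res : ℕ → Type
  | 0 => P
  | 1 => Ring1
  | n + 2 => C n

noncomputable instance (n : ℕ) : AddCommGroup (Res n) :=
  match n with
  | 0 => inferInstanceAs (AddCommGroup P)
  | 1 => inferInstanceAs (AddCommGroup Ring1)
  | n + 2 => inferInstanceAs (AddCommGroup (C n))

noncomputable instance (n : ℕ) : Module Ring1 (Res n) :=
  match n with
  | 0 => inferInstanceAs (Module Ring1 P)
  | 1 => inferInstanceAs (Module Ring1 Ring1)
  | n + 2 => inferInstanceAs (Module Ring1 (C n))

/-- The differentials of the resolution. -/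
noncomputable def resD : ∀ n, Res (n + 1) →ₗ[Ring1] Res n
  | 0 => d1
  | 1 => d2C
  | n + 2 => dC n

theorem exact_resD : ∀ n, Function.Exact (resD (n + 1)) (resD n)
  | 0 => exact_d2C_d1
  | 1 => exact_dC_d2C
  | n + 2 => exact_dC_dC n

/-- The augmentation on the summands of `D`. -/
noncomputable def augD : D →+ ℤ × ℤ × ℤ × ℤ :=
  (augmentation.toAddMonoidHom.comp P.subtype.toAddMonoidHom).prodMap
    ((augmentation.toAddMonoidHom.comp P.subtype.toAddMonoidHom).prodMap
      (augmentation.toAddMonoidHom.prodMap augmentation.toAddMonoidHom))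

theorem augD_apply (u : D) : augD u = (augmentation u.1, augmentation u.2.1,
    augmentation u.2.2.1, augmentation u.2.2.2) := rfl

/-- The coinvariants of the terms of the resolution. -/
def Coinv : ℕ → Type
  | 0 => ℤ
  | 1 => ℤ
  | n + 2 => (Fin n → Bool) → ℤ × ℤ × ℤ × ℤ

instance (n : ℕ) : AddCommGroup (Coinv n) :=
  match n with
  | 0 => inferInstanceAs (AddCommGroup ℤ)
  | 1 => inferInstanceAs (AddCommGroup ℤ)
  | n + 2 => inferInstanceAs (AddCommGroup ((Fin n → Bool) → ℤ × ℤ × ℤ × ℤ))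

/-- The projections onto the coinvariants. -/
noncomputable def toCoinv : ∀ n, Res n →+ Coinv n
  | 0 => augmentation.toAddMonoidHom.comp P.subtype.toAddMonoidHom
  | 1 => augmentation.toAddMonoidHom
  | _ + 2 => AddMonoidHom.compLeft augD _

/-- The sum of the coordinates. -/
def sumCoords : ℤ × ℤ × ℤ × ℤ →+ ℤ where
  toFun u := u.1 + u.2.1 + u.2.2.1 + u.2.2.2
  map_zero' := rfl
  map_add' u v := by simp only [Prod.fst_add, Prod.snd_add]; ring

/-- The map induced by `∂₃` on coinvariants. -/
def coinvD3 : (ℤ × ℤ × ℤ × ℤ) × (ℤ × ℤ × ℤ × ℤ) →+ ℤ × ℤ × ℤ × ℤ :=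
  (0 : _ →+ ℤ).prod ((sumCoords.coprod sumCoords).prod
    ((-(sumCoords.comp (AddMonoidHom.fst _ _))).prod (-(sumCoords.comp (AddMonoidHom.snd _ _)))))

theorem coinvD3_apply (u v : ℤ × ℤ × ℤ × ℤ) :
    coinvD3 (u, v) = (0, sumCoords u + sumCoords v, -sumCoords u, -sumCoords v) := rfl

/-- The differentials induced on coinvariants. -/
def coinvD : ∀ n, Coinv (n + 1) →+ Coinv n
  | 0 => (0 : ℤ →+ ℤ)
  | 1 => sumCoords.comp (Pi.evalAddMonoidHom (fun _ : Fin 0 → Bool => ℤ × ℤ × ℤ × ℤ) default)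
  | n + 2 => AddMonoidHom.pi fun w : Fin n → Bool => coinvD3.comp
      ((Pi.evalAddMonoidHom (fun _ : Fin (n + 1) → Bool => ℤ × ℤ × ℤ × ℤ)
        (Fin.snoc (α := fun _ => Bool) w false)).prod
          (Pi.evalAddMonoidHom (fun _ : Fin (n + 1) → Bool => ℤ × ℤ × ℤ × ℤ)
            (Fin.snoc (α := fun _ => Bool) w true)))

theorem coinvD_add_two_apply (n : ℕ) (f : (Fin (n + 1) → Bool) → ℤ × ℤ × ℤ × ℤ)
    (w : Fin n → Bool) : (coinvD (n + 2) f : (Fin n → Bool) → ℤ × ℤ × ℤ × ℤ) w =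
      coinvD3 (f (Fin.snoc (α := fun _ => Bool) w false),
        f (Fin.snoc (α := fun _ => Bool) w true)) := rfl

theorem sumCoords_augD (u : D) : sumCoords (augD u) = augmentation (d2 u) := by
  rw [d2_apply]
  simp only [map_add, map_mul, augmentation_el, mul_one]
  rfl

theorem augD_d3 (u v : D) : augD (d3 (u, v)) = coinvD3 (augD u, augD v) := by
  rw [d3_apply, coinvD3_apply, augD_apply, sumCoords_augD, sumCoords_augD]
  simp [sigma_apply, augmentation_el]

theorem augmentation_d1 (r : Ring1) : augmentation (d1 r) = 0 := by
  rw [d1_apply, map_zsmul, map_sub, augmentation_el, augmentation_el]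
  simp

theorem toCoinv_resD : ∀ n (z : Res (n + 1)),
    coinvD n (toCoinv (n + 1) z) = toCoinv n (resD n z)
  | 0, r => (augmentation_d1 r).symm
  | 1, f => sumCoords_augD (f default)
  | _ + 2, _ => funext fun _ => (augD_d3 _ _).symm

theorem augmentation_surjective : Function.Surjective augmentation := fun n =>
  ⟨n • el (x 0 0), augmentation_zsmul_el n _⟩

theorem augmentation_P_surjective (n : ℤ) : ∃ p : P, augmentation p = n :=
  ⟨⟨n • el (x 0 0), zsmul_mem (el_mem_P 0) n⟩, augmentation_zsmul_el n _⟩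

theorem augD_surjective : Function.Surjective augD := by
  rintro ⟨q, p, a, b⟩
  obtain ⟨q, rfl⟩ := augmentation_P_surjective q
  obtain ⟨p, rfl⟩ := augmentation_P_surjective p
  obtain ⟨a, rfl⟩ := augmentation_surjective a
  obtain ⟨b, rfl⟩ := augmentation_surjective b
  exact ⟨(q, p, a, b), rfl⟩

theorem toCoinv_surjective : ∀ n, Function.Surjective (toCoinv n)
  | 0 => augmentation_P_surjective
  | 1 => augmentation_surjective
  | _ + 2 => augD_surjective.comp_left

/-- The inclusions of four copies of `ℤ S¹` into `D`, with retractions on the copies of `P`. -/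
noncomputable def inclD : Fin 4 → Ring1 →ₗ[Ring1] D :=
  ![LinearMap.inl _ _ _ ∘ₗ toP, LinearMap.inr _ _ _ ∘ₗ LinearMap.inl _ _ _ ∘ₗ toP,
    LinearMap.inr _ _ _ ∘ₗ LinearMap.inr _ _ _ ∘ₗ LinearMap.inl _ _ _,
    LinearMap.inr _ _ _ ∘ₗ LinearMap.inr _ _ _ ∘ₗ LinearMap.inr _ _ _]

/-- The projections of `D` to four copies of `ℤ S¹`. -/
noncomputable def projD : Fin 4 → D →ₗ[Ring1] Ring1 :=
  ![P.subtype ∘ₗ LinearMap.fst _ _ _,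
    P.subtype ∘ₗ LinearMap.fst _ _ _ ∘ₗ LinearMap.snd _ _ _,
    LinearMap.fst _ _ _ ∘ₗ LinearMap.snd _ _ _ ∘ₗ LinearMap.snd _ _ _,
    LinearMap.snd _ _ _ ∘ₗ LinearMap.snd _ _ _ ∘ₗ LinearMap.snd _ _ _]

theorem sum_inclD_projD (u : D) : ∑ j, inclD j (projD j u) = u := by
  obtain ⟨q, p, a, b⟩ := u
  simp [Fin.sum_univ_four, inclD, projD, toP_apply_coe]

theorem augmentation_projD_eq_zero (u : D) (h : augD u = 0) (j : Fin 4) :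
    augmentation (projD j u) = 0 := by
  rw [augD_apply] at h
  simp only [Prod.mk_eq_zero] at h
  fin_cases j
  · exact h.1
  · exact h.2.1
  · exact h.2.2.1
  · exact h.2.2.2

theorem augD_smul (s : S6) (u : D) : augD (el s • u) = augD u := by
  simp [augD_apply, augmentation_el]

theorem exact_bar_res : ∀ n, Function.Exact (barD (Res n) 0)
      ((toCoinv n).comp (Finsupp.applyAddHom default)) ∧
    ∀ q, Function.Exact (barD (Res n) (q + 1)) (barD (Res n) q)
  | 0 => exact_bar_of_retract (F := P) (B := ℤ) (J := Unit) (fun _ => toP) (fun _ => P.subtype)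
      (by simp [toP_apply_coe]) (toCoinv 0) (fun _ h _ => h) (fun s m => by
        change augmentation (el s * m.1) = augmentation m.1
        rw [map_mul, augmentation_el, one_mul])
  | 1 => exact_bar_of_retract (F := Ring1) (B := ℤ) (J := Unit) (fun _ => LinearMap.id)
      (fun _ => LinearMap.id) (by simp) (toCoinv 1) (fun _ h _ => h) (fun s m => by
        change augmentation (el s * m) = augmentation m
        rw [map_mul, augmentation_el, one_mul])
  | n + 2 => exact_bar_of_retract (F := C n) (B := (Fin n → Bool) → ℤ × ℤ × ℤ × ℤ)
      (J := (Fin n → Bool) × Fin 4)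
      (fun j => LinearMap.single Ring1 (fun _ : Fin n → Bool => D) j.1 ∘ₗ inclD j.2)
      (fun j => projD j.2 ∘ₗ LinearMap.proj (R := Ring1) (φ := fun _ : Fin n → Bool => D) j.1)
      (fun m => by
        rw [Fintype.sum_prod_type]
        simp only [LinearMap.comp_apply, ← map_sum, LinearMap.proj_apply, sum_inclD_projD]
        exact LinearMap.sum_single_apply (fun _ : Fin n → Bool => D) m)
      (toCoinv (n + 2)) (fun m h j => augmentation_projD_eq_zero _ (congrFun h j.1) j.2)
      (fun s m => funext fun w => augD_smul s (m w))

theorem mapRange_toCoinv_barFace {q : ℕ} (i : Fin (q + 2)) (z : (Fin (q + 1) → S6) →₀ Res 0) :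
    Finsupp.mapRange.addMonoidHom (toCoinv 0) (barFace (Res 0) i z) =
      Finsupp.mapDomain.addMonoidHom (nerveFace S6 i)
        (Finsupp.mapRange.addMonoidHom (toCoinv 0) z) := by
  induction z using Finsupp.induction_linear with
  | zero => simp
  | add y z hy hz => simp only [map_add, hy, hz]
  | single s m =>
    simp only [barFace_single, Finsupp.mapRange.addMonoidHom_apply, Finsupp.mapRange_single,
      Finsupp.mapDomain.addMonoidHom_apply, Finsupp.mapDomain_single]
    refine congrArg (Finsupp.single _) ?_
    simp only [barAct]
    split_ifs
    · change augmentation (el _ * m.1) = augmentation m.1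
      rw [map_mul, augmentation_el, one_mul]
    · rfl

/-- The balancing argument for `Tor` of two trivial modules: the bar complex with coefficients in
the resolution is augmented on one side to the bar complex with trivial coefficients, which is the
chain complex of the nerve, and on the other to the coinvariants. -/
theorem nonempty_nerve_homology_equiv_coinv (n : ℕ) :
    Nonempty (MiddleHomology ((nerve S6).boundary (n + 1)) ((nerve S6).boundary n) ≃+
      MiddleHomology (coinvD (n + 1)) (coinvD n)) := by
  refine nonempty_homology_equiv_of_doubleComplex n
    (D := fun k q => (Fin q → S6) →₀ Res k) (A := fun q => (Fin q → S6) →₀ ℤ) (B := Coinv)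
    (fun k q => barD (Res k) q)
    (fun k q => Finsupp.mapRange.addMonoidHom (resD k).toAddMonoidHom)
    (fun q => (nerve S6).boundary q) coinvD
    (fun q => Finsupp.mapRange.addMonoidHom (toCoinv 0))
    (fun k => (toCoinv k).comp (Finsupp.applyAddHom default)) ?_ ?_ ?_ ?_ ?_ ?_ ?_ ?_ ?_
  · exact fun k q z => (mapRange_barD (resD k) q z).symm
  · intro q z
    exact (map_alternatingSum (barFace (Res 0)) _ (Finsupp.mapRange.addMonoidHom (toCoinv 0))
      (Finsupp.mapRange.addMonoidHom (toCoinv 0)) mapRange_toCoinv_barFace z).symm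
  · intro k z
    exact toCoinv_resD k (z default)
  · exact fun q => Finsupp.mapRange_addMonoidHom_surjective (toCoinv_surjective 0)
  · intro q
    exact Function.Exact.finsupp_mapRange (f := (resD 0).toAddMonoidHom) (g := toCoinv 0)
      exact_d1_eps
  · intro k q
    exact Function.Exact.finsupp_mapRange (f := (resD (k + 1)).toAddMonoidHom)
      (g := (resD k).toAddMonoidHom) (exact_resD k)
  · intro k m
    obtain ⟨m, rfl⟩ := toCoinv_surjective k m
    exact ⟨Finsupp.single default m, by simp⟩
  · exact fun k => (exact_bar_res k).1
  · exact fun k => (exact_bar_res k).2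

theorem subsingleton_coinv_homology_one : Subsingleton (MiddleHomology (coinvD 1) (coinvD 0)) := by
  obtain ⟨e⟩ := MiddleHomology.nonempty_equiv_of_ker (coinvD 1) (coinvD 0) (0 : _ →+ PUnit.{1})
    (fun m => ⟨0, map_zero _, Subsingleton.elim _ _⟩)
    (fun y _ => ⟨fun _ => ⟨fun _ => ((y : ℤ), 0, 0, 0), by
      change (y : ℤ) + 0 + 0 + 0 = y
      rw [add_zero, add_zero, add_zero]⟩, fun _ => rfl⟩)
  exact e.toEquiv.subsingleton

theorem coinvD_eq_zero_iff : ∀ n (f : (Fin n → Bool) → ℤ × ℤ × ℤ × ℤ),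
    coinvD (n + 1) f = 0 ↔ ∀ w, sumCoords (f w) = 0
  | 0, f => ⟨fun h w => by rw [Subsingleton.elim w default]; exact h, fun h => h default⟩
  | n + 1, f => by
    rw [forall_word_succ]
    refine funext_iff.trans (forall_congr' fun w => ?_)
    rw [coinvD_add_two_apply, coinvD3_apply]
    change _ = (0 : ℤ × ℤ × ℤ × ℤ) ↔ _
    simp only [Prod.mk_eq_zero, neg_eq_zero, true_and]
    exact ⟨fun h => h.2, fun h => ⟨by rw [h.1, h.2]; rfl, h⟩⟩

theorem exists_coinvD_eq_iff (n : ℕ) (f : (Fin n → Bool) → ℤ × ℤ × ℤ × ℤ) :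
    (∃ g, coinvD (n + 2) g = f) ↔ ∀ w, (f w).1 = 0 ∧ sumCoords (f w) = 0 := by
  constructor
  · rintro ⟨g, rfl⟩ w
    change (coinvD3 (_, _)).1 = 0 ∧ sumCoords (coinvD3 (_, _)) = 0
    rw [coinvD3_apply]
    refine ⟨rfl, ?_⟩
    simp only [sumCoords, AddMonoidHom.coe_mk, ZeroHom.coe_mk]
    ring
  · intro h
    -- Only coordinate sums of preimages matter, so the required sum is put into the first
    -- coordinate: minus the third or the fourth coordinate of the target, according to the last
    -- letter. The second coordinate is then right because the target has coordinate sum `0` and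
    -- first coordinate `0`.
    refine ⟨fun w : Fin (n + 1) → Bool => (bif w (Fin.last n) then -(f (Fin.init w)).2.2.2
      else -(f (Fin.init w)).2.2.1, 0, 0, 0), funext fun w => ?_⟩
    obtain ⟨h1, h2⟩ := h w
    rw [coinvD_add_two_apply, coinvD3_apply]
    simp only [sumCoords, AddMonoidHom.coe_mk, ZeroHom.coe_mk, Fin.snoc_last, Fin.init_snoc,
      cond_true, cond_false] at h2 ⊢
    refine Prod.ext h1.symm (Prod.ext ?_ (Prod.ext ?_ ?_)) <;> dsimp only <;> linarith

/-- Cycles have coordinate sum `0` for each word, and boundaries have first coordinate `0` in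
addition; so the first coordinates of a cycle, which are arbitrary, are its class. -/
theorem nonempty_coinv_homology_equiv (n : ℕ) :
    Nonempty (MiddleHomology (coinvD (n + 2)) (coinvD (n + 1)) ≃+ ((Fin n → Bool) → ℤ)) := by
  refine MiddleHomology.nonempty_equiv_of_ker _ _
    (AddMonoidHom.compLeft (AddMonoidHom.fst ℤ (ℤ × ℤ × ℤ)) (Fin n → Bool)) ?_ ?_
  · intro m
    refine ⟨fun w => (m w, -m w, 0, 0), (coinvD_eq_zero_iff n _).2 fun w => ?_, rfl⟩
    simp [sumCoords]
  · intro y hy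
    have := (coinvD_eq_zero_iff n y).1 hy
    refine Iff.trans ?_ (exists_coinvD_eq_iff n y).symm
    exact ⟨fun h w => ⟨congrFun h w, this w⟩, fun h => funext fun w => (h w).1⟩

theorem subsingleton_nerve_homology_one :
    Subsingleton (MiddleHomology ((nerve S6).boundary 1) ((nerve S6).boundary 0)) := by
  obtain ⟨e⟩ := nonempty_nerve_homology_equiv_coinv 0
  have := subsingleton_coinv_homology_one
  exact e.toEquiv.subsingleton

theorem nonempty_nerve_homology_equiv (n : ℕ) :
    Nonempty (MiddleHomology ((nerve S6).boundary (n + 2)) ((nerve S6).boundary (n + 1)) ≃+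
      (Fin (2 ^ n) → ℤ)) := by
  obtain ⟨e⟩ := nonempty_nerve_homology_equiv_coinv (n + 1)
  obtain ⟨f⟩ := nonempty_coinv_homology_equiv n
  have hc : Fintype.card (Fin n → Bool) = Fintype.card (Fin (2 ^ n)) := by simp
  exact ⟨(e.trans f).trans (LinearEquiv.funCongrLeft ℤ ℤ (Fintype.equivOfCardEq hc).symm).toAddEquiv⟩

end S6

/-! ### Singular homology as homology of the `Δ`-set of singular simplices -/

open CategoryTheory Limits in
theorem ChainComplex.nonempty_homology_equiv {R : Type} [Ring R]
    (K : ChainComplex (ModuleCat.{0} R) ℕ) (n : ℕ) :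
    Nonempty (K.homology (n + 1) ≃+ MiddleHomology (K.d (n + 2) (n + 1)).hom.toAddMonoidHom
      (K.d (n + 1) n).hom.toAddMonoidHom) := by
  let S := K.sc' (n + 2) (n + 1) n
  let e : K.homology (n + 1) ≅ S.homology :=
    ShortComplex.homologyMapIso (K.isoSc' (n + 2) (n + 1) n (by simp) (by simp))
  let e2 := (e ≪≫ S.moduleCatHomologyIso).toLinearEquiv.toAddEquiv
  let π : S.g.hom.toAddMonoidHom.ker →+ S.moduleCatLeftHomologyData.H :=
    AddMonoidHom.mk' (fun y => (LinearMap.range S.moduleCatToCycles).mkQ ⟨y.1, y.2⟩)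
      fun y z => map_add (LinearMap.range S.moduleCatToCycles).mkQ ⟨y.1, y.2⟩ ⟨z.1, z.2⟩
  have hπ : Function.Surjective π := fun y =>
    let ⟨z, hz⟩ := Submodule.mkQ_surjective _ y
    ⟨⟨z.1, z.2⟩, hz⟩
  have h : S.f.hom.toAddMonoidHom.range.addSubgroupOf S.g.hom.toAddMonoidHom.ker = π.ker := by
    ext y
    rw [AddMonoidHom.mem_ker]
    refine Iff.trans ?_ (Submodule.Quotient.mk_eq_zero _).symm
    exact ⟨fun ⟨x, hx⟩ => ⟨x, Subtype.ext hx⟩, fun ⟨x, hx⟩ => ⟨x, congrArg Subtype.val hx⟩⟩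
  exact ⟨e2.trans ((QuotientAddGroup.quotientAddEquivOfEq h).trans
    (QuotientAddGroup.quotientKerEquivOfSurjective π hπ)).symm⟩

theorem MiddleHomology.nonempty_equiv_of_equiv {A B C A' B' C' : Type*} [AddCommGroup A]
    [AddCommGroup B] [AddCommGroup C] [AddCommGroup A'] [AddCommGroup B'] [AddCommGroup C']
    (f : A →+ B) (g : B →+ C) (f' : A' →+ B') (g' : B' →+ C') (a : A ≃+ A') (b : B ≃+ B')
    (c : C ≃+ C') (hf : ∀ x, f' (a x) = b (f x)) (hg : ∀ x, g' (b x) = c (g x)) :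
    Nonempty (MiddleHomology f g ≃+ MiddleHomology f' g') := by
  refine nonempty_equiv_of_span f g f' g' g.ker.subtype (b.toAddMonoidHom.comp g.ker.subtype)
    (fun z => z.2) (fun z => ?_) (fun y hy => ⟨⟨y, hy⟩, by simp⟩) (fun y hy => ?_) (fun z => ?_)
  · change g' (b z.1) = 0
    rw [hg, show g z.1 = 0 from z.2, map_zero]
  · obtain ⟨y, rfl⟩ := b.surjective y
    rw [hg, map_eq_zero_iff c c.injective] at hy
    exact ⟨⟨y, hy⟩, by simp⟩
  · constructor
    · rintro ⟨x, hx⟩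
      exact ⟨a x, (hf x).trans (congrArg b hx)⟩
    · rintro ⟨x, hx⟩
      obtain ⟨x, rfl⟩ := a.surjective x
      rw [hf] at hx
      exact ⟨x, b.injective hx⟩

/-- The standard face inclusion. -/
noncomputable def stdSimplex.faceMap {n : ℕ} (i : Fin (n + 2)) :
    C(stdSimplex ℝ (Fin (n + 1)), stdSimplex ℝ (Fin (n + 2))) :=
  ⟨stdSimplex.map i.succAbove, stdSimplex.continuous_map _⟩

theorem Fin.succ_succAbove_comp_succAbove {n : ℕ} {i j : Fin (n + 2)} (h : i ≤ j) :
    j.succ.succAbove ∘ i.succAbove = i.castSucc.succAbove ∘ j.succAbove := by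
  funext k
  ext
  have h : i.val ≤ j.val := h
  simp only [Function.comp, Fin.succAbove, Fin.lt_def, Fin.val_succ, Fin.val_castSucc]
  split_ifs <;> simp_all <;> omega

/-- The singular simplices of a topological space, with their faces. -/
noncomputable abbrev TopologicalSpace.singular (Y : Type) [TopologicalSpace Y] : DeltaSet.{0} where
  simplex n := C(stdSimplex ℝ (Fin (n + 1)), Y)
  face i σ := σ.comp (stdSimplex.faceMap i)
  face_face i j h σ := by
    ext t
    change σ (stdSimplex.map _ (stdSimplex.map _ t)) = σ (stdSimplex.map _ (stdSimplex.map _ t))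
    rw [stdSimplex.map_comp_apply, stdSimplex.map_comp_apply, Fin.succ_succAbove_comp_succAbove h]

section

open CategoryTheory Limits Simplicial

theorem TopCat.toSSetObjEquiv_δ (Y : TopCat.{0}) {n : ℕ} (i : Fin (n + 2))
    (x : (TopCat.toSSet.obj Y) _⦋n + 1⦌) :
    TopCat.toSSetObjEquiv Y _ ((TopCat.toSSet.obj Y).δ i x) =
      (TopCat.toSSetObjEquiv Y _ x).comp (stdSimplex.faceMap i) := by
  rfl

section

variable (R : Type) [CommRing R] (X : SSet.{0}) (n : ℕ)

/-- The comparison map from simplicial chains to the free module on the simplices. -/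
noncomputable def SSet.chainComplexXToFinsupp :
    (X.chainComplex (ModuleCat.of R R)).X n ⟶ ModuleCat.of R (X _⦋n⦌ →₀ R) :=
  (X.isColimitChainComplexXCofan (ModuleCat.of R R) n).desc
    (Cofan.mk (ModuleCat.of R (X _⦋n⦌ →₀ R)) fun x => ModuleCat.ofHom (Finsupp.lsingle x))

theorem SSet.chainComplexXToFinsupp_ι (x : X _⦋n⦌) (m : R) :
    (X.chainComplexXToFinsupp R n).hom
      ((X.ιChainComplex (R := ModuleCat.of R R) x).hom m) = Finsupp.single x m :=
  congrArg (fun f => f.hom m) ((X.isColimitChainComplexXCofan (ModuleCat.of R R) n).fac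
    (Cofan.mk (ModuleCat.of R (X _⦋n⦌ →₀ R)) fun x => ModuleCat.ofHom (Finsupp.lsingle x)) ⟨x⟩)

/-- The inverse of the comparison map. -/
noncomputable def SSet.finsuppToChainComplexX :
    ModuleCat.of R (X _⦋n⦌ →₀ R) ⟶ (X.chainComplex (ModuleCat.of R R)).X n :=
  ModuleCat.ofHom (Finsupp.lsum R fun x => (X.ιChainComplex (R := ModuleCat.of R R) x).hom)

theorem SSet.finsuppToChainComplexX_single (x : X _⦋n⦌) (m : R) :
    (X.finsuppToChainComplexX R n).hom (Finsupp.single x m) =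
      (X.ιChainComplex (R := ModuleCat.of R R) x).hom m := by
  change (Finsupp.lsum R fun x => (X.ιChainComplex (R := ModuleCat.of R R) x).hom)
    (Finsupp.single x m) = _
  rw [Finsupp.lsum_single]

/-- The simplicial chains of a simplicial set form a free module. -/
noncomputable def SSet.chainComplexXIso :
    (X.chainComplex (ModuleCat.of R R)).X n ≅ ModuleCat.of R (X _⦋n⦌ →₀ R) where
  hom := X.chainComplexXToFinsupp R n
  inv := X.finsuppToChainComplexX R n
  hom_inv_id := by
    refine SSet.chainComplex_hom_ext fun x => ?_
    refine ModuleCat.hom_ext (LinearMap.ext fun m => ?_)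
    change (X.finsuppToChainComplexX R n).hom ((X.chainComplexXToFinsupp R n).hom
      ((X.ιChainComplex (R := ModuleCat.of R R) x).hom m)) = _
    rw [chainComplexXToFinsupp_ι, finsuppToChainComplexX_single]
    rfl
  inv_hom_id := by
    refine ModuleCat.hom_ext (Finsupp.lhom_ext fun x m => ?_)
    change (X.chainComplexXToFinsupp R n).hom ((X.finsuppToChainComplexX R n).hom _) = _
    rw [finsuppToChainComplexX_single, chainComplexXToFinsupp_ι]
    rfl

theorem SSet.chainComplexXIso_hom_d (x : X _⦋n + 1⦌) (m : R) :
    (X.chainComplexXIso R n).hom.hom (((X.chainComplex (ModuleCat.of R R)).d (n + 1) n).hom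
      ((X.chainComplexXIso R (n + 1)).inv.hom (Finsupp.single x m))) =
      ∑ i : Fin (n + 2), (-1 : ℤ) ^ (i : ℕ) • Finsupp.single (X.δ i x) m := by
  change (X.chainComplexXToFinsupp R n).hom (((X.chainComplex (ModuleCat.of R R)).d (n + 1) n).hom
    ((X.finsuppToChainComplexX R (n + 1)).hom _)) = _
  rw [finsuppToChainComplexX_single]
  have : ((X.chainComplex (ModuleCat.of R R)).d (n + 1) n).hom
      ((X.ιChainComplex (R := ModuleCat.of R R) x).hom m) = _ :=
    congrArg (fun f => f.hom m) (X.ιChainComplex_d (ModuleCat.of R R) x)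
  rw [this]
  rw [ModuleCat.hom_sum, LinearMap.sum_apply, map_sum]
  refine Finset.sum_congr rfl fun i _ => ?_
  rw [ModuleCat.hom_zsmul, LinearMap.smul_apply, map_zsmul, chainComplexXToFinsupp_ι]

end

/-- The categorical chain modules are free on the singular simplices, so it is enough to compare the
differentials on basis elements. -/
theorem TopologicalSpace.nonempty_singularHomology_equiv (Y : TopCat.{0}) (n : ℕ) :
    Nonempty (((AlgebraicTopology.singularHomologyFunctor (ModuleCat.{0} ℤ) (n + 1)).obj
      (ModuleCat.of ℤ ℤ)).obj Y ≃+ MiddleHomology ((TopologicalSpace.singular Y).boundary (n + 1))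
        ((TopologicalSpace.singular Y).boundary n)) := by
  obtain ⟨e⟩ := ChainComplex.nonempty_homology_equiv
    ((TopCat.toSSet.obj Y).chainComplex (ModuleCat.of ℤ ℤ)) n
  let K := (TopCat.toSSet.obj Y).chainComplex (ModuleCat.of ℤ ℤ)
  let b : ∀ q, K.X q ≃+ ((TopologicalSpace.singular Y).simplex q →₀ ℤ) := fun q =>
    ((TopCat.toSSet.obj Y).chainComplexXIso ℤ q).toLinearEquiv.toAddEquiv.trans
      (Finsupp.domCongr (TopCat.toSSetObjEquiv Y (.op ⦋q⦌)))
  have hb : ∀ q x, (TopologicalSpace.singular Y).boundary q (b (q + 1) x) =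
      b q ((K.d (q + 1) q).hom.toAddMonoidHom x) := by
    intro q x
    obtain ⟨x, rfl⟩ := (b (q + 1)).symm.surjective x
    rw [AddEquiv.apply_symm_apply]
    refine Finsupp.addHom_eq_of_single (f := (TopologicalSpace.singular Y).boundary q)
      (g := (b q).toAddMonoidHom.comp ((K.d (q + 1) q).hom.toAddMonoidHom.comp
        (b (q + 1)).symm.toAddMonoidHom)) (fun σ => ?_) x
    rw [DeltaSet.boundary_single]
    have := (TopCat.toSSet.obj Y).chainComplexXIso_hom_d ℤ q
      ((TopCat.toSSetObjEquiv Y (.op ⦋q + 1⦌)).symm σ) 1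
    change _ = Finsupp.domCongr (TopCat.toSSetObjEquiv Y (.op ⦋q⦌))
      (((TopCat.toSSet.obj Y).chainComplexXIso ℤ q).hom.hom ((K.d (q + 1) q).hom
        (((TopCat.toSSet.obj Y).chainComplexXIso ℤ (q + 1)).inv.hom
          ((Finsupp.domCongr (TopCat.toSSetObjEquiv Y (.op ⦋q + 1⦌))).symm (Finsupp.single σ 1)))))
    have h : (Finsupp.domCongr (TopCat.toSSetObjEquiv Y (.op ⦋q + 1⦌))).symm
        (Finsupp.single σ (1 : ℤ)) =
        Finsupp.single ((TopCat.toSSetObjEquiv Y (.op ⦋q + 1⦌)).symm σ) 1 :=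
      Finsupp.equivMapDomain_single _ _ _
    rw [h, this, map_sum]
    refine Finset.sum_congr rfl fun i _ => ?_
    rw [map_zsmul]
    congr 1
    refine Eq.trans ?_ (Finsupp.equivMapDomain_single _ _ _).symm
    refine congrArg (fun τ => Finsupp.single τ (1 : ℤ)) ?_
    refine Eq.trans ?_ (TopCat.toSSetObjEquiv_δ Y i _).symm
    exact congrArg (fun τ => ContinuousMap.comp τ (stdSimplex.faceMap i))
      (Equiv.apply_symm_apply (TopCat.toSSetObjEquiv Y (.op ⦋q + 1⦌)) σ).symm
  obtain ⟨e'⟩ := MiddleHomology.nonempty_equiv_of_equiv (K.d (n + 2) (n + 1)).hom.toAddMonoidHom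
    (K.d (n + 1) n).hom.toAddMonoidHom
    ((TopologicalSpace.singular Y).boundary (n + 1)) ((TopologicalSpace.singular Y).boundary n)
    (b (n + 2)) (b (n + 1)) (b n) (hb (n + 1)) (hb n)
  exact ⟨e.trans e'⟩

end

/-! ### Affine simplices and barycentric subdivision -/

/-- The standard topological simplex. -/
abbrev TopSimplex (n : ℕ) : Type := stdSimplex ℝ (Fin (n + 1))

namespace TopSimplex

variable {p q r k : ℕ}

/-- The affine map between standard simplices with prescribed images of the vertices. -/
noncomputable def affine (v : Fin (q + 1) → TopSimplex p) : C(TopSimplex q, TopSimplex p) where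
  toFun t := ⟨fun k => ∑ i, t i * v i k, fun k => Finset.sum_nonneg fun i _ =>
      mul_nonneg (t.2.1 i) ((v i).2.1 k), by
    rw [Finset.sum_comm]
    simp only [← Finset.mul_sum, stdSimplex.sum_eq_one, mul_one]⟩
  continuous_toFun := by
    refine Continuous.subtype_mk (continuous_pi fun k => continuous_finsetSum _ fun i _ => ?_) _
    exact ((continuous_apply i).comp continuous_subtype_val).mul continuous_const

theorem affine_apply (v : Fin (q + 1) → TopSimplex p) (t : TopSimplex q) (k : Fin (p + 1)) :
    affine v t k = ∑ i, t i * v i k := rfl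

theorem affine_affine (w : Fin (p + 1) → TopSimplex r) (v : Fin (q + 1) → TopSimplex p)
    (t : TopSimplex q) : affine w (affine v t) = affine (fun i => affine w (v i)) t := by
  ext k
  simp only [affine_apply, Finset.sum_mul, Finset.mul_sum]
  rw [Finset.sum_comm]
  exact Finset.sum_congr rfl fun i _ => Finset.sum_congr rfl fun j _ => mul_assoc _ _ _

theorem affine_vertex (t : TopSimplex p) :
    affine (fun i : Fin (p + 1) => stdSimplex.vertex (S := ℝ) i) t = t := by
  ext k
  simp [affine_apply, Pi.single_apply]

theorem affine_apply_vertex (v : Fin (q + 1) → TopSimplex p) (i : Fin (q + 1)) :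
    affine v (stdSimplex.vertex i) = v i := by
  ext k
  simp [affine_apply, Pi.single_apply]

theorem map_apply_eq_sum {n m : ℕ} (f : Fin (n + 1) → Fin (m + 1)) (t : TopSimplex n)
    (k : Fin (m + 1)) : stdSimplex.map f t k = ∑ i, if f i = k then t i else 0 := by
  rw [stdSimplex.map_coe, FunOnFinite.linearMap_apply_apply, Finset.sum_filter]

theorem affine_comp_succAbove (v : Fin (q + 2) → TopSimplex p) (i : Fin (q + 2)) :
    affine (v ∘ i.succAbove) = (affine v).comp (stdSimplex.faceMap i) := by
  ext t k
  change _ = affine v (stdSimplex.map i.succAbove t) k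
  simp only [affine_apply, map_apply_eq_sum, Finset.sum_mul]
  rw [Finset.sum_comm]
  simp

theorem faceMap_eq_affine (i : Fin (q + 2)) : stdSimplex.faceMap i =
    affine ((fun j : Fin (q + 2) => stdSimplex.vertex (S := ℝ) j) ∘ i.succAbove) := by
  rw [affine_comp_succAbove]
  ext1 t
  exact (affine_vertex _).symm

/-- The barycenter of an affine simplex. -/
noncomputable def center (v : Fin (q + 1) → TopSimplex p) : TopSimplex p :=
  affine v stdSimplex.barycenter

theorem dist_affine_le (v : Fin (q + 1) → TopSimplex p) (t : TopSimplex q) (x : TopSimplex p) :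
    dist (affine v t) x ≤ ∑ i, t i * dist (v i) x := by
  refine (dist_pi_le_iff (f := (affine v t).1) (g := x.1)
    (Finset.sum_nonneg fun i _ => mul_nonneg (t.2.1 i) dist_nonneg)).2 fun k => ?_
  have h : (affine v t).1 k - x.1 k = ∑ i, t i * ((v i).1 k - x.1 k) := by
    simp only [mul_sub, Finset.sum_sub_distrib, ← Finset.sum_mul, stdSimplex.sum_eq_one, one_mul]
    rfl
  rw [Real.dist_eq, h]
  refine (Finset.abs_sum_le_sum_abs _ _).trans (Finset.sum_le_sum fun i _ => ?_)
  rw [abs_mul, abs_of_nonneg (show 0 ≤ t i from t.2.1 i), ← Real.dist_eq]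
  exact mul_le_mul_of_nonneg_left (dist_le_pi_dist (v i).1 x.1 k) (t.2.1 i)

theorem dist_affine_le_of_forall_le (v : Fin (q + 1) → TopSimplex p) (t : TopSimplex q)
    (x : TopSimplex p) {c : ℝ} (h : ∀ i, dist (v i) x ≤ c) : dist (affine v t) x ≤ c := by
  refine (dist_affine_le v t x).trans ?_
  calc ∑ i, t i * dist (v i) x ≤ ∑ i, t i * c :=
        Finset.sum_le_sum fun i _ => mul_le_mul_of_nonneg_left (h i) (t.2.1 i)
    _ = c := by rw [← Finset.sum_mul, stdSimplex.sum_eq_one, one_mul]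

/-- The distance from the barycenter to `v j` is at most the average of `q + 1` distances to `v j`,
one of which is `0`. -/
theorem dist_center_le (v : Fin (q + 1) → TopSimplex p) {c : ℝ}
    (h : ∀ i j, dist (v i) (v j) ≤ c) (j : Fin (q + 1)) :
    dist (center v) (v j) ≤ q / (q + 1) * c := by
  refine (dist_affine_le v _ _).trans ?_
  have hb : ∀ i, (stdSimplex.barycenter : TopSimplex q) i = ((q : ℝ) + 1)⁻¹ := by
    intro i
    refine (stdSimplex.barycenter_apply (𝕜 := ℝ) i).trans ?_
    simp
  simp only [hb, ← Finset.mul_sum]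
  have : ∑ i, dist (v i) (v j) ≤ q * c := by
    rw [Fin.sum_univ_succAbove _ j, dist_self, zero_add]
    refine (Finset.sum_le_sum fun i _ => h _ _).trans ?_
    simp
  calc ((q : ℝ) + 1)⁻¹ * ∑ i, dist (v i) (v j) ≤ ((q : ℝ) + 1)⁻¹ * (q * c) :=
        mul_le_mul_of_nonneg_left this (by positivity)
    _ = q / (q + 1) * c := by ring

end TopSimplex

/-- The finitely supported functions with support in `s`. -/
noncomputable def Finsupp.supportedIn {X : Type*} (s : Set X) : AddSubgroup (X →₀ ℤ) :=
  (Finsupp.supported ℤ ℤ s).toAddSubgroup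

theorem Finsupp.single_mem_supportedIn {X : Type*} {s : Set X} {x : X} (n : ℤ) (h : x ∈ s) :
    Finsupp.single x n ∈ Finsupp.supportedIn s :=
  Finsupp.single_mem_supported ℤ n h

theorem Finsupp.map_mem_of_mem_supportedIn {X A : Type*} [AddCommGroup A] {s : Set X}
    (F : (X →₀ ℤ) →+ A) (N : AddSubgroup A) (h : ∀ x ∈ s, F (Finsupp.single x 1) ∈ N)
    {z : X →₀ ℤ} (hz : z ∈ Finsupp.supportedIn s) : F z ∈ N := by
  have hz : ∀ x ∈ z.support, x ∈ s := fun x hx => (Finsupp.mem_supported ℤ z).1 hz hx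
  rw [← Finsupp.sum_single z, Finsupp.sum, map_sum]
  refine sum_mem fun x hx => ?_
  rw [← mul_one (z x), ← smul_eq_mul, ← Finsupp.smul_single, map_zsmul]
  exact zsmul_mem (h x (hz x hx)) _

theorem Finsupp.mem_supportedIn_support {X : Type*} (z : X →₀ ℤ) :
    z ∈ Finsupp.supportedIn (z.support : Set X) :=
  (Finsupp.mem_supported ℤ z).2 subset_rfl

theorem Finsupp.supportedIn_mono {X : Type*} {s t : Set X} (h : s ⊆ t) :
    Finsupp.supportedIn s ≤ Finsupp.supportedIn t :=
  Finsupp.supported_mono (M := ℤ) (R := ℤ) h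

namespace TopSimplex

variable {p q r : ℕ}

/-- The affine simplices in a standard simplex, given by their vertices. -/
def tuples (p : ℕ) : DeltaSet.{0} where
  simplex q := Fin (q + 1) → TopSimplex p
  face i v := v ∘ i.succAbove
  face_face i j h v := by
    rw [Function.comp_assoc, Function.comp_assoc, Fin.succ_succAbove_comp_succAbove h]

/-- The chains of affine simplices. -/
abbrev AffineChain (p q : ℕ) : Type := (Fin (q + 1) → TopSimplex p) →₀ ℤ

/-- The boundary of a chain of affine simplices. -/
noncomputable def bd (p q : ℕ) : AffineChain p (q + 1) →+ AffineChain p q := (tuples p).boundary q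

theorem bd_single (v : Fin (q + 2) → TopSimplex p) : bd p q (Finsupp.single v 1) =
    ∑ i : Fin (q + 2), (-1 : ℤ) ^ (i : ℕ) • Finsupp.single (v ∘ i.succAbove) 1 :=
  (tuples p).boundary_single q v

theorem bd_bd (z : AffineChain p (q + 2)) : bd p q (bd p (q + 1) z) = 0 :=
  (tuples p).boundary_boundary q z

/-- The cone on a chain of affine simplices. -/
noncomputable def cone (b : TopSimplex p) (q : ℕ) : AffineChain p q →+ AffineChain p (q + 1) :=
  Finsupp.mapDomain.addMonoidHom
    fun v : Fin (q + 1) → TopSimplex p => (Fin.cons b v : Fin (q + 2) → TopSimplex p)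

theorem cone_single (b : TopSimplex p) (v : Fin (q + 1) → TopSimplex p) :
    cone b q (Finsupp.single v 1) =
      Finsupp.single (Fin.cons b v : Fin (q + 2) → TopSimplex p) 1 :=
  Finsupp.mapDomain_single

theorem cons_comp_succ_succAbove (b : TopSimplex p) (v : Fin (q + 2) → TopSimplex p)
    (i : Fin (q + 2)) : (Fin.cons b v : Fin (q + 3) → TopSimplex p) ∘ i.succ.succAbove =
      Fin.cons b (v ∘ i.succAbove) := by
  funext k
  induction k using Fin.cases with
  | zero => simp
  | succ k => simp

theorem bd_cone (b : TopSimplex p) (z : AffineChain p (q + 1)) :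
    bd p (q + 1) (cone b (q + 1) z) = z - cone b q (bd p q z) := by
  refine Finsupp.addHom_eq_of_single (f := (bd p (q + 1)).comp (cone b (q + 1)))
    (g := AddMonoidHom.id _ - (cone b q).comp (bd p q)) (fun v => ?_) z
  change bd p (q + 1) (cone b (q + 1) (Finsupp.single v 1)) =
    Finsupp.single v 1 - cone b q (bd p q (Finsupp.single v 1))
  rw [cone_single, bd_single, Fin.sum_univ_succ, bd_single]
  simp only [map_sum, map_zsmul, cone_single, cons_comp_succ_succAbove, Fin.val_succ, pow_succ,
    mul_neg, mul_one, neg_smul, Finset.sum_neg_distrib, sub_eq_add_neg, Fin.val_zero, pow_zero,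
    one_smul]
  rfl

/-- In degree 0 the boundary of a cone has an extra term, the augmentation times the cone point. It
vanishes on boundaries, the only place where the subdivision of 1-simplices needs it. -/
theorem bd_cone_bd (b : TopSimplex p) (z : AffineChain p 1) :
    bd p 0 (cone b 0 (bd p 0 z)) = bd p 0 z := by
  refine Finsupp.addHom_eq_of_single (f := (bd p 0).comp ((cone b 0).comp (bd p 0)))
    (g := bd p 0) (fun v => ?_) z
  have h : ∀ w : Fin 1 → TopSimplex p, (Fin.cons b w : Fin 2 → TopSimplex p) ∘
      Fin.succAbove 1 = fun _ => b := by
    intro w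
    funext k
    rw [Subsingleton.elim k 0]
    rfl
  have h' : ∀ w : Fin 1 → TopSimplex p, (Fin.cons b w : Fin 2 → TopSimplex p) ∘
      Fin.succAbove 0 = w := fun w => rfl
  have hb : ∀ u : Fin 2 → TopSimplex p, bd p 0 (Finsupp.single u 1) =
      Finsupp.single (u ∘ Fin.succAbove 0) 1 - Finsupp.single (u ∘ Fin.succAbove 1) 1 := by
    intro u
    rw [bd_single]
    refine (Fin.sum_univ_two _).trans ?_
    simp [sub_eq_add_neg]
  simp only [AddMonoidHom.comp_apply]
  rw [hb, map_sub, map_sub, cone_single, cone_single, hb, hb, h, h, h', h', sub_sub_sub_cancel_right]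

/-- Barycentric subdivision of chains of affine simplices. -/
noncomputable def sd (p : ℕ) : ∀ q, AffineChain p q →+ AffineChain p q
  | 0 => AddMonoidHom.id _
  | q + 1 => Finsupp.freeLift fun v => cone (center v) q (sd p q (bd p q (Finsupp.single v 1)))

theorem sd_single (v : Fin (q + 2) → TopSimplex p) : sd p (q + 1) (Finsupp.single v 1) =
    cone (center v) q (sd p q (bd p q (Finsupp.single v 1))) :=
  Finsupp.freeLift_single _ v

theorem bd_sd : ∀ q (z : AffineChain p (q + 1)), bd p q (sd p (q + 1) z) = sd p q (bd p q z) := by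
  intro q
  induction q with
  | zero =>
    refine Finsupp.addHom_eq_of_single (f := (bd p 0).comp (sd p 1))
      (g := (sd p 0).comp (bd p 0)) fun v => ?_
    simp only [AddMonoidHom.comp_apply, sd_single]
    exact bd_cone_bd _ _
  | succ q ih =>
    refine Finsupp.addHom_eq_of_single (f := (bd p (q + 1)).comp (sd p (q + 2)))
      (g := (sd p (q + 1)).comp (bd p (q + 1))) fun v => ?_
    simp only [AddMonoidHom.comp_apply, sd_single]
    rw [bd_cone, ih, bd_bd, map_zero, map_zero, sub_zero]

/-- The chain homotopy between the identity and barycentric subdivision. -/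
noncomputable def sdHomotopy (p : ℕ) : ∀ q, AffineChain p q →+ AffineChain p (q + 1)
  | 0 => 0
  | q + 1 => Finsupp.freeLift fun v => cone (center v) (q + 1)
      (Finsupp.single v 1 - sdHomotopy p q (bd p q (Finsupp.single v 1)))

theorem sdHomotopy_single (v : Fin (q + 2) → TopSimplex p) :
    sdHomotopy p (q + 1) (Finsupp.single v 1) = cone (center v) (q + 1)
      (Finsupp.single v 1 - sdHomotopy p q (bd p q (Finsupp.single v 1))) :=
  Finsupp.freeLift_single _ v

/-- With `T v = cone (v - T ∂v)`, the boundary is `v - T ∂v - cone (∂v - ∂T ∂v)`. By induction `∂T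
∂v = ∂v - sd ∂v`, so the last cone is `sd v`. -/
theorem bd_sdHomotopy : ∀ q (z : AffineChain p (q + 1)), bd p (q + 1) (sdHomotopy p (q + 1) z) =
    z - sd p (q + 1) z - sdHomotopy p q (bd p q z) := by
  intro q
  induction q with
  | zero =>
    refine Finsupp.addHom_eq_of_single (f := (bd p 1).comp (sdHomotopy p 1))
      (g := AddMonoidHom.id _ - sd p 1 - (sdHomotopy p 0).comp (bd p 0)) fun v => ?_
    change bd p 1 (sdHomotopy p 1 (Finsupp.single v 1)) = Finsupp.single v 1 -
      sd p 1 (Finsupp.single v 1) - 0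
    rw [sdHomotopy_single, sd_single, bd_cone]
    change (Finsupp.single v 1 - 0) - cone _ _ (bd p 0 (Finsupp.single v 1 - 0)) =
      _ - cone _ _ (bd p 0 (Finsupp.single v 1)) - 0
    simp only [sub_zero]
  | succ q ih =>
    refine Finsupp.addHom_eq_of_single (f := (bd p (q + 2)).comp (sdHomotopy p (q + 2)))
      (g := AddMonoidHom.id _ - sd p (q + 2) - (sdHomotopy p (q + 1)).comp (bd p (q + 1)))
      fun v => ?_
    change bd p (q + 2) (sdHomotopy p (q + 2) (Finsupp.single v 1)) = Finsupp.single v 1 -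
      sd p (q + 2) (Finsupp.single v 1) -
        sdHomotopy p (q + 1) (bd p (q + 1) (Finsupp.single v 1))
    rw [sdHomotopy_single, sd_single, bd_cone, map_sub, ih, bd_bd, map_zero, sub_zero, sub_sub_self]
    abel

/-- The image of a chain of affine simplices under an affine map. -/
noncomputable def mapChain (w : Fin (p + 1) → TopSimplex r) (q : ℕ) :
    AffineChain p q →+ AffineChain r q :=
  Finsupp.mapDomain.addMonoidHom fun v i => affine w (v i)

theorem mapChain_single (w : Fin (p + 1) → TopSimplex r) (v : Fin (q + 1) → TopSimplex p) :
    mapChain w q (Finsupp.single v 1) = Finsupp.single (fun i => affine w (v i)) 1 :=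
  Finsupp.mapDomain_single

theorem mapChain_bd (w : Fin (p + 1) → TopSimplex r) (z : AffineChain p (q + 1)) :
    mapChain w q (bd p q z) = bd r q (mapChain w (q + 1) z) :=
  DeltaSet.mapDomain_boundary (tuples p) (tuples r) (fun _ v i => affine w (v i))
    (fun _ _ _ => rfl) q z

theorem mapChain_cone (w : Fin (p + 1) → TopSimplex r) (b : TopSimplex p)
    (z : AffineChain p q) :
    mapChain w (q + 1) (cone b q z) = cone (affine w b) q (mapChain w q z) := by
  refine Finsupp.addHom_eq_of_single (f := (mapChain w (q + 1)).comp (cone b q))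
    (g := (cone (affine w b) q).comp (mapChain w q)) (fun v => ?_) z
  simp only [AddMonoidHom.comp_apply, cone_single, mapChain_single]
  congr 1
  funext i
  induction i using Fin.cases with
  | zero => rfl
  | succ i => rfl

theorem affine_center (w : Fin (p + 1) → TopSimplex r) (v : Fin (q + 1) → TopSimplex p) :
    affine w (center v) = center fun i => affine w (v i) :=
  affine_affine _ _ _

theorem mapChain_sd (w : Fin (p + 1) → TopSimplex r) : ∀ q (z : AffineChain p q),
    mapChain w q (sd p q z) = sd r q (mapChain w q z) := by
  intro q
  induction q with
  | zero => exact fun z => rfl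
  | succ q ih =>
    refine Finsupp.addHom_eq_of_single (f := (mapChain w (q + 1)).comp (sd p (q + 1)))
      (g := (sd r (q + 1)).comp (mapChain w (q + 1))) fun v => ?_
    simp only [AddMonoidHom.comp_apply]
    rw [sd_single, mapChain_cone, ih, mapChain_bd, mapChain_single, sd_single, affine_center]

theorem mapChain_sdHomotopy (w : Fin (p + 1) → TopSimplex r) : ∀ q (z : AffineChain p q),
    mapChain w (q + 1) (sdHomotopy p q z) = sdHomotopy r q (mapChain w q z) := by
  intro q
  induction q with
  | zero => exact fun z => map_zero _
  | succ q ih =>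
    refine Finsupp.addHom_eq_of_single (f := (mapChain w (q + 2)).comp (sdHomotopy p (q + 1)))
      (g := (sdHomotopy r (q + 1)).comp (mapChain w (q + 1))) fun v => ?_
    simp only [AddMonoidHom.comp_apply]
    rw [sdHomotopy_single, mapChain_cone, map_sub, ih, mapChain_bd, mapChain_single,
      sdHomotopy_single, affine_center]

/-- The iterated barycentric subdivision. -/
noncomputable def sdIter (N p q : ℕ) : AffineChain p q →+ AffineChain p q :=
  match N with
  | 0 => AddMonoidHom.id _
  | N + 1 => (sd p q).comp (sdIter N p q)

/-- The chain homotopy between the identity and the iterated barycentric subdivision. -/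
noncomputable def sdIterHomotopy (N p q : ℕ) : AffineChain p q →+ AffineChain p (q + 1) :=
  match N with
  | 0 => 0
  | N + 1 => sdIterHomotopy N p q + (sdHomotopy p q).comp (sdIter N p q)

theorem bd_sdIter (N : ℕ) (z : AffineChain p (q + 1)) :
    bd p q (sdIter N p (q + 1) z) = sdIter N p q (bd p q z) := by
  induction N with
  | zero => rfl
  | succ N ih => exact (bd_sd q _).trans (congrArg (sd p q) ih)

theorem bd_sdIterHomotopy (N : ℕ) (z : AffineChain p (q + 1)) :
    bd p (q + 1) (sdIterHomotopy N p (q + 1) z) =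
      z - sdIter N p (q + 1) z - sdIterHomotopy N p q (bd p q z) := by
  induction N with
  | zero =>
    change bd p (q + 1) 0 = z - z - 0
    simp
  | succ N ih =>
    change bd p (q + 1) (sdIterHomotopy N p (q + 1) z + sdHomotopy p (q + 1) (sdIter N p (q + 1) z))
      = z - sd p (q + 1) (sdIter N p (q + 1) z) - (sdIterHomotopy N p q (bd p q z) +
        sdHomotopy p q (sdIter N p q (bd p q z)))
    rw [map_add, ih, bd_sdHomotopy, bd_sdIter]
    abel

theorem mapChain_sdIter (N : ℕ) (w : Fin (p + 1) → TopSimplex r) (z : AffineChain p q) :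
    mapChain w q (sdIter N p q z) = sdIter N r q (mapChain w q z) := by
  induction N with
  | zero => rfl
  | succ N ih => exact (mapChain_sd w q _).trans (congrArg (sd r q) ih)

theorem mapChain_sdIterHomotopy (N : ℕ) (w : Fin (p + 1) → TopSimplex r) (z : AffineChain p q) :
    mapChain w (q + 1) (sdIterHomotopy N p q z) = sdIterHomotopy N r q (mapChain w q z) := by
  induction N with
  | zero => exact map_zero _
  | succ N ih =>
    change mapChain w (q + 1) (sdIterHomotopy N p q z + sdHomotopy p q (sdIter N p q z)) = _
    rw [map_add, ih, mapChain_sdHomotopy, mapChain_sdIter]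
    rfl

/-- Two properties are carried through the induction. Subdivision stays inside every closed ball
that contains the vertices; with the ball about the barycenter this bounds the distances to the new
vertex. All other pairs of vertices lie in the subdivision of a face, where the factor of one
dimension less is even smaller. -/
theorem sd_single_mem : ∀ q (v : Fin (q + 1) → TopSimplex p), sd p q (Finsupp.single v 1) ∈
    Finsupp.supportedIn {w : Fin (q + 1) → TopSimplex p |
      (∀ x c, (∀ j, dist (v j) x ≤ c) → ∀ i, dist (w i) x ≤ c) ∧
      ∀ c, (∀ i j, dist (v i) (v j) ≤ c) → ∀ i j, dist (w i) (w j) ≤ q / (q + 1) * c} := by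
  intro q
  induction q with
  | zero =>
    intro v
    refine Finsupp.single_mem_supportedIn 1 ⟨fun _ _ h => h, fun c _ i j => ?_⟩
    rw [Subsingleton.elim (α := Fin 1) i j]
    simp
  | succ q ih =>
    intro v
    rw [sd_single, bd_single]
    simp only [map_sum, map_zsmul]
    refine sum_mem fun i _ => zsmul_mem ?_ _
    refine Finsupp.map_mem_of_mem_supportedIn _ _ (fun w hw => ?_) (ih (v ∘ i.succAbove))
    rw [cone_single]
    refine Finsupp.single_mem_supportedIn 1 ⟨fun x c h j => ?_, fun c h j k => ?_⟩
    · induction j using Fin.cases with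
      | zero => exact dist_affine_le_of_forall_le v _ x h
      | succ j => exact hw.1 x c (fun _ => h _) j
    · have hc : 0 ≤ c := dist_nonneg.trans (h 0 0)
      have hcast : ((q + 1 : ℕ) : ℝ) = q + 1 := by push_cast; ring
      have hk : ∀ k, dist (w k) (center v) ≤ (q + 1 : ℕ) / ((q + 1 : ℕ) + 1) * c := fun k =>
        hw.1 _ _ (fun _ => (dist_comm _ _).trans_le (dist_center_le v h _)) k
      induction j using Fin.cases with
      | zero =>
        induction k using Fin.cases with
        | zero =>
          rw [dist_self]
          positivity
        | succ k => exact (dist_comm _ _).trans_le (hk k)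
      | succ j =>
        induction k using Fin.cases with
        | zero => exact hk j
        | succ k =>
          refine (hw.2 c (fun _ _ => h _ _) j k).trans (mul_le_mul_of_nonneg_right ?_ hc)
          rw [hcast, div_le_div_iff₀ (by positivity) (by positivity)]
          nlinarith

theorem sdIter_single_mem (N : ℕ) (v : Fin (q + 1) → TopSimplex p) {c : ℝ}
    (h : ∀ i j, dist (v i) (v j) ≤ c) : sdIter N p q (Finsupp.single v 1) ∈
      Finsupp.supportedIn {w : Fin (q + 1) → TopSimplex p |
        ∀ i j, dist (w i) (w j) ≤ ((q : ℝ) / (q + 1)) ^ N * c} := by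
  induction N with
  | zero =>
    refine Finsupp.single_mem_supportedIn 1 fun i j => ?_
    rw [pow_zero, one_mul]
    exact h i j
  | succ N ih =>
    refine Finsupp.map_mem_of_mem_supportedIn (sd p q) _ (fun w hw => ?_) ih
    refine Finsupp.supportedIn_mono ?_ (sd_single_mem q w)
    intro u hu i j
    rw [pow_succ', mul_assoc]
    exact hu.2 _ hw i j

end TopSimplex

/-! ### Subdivision of singular chains and small chains -/

namespace TopologicalSpace

open TopSimplex

variable {Y : Type} [TopologicalSpace Y] {p q r : ℕ}

/-- The singular chain given by a chain of affine simplices in a singular simplex. -/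
noncomputable def push (σ : C(TopSimplex p, Y)) (q : ℕ) :
    AffineChain p q →+ ((singular Y).simplex q →₀ ℤ) :=
  Finsupp.mapDomain.addMonoidHom fun v => (σ.comp (affine v))

theorem push_single (σ : C(TopSimplex p, Y)) (v : Fin (q + 1) → TopSimplex p) :
    push σ q (Finsupp.single v 1) = Finsupp.single (σ.comp (affine v)) 1 :=
  Finsupp.mapDomain_single

theorem push_bd (σ : C(TopSimplex p, Y)) (z : AffineChain p (q + 1)) :
    push σ q (bd p q z) = (singular Y).boundary q (push σ (q + 1) z) := by
  refine DeltaSet.mapDomain_boundary (tuples p) (singular Y) (fun _ v => σ.comp (affine v))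
    (fun _ i v => ?_) q z
  exact congrArg σ.comp (affine_comp_succAbove v i)

theorem push_mapChain (σ : C(TopSimplex p, Y)) (w : Fin (r + 1) → TopSimplex p)
    (z : AffineChain r q) : push σ q (mapChain w q z) = push (σ.comp (affine w)) q z := by
  refine Finsupp.addHom_eq_of_single (f := (push σ q).comp (mapChain w q))
    (g := push (σ.comp (affine w)) q) (fun v => ?_) z
  simp only [AddMonoidHom.comp_apply, mapChain_single]
  rw [push_single, push_single]
  refine congrArg (fun τ => Finsupp.single τ 1) (ContinuousMap.ext fun t => ?_)
  exact congrArg σ (affine_affine w v t).symm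

/-- The tuple of vertices of the standard simplex. -/
noncomputable def vertices (q : ℕ) : Fin (q + 1) → TopSimplex q := fun i => stdSimplex.vertex i

theorem push_vertices (σ : C(TopSimplex q, Y)) :
    push σ q (Finsupp.single (vertices q) 1) = Finsupp.single σ 1 := by
  rw [push_single]
  congr 1
  ext t
  exact congrArg σ (affine_vertex t)

/-- The iterated barycentric subdivision of singular chains. -/
noncomputable def subdivision (Y : Type) [TopologicalSpace Y] (N q : ℕ) :
    ((singular Y).simplex q →₀ ℤ) →+ ((singular Y).simplex q →₀ ℤ) :=
  Finsupp.freeLift fun σ => push σ q (sdIter N q q (Finsupp.single (vertices q) 1))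

/-- The chain homotopy between the identity and the iterated barycentric subdivision. -/
noncomputable def subdivisionHomotopy (Y : Type) [TopologicalSpace Y] (N q : ℕ) :
    ((singular Y).simplex q →₀ ℤ) →+ ((singular Y).simplex (q + 1) →₀ ℤ) :=
  Finsupp.freeLift fun σ => push σ (q + 1) (sdIterHomotopy N q q (Finsupp.single (vertices q) 1))

/-- Naturality: each face is the affine image of a standard simplex, and the homotopy commutes with
affine maps. This lets the affine homotopy formula descend to singular chains. -/
theorem push_sdIterHomotopy_bd (N : ℕ) (σ : C(TopSimplex (q + 1), Y)) :
    push σ (q + 1) (sdIterHomotopy N (q + 1) q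
      (bd (q + 1) q (Finsupp.single (vertices (q + 1)) 1))) =
    subdivisionHomotopy Y N q ((singular Y).boundary q (Finsupp.single σ 1)) := by
  rw [bd_single, (singular Y).boundary_single q σ]
  simp only [map_sum, map_zsmul]
  refine Finset.sum_congr rfl fun i _ => congrArg _ ?_
  have h : (Finsupp.single (vertices (q + 1) ∘ i.succAbove) 1 : AffineChain (q + 1) q) =
      mapChain (vertices (q + 1) ∘ i.succAbove) q (Finsupp.single (vertices q) 1) := by
    rw [mapChain_single]
    congr 1
    funext k
    exact (affine_apply_vertex _ k).symm
  rw [h, ← mapChain_sdIterHomotopy, push_mapChain]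
  have h' : σ.comp (affine (vertices (q + 1) ∘ i.succAbove)) =
      (singular Y).face i σ :=
    congrArg (ContinuousMap.comp σ) (faceMap_eq_affine i).symm
  rw [h']
  rw [subdivisionHomotopy, Finsupp.freeLift_single]

theorem boundary_subdivisionHomotopy (N : ℕ) (z : (singular Y).simplex (q + 1) →₀ ℤ) :
    (singular Y).boundary (q + 1) (subdivisionHomotopy Y N (q + 1) z) =
      z - subdivision Y N (q + 1) z - subdivisionHomotopy Y N q ((singular Y).boundary q z) := by
  refine Finsupp.addHom_eq_of_single
    (f := ((singular Y).boundary (q + 1)).comp (subdivisionHomotopy Y N (q + 1)))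
    (g := AddMonoidHom.id _ - subdivision Y N (q + 1) -
      (subdivisionHomotopy Y N q).comp ((singular Y).boundary q)) (fun σ => ?_) z
  change (singular Y).boundary (q + 1) (subdivisionHomotopy Y N (q + 1) (Finsupp.single σ 1)) =
    Finsupp.single σ 1 - subdivision Y N (q + 1) (Finsupp.single σ 1) -
      subdivisionHomotopy Y N q ((singular Y).boundary q (Finsupp.single σ 1))
  rw [← push_sdIterHomotopy_bd, subdivisionHomotopy, subdivision, Finsupp.freeLift_single,
    Finsupp.freeLift_single, ← push_bd, bd_sdIterHomotopy, map_sub, map_sub, push_vertices]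

/-- Subdivision makes chains small: if the boundary of a chain is small, the chain is homologous
to a small one. -/
theorem exists_sub_boundary_mem (𝒮 : ∀ q, Set C(TopSimplex q, Y))
    (comp_mem : ∀ q r, ∀ σ ∈ 𝒮 q, ∀ f : C(TopSimplex r, TopSimplex q), σ.comp f ∈ 𝒮 r)
    (local_mem : ∀ y, ∃ W, IsOpen W ∧ y ∈ W ∧
      ∀ q (σ : C(TopSimplex q, Y)), (∀ t, σ t ∈ W) → σ ∈ 𝒮 q)
    (q : ℕ) (z : (singular Y).simplex (q + 1) →₀ ℤ)
    (hz : (singular Y).boundary q z ∈ Finsupp.supportedIn (X := (singular Y).simplex q) (𝒮 q)) :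
    ∃ w, z - (singular Y).boundary (q + 1) w ∈
      Finsupp.supportedIn (X := (singular Y).simplex (q + 1)) (𝒮 (q + 1)) := by
  choose W hWo hW hWs using local_mem
  -- The Lebesgue number of the cover by the preimages of the `W y` exceeds the diameters of fine
  -- subdivisions, which shrink geometrically. All `N ≥ N₀` are needed because one `N` must serve
  -- every simplex of `z`.
  have key : ∀ σ : C(TopSimplex (q + 1), Y), ∃ N₀, ∀ N, N₀ ≤ N →
      push σ (q + 1) (sdIter N (q + 1) (q + 1) (Finsupp.single (vertices (q + 1)) 1)) ∈
        Finsupp.supportedIn (X := (singular Y).simplex (q + 1)) (𝒮 (q + 1)) := by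
    intro σ
    obtain ⟨δ, hδ, hball⟩ := lebesgue_number_lemma_of_metric (s := (Set.univ : Set (TopSimplex (q + 1))))
      (c := fun y => σ ⁻¹' W y) isCompact_univ (fun y => (hWo y).preimage σ.continuous)
      (fun t _ => Set.mem_iUnion.2 ⟨σ t, hW _⟩)
    have hlt : ((q + 1 : ℕ) : ℝ) / ((q + 1 : ℕ) + 1) < 1 := by
      rw [div_lt_one (by positivity)]
      linarith
    set c := Metric.diam (Set.univ : Set (TopSimplex (q + 1)))
    have hlim : Filter.Tendsto (fun N : ℕ => (((q + 1 : ℕ) : ℝ) / ((q + 1 : ℕ) + 1)) ^ N * c)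
        Filter.atTop (nhds 0) := by
      simpa using (tendsto_pow_atTop_nhds_zero_of_lt_one (by positivity) hlt).mul_const c
    obtain ⟨N₀, hN₀⟩ := Filter.eventually_atTop.1 (hlim.eventually (gt_mem_nhds hδ))
    refine ⟨N₀, fun N hN => Finsupp.map_mem_of_mem_supportedIn (push σ (q + 1)) _ (fun v hv => ?_)
      (sdIter_single_mem N (vertices (q + 1)) (c := c) fun i j =>
        Metric.dist_le_diam_of_mem (Metric.isBounded_of_compactSpace) trivial trivial)⟩
    rw [push_single]
    refine Finsupp.single_mem_supportedIn 1 ?_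
    obtain ⟨y, hy⟩ := hball (v 0) trivial
    refine hWs y _ _ fun t => hy ?_
    exact (dist_affine_le_of_forall_le v t (v 0) fun i => hv i 0).trans_lt (hN₀ N hN)
  choose N₀ hN₀ using key
  let N := z.support.sup N₀
  refine ⟨subdivisionHomotopy Y N (q + 1) z, ?_⟩
  -- With `w = T z` this gives `z - ∂T z = sd z + T ∂z`. The first summand is small by the choice of
  -- `N`; the second is, because `∂z` is small and `T` only precomposes simplices with affine maps.
  have h : ∀ a b c : (singular Y).simplex (q + 1) →₀ ℤ, a - (a - b - c) = b + c := by
    intro a b c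
    abel
  rw [boundary_subdivisionHomotopy, h]
  refine add_mem ?_ ?_
  · refine Finsupp.map_mem_of_mem_supportedIn (subdivision Y N (q + 1)) _ (fun σ hσ => ?_)
      (Finsupp.mem_supportedIn_support z)
    rw [subdivision, Finsupp.freeLift_single]
    exact hN₀ σ N (Finset.le_sup (f := N₀) hσ)
  · refine Finsupp.map_mem_of_mem_supportedIn (subdivisionHomotopy Y N q) _ (fun σ hσ => ?_) hz
    rw [subdivisionHomotopy, Finsupp.freeLift_single]
    refine Finsupp.map_mem_of_mem_supportedIn (push σ (q + 1)) _ (fun v _ => ?_)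
      (Finsupp.mem_supportedIn_support _)
    rw [push_single]
    exact Finsupp.single_mem_supportedIn 1 (comp_mem q _ σ hσ _)

end TopologicalSpace

/-! ### Ranks of vertices with respect to a weight threshold -/

namespace TopSimplex

variable {n : ℕ}

theorem map_succAbove_apply (i : Fin (n + 2)) (t : TopSimplex n) (a : Fin (n + 1)) :
    stdSimplex.map i.succAbove t (i.succAbove a) = t a := by
  rw [map_apply_eq_sum]
  simp

theorem map_succAbove_self (i : Fin (n + 2)) (t : TopSimplex n) :
    stdSimplex.map i.succAbove t i = 0 := by
  rw [map_apply_eq_sum]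
  simp

theorem continuous_coord (i : Fin (n + 1)) : Continuous fun t : TopSimplex n => t i :=
  (continuous_apply i).comp continuous_subtype_val

/-- The number of vertices before `a` of weight more than `ε`. -/
noncomputable def rank (ε : ℝ) (t : TopSimplex n) (a : Fin (n + 1)) : ℕ :=
  Nat.card {i : Fin (n + 1) // i < a ∧ ε < t i}

/-- A face inclusion inserts a vertex of weight `0`, which is not counted for a threshold `ε ≥ 0`.
So ranks are compatible with the gluing. -/
theorem rank_map_succAbove {ε : ℝ} (hε : 0 ≤ ε) (i : Fin (n + 2)) (t : TopSimplex n)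
    (a : Fin (n + 1)) : rank ε (stdSimplex.map i.succAbove t) (i.succAbove a) = rank ε t a := by
  refine (Nat.card_congr (Equiv.ofBijective (fun b : {b : Fin (n + 1) // b < a ∧ ε < t b} =>
    (⟨i.succAbove b.1, Fin.succAbove_lt_succAbove_iff.2 b.2.1,
      (map_succAbove_apply i t b.1).symm ▸ b.2.2⟩ :
      {b : Fin (n + 2) // b < i.succAbove a ∧ ε < stdSimplex.map i.succAbove t b}))
    ⟨fun b c h => Subtype.ext (Fin.succAbove_right_injective (Subtype.ext_iff.1 h)), ?_⟩)).symm
  rintro ⟨b, hb, hb'⟩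
  by_cases h : b = i
  · subst h
    rw [map_succAbove_self] at hb'
    exact absurd hb' hε.not_gt
  · obtain ⟨b, rfl⟩ := Fin.exists_succAbove_eq h
    exact ⟨⟨b, Fin.succAbove_lt_succAbove_iff.1 hb, map_succAbove_apply i t b ▸ hb'⟩, rfl⟩

theorem rank_lt_rank {ε : ℝ} {t : TopSimplex n} {a b : Fin (n + 1)} (ha : ε < t a) (h : a < b) :
    rank ε t a < rank ε t b := by
  classical
  simp only [rank, Nat.card_eq_fintype_card, Fintype.card_subtype]
  refine Finset.card_lt_card ⟨fun i hi => ?_, fun hs => ?_⟩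
  · rw [Finset.mem_filter_univ] at hi ⊢
    exact ⟨hi.1.trans h, hi.2⟩
  · exact absurd ((Finset.mem_filter_univ _).1 (hs ((Finset.mem_filter_univ a).2 ⟨h, ha⟩))).1
      (lt_irrefl a)

theorem rank_lt_rank_iff {ε : ℝ} {t : TopSimplex n} {a b : Fin (n + 1)} (ha : ε < t a)
    (hb : ε < t b) : rank ε t a < rank ε t b ↔ a < b := by
  refine ⟨fun h => ?_, rank_lt_rank ha⟩
  rcases lt_trichotomy a b with h' | rfl | h'
  · exact h'
  · exact absurd h (lt_irrefl _)
  · exact absurd h (rank_lt_rank hb h').not_gt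

theorem rank_inj {ε : ℝ} {t : TopSimplex n} {a b : Fin (n + 1)} (ha : ε < t a)
    (hb : ε < t b) (h : rank ε t a = rank ε t b) : a = b := by
  rcases lt_trichotomy a b with h' | h' | h'
  · exact absurd h (rank_lt_rank ha h').ne
  · exact h'
  · exact absurd h (rank_lt_rank hb h').ne'

/-- If no weight equals `ε`, nearby points have the same set of vertices of weight above `ε`. -/
theorem isOpen_rank_eq (ε : ℝ) {k : ℕ} (γ : Fin k → Fin (n + 1)) (m : Fin k → ℕ) :
    IsOpen {t : TopSimplex n | (∀ i, t i ≠ ε) ∧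
      ∀ j, ε < t (γ j) ∧ rank ε t (γ j) = m j} := by
  rw [isOpen_iff_mem_nhds]
  rintro t ⟨ht, htγ⟩
  have h : ∀ i, ∀ᶠ u : TopSimplex n in nhds t, u i ≠ ε ∧ (ε < u i ↔ ε < t i) := by
    intro i
    rcases (ht i).lt_or_gt with h | h
    · filter_upwards [(continuous_coord i).continuousAt.eventually (gt_mem_nhds h)] with u hu
      exact ⟨hu.ne, iff_of_false hu.not_gt h.not_gt⟩
    · filter_upwards [(continuous_coord i).continuousAt.eventually (lt_mem_nhds h)] with u hu
      exact ⟨hu.ne', iff_of_true hu h⟩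
  filter_upwards [Filter.eventually_all.2 h] with u hu
  refine ⟨fun i => (hu i).1, fun j => ⟨(hu _).2.2 (htγ j).1, ?_⟩⟩
  rw [← (htγ j).2, rank, rank]
  simp only [(hu _).2]

theorem exists_pos_lt (t : TopSimplex n) : ∃ ε : ℝ, 0 < ε ∧ ∀ i, 0 < t i → ε < t i := by
  have h : ∀ i, ∃ ε : ℝ, 0 < ε ∧ (0 < t i → ε < t i) := by
    intro i
    by_cases hi : 0 < t i
    · exact ⟨t i / 2, half_pos hi, fun _ => half_lt_self hi⟩
    · exact ⟨1, one_pos, fun h => absurd h hi⟩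
  choose ε hε h using h
  refine ⟨Finset.univ.inf' Finset.univ_nonempty ε, ?_, fun i hi => ?_⟩
  · rw [Finset.lt_inf'_iff]
    exact fun i _ => hε i
  · exact (Finset.inf'_le _ (Finset.mem_univ i)).trans_lt (h i hi)

theorem exists_coord_pos (t : TopSimplex n) : ∃ i, 0 < t i := by
  by_contra! h
  have h1 : ∑ i, t i = 1 := stdSimplex.sum_eq_one t
  have h2 : ∑ i, t i ≤ 0 := Finset.sum_nonpos fun i _ => h i
  linarith

end TopSimplex

theorem OrderEmbedding.exists_trans_succAbove {k n : ℕ} (γ : Fin k ↪o Fin (n + 2))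
    {i : Fin (n + 2)} (h : ∀ j, γ j ≠ i) :
    ∃ δ : Fin k ↪o Fin (n + 1), γ = δ.trans (Fin.succAboveOrderEmb i) := by
  choose γ' hγ' using fun j => Fin.exists_succAbove_eq (h j)
  exact ⟨OrderEmbedding.ofStrictMono γ' fun a b h => by
    rw [← Fin.succAbove_lt_succAbove_iff (p := i), hγ', hγ']
    exact γ.strictMono h, RelEmbedding.ext fun j => (hγ' j).symm⟩

/-! ### The étale spaces of marked points -/

namespace DeltaSet

open TopSimplex

variable (X : DeltaSet.{0})

/-- Points of simplices of a `Δ`-set, with `k` marked vertices of positive weight. -/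
abbrev MarkedCells (k : ℕ) : Type :=
  Σ p : (Σ n : ℕ, X.simplex n × (Fin k ↪o Fin (n + 1))),
    {t : TopSimplex p.1 // ∀ j, 0 < t (p.2.2 j)}

/-- The gluing of simplices with marked vertices along faces that contain the marked vertices. -/
inductive MarkedGlue (k : ℕ) : X.MarkedCells k → X.MarkedCells k → Prop
  | face {n : ℕ} (i : Fin (n + 2)) (x : X.simplex (n + 1)) (γ : Fin k ↪o Fin (n + 1))
      (t : TopSimplex n) (ht : ∀ j, 0 < t (γ j))
      (ht' : ∀ j, 0 < stdSimplex.map i.succAbove t (γ.trans (Fin.succAboveOrderEmb i) j)) :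
      MarkedGlue k ⟨⟨n, X.face i x, γ⟩, ⟨t, ht⟩⟩
        ⟨⟨n + 1, x, γ.trans (Fin.succAboveOrderEmb i)⟩, ⟨stdSimplex.map i.succAbove t, ht'⟩⟩

/-- The space of points of the realization with `k` marked vertices of the carrier, in order. -/
def Marked (k : ℕ) : Type := Quot (X.MarkedGlue k)

instance (k : ℕ) : TopologicalSpace (X.Marked k) :=
  inferInstanceAs (TopologicalSpace (Quot (X.MarkedGlue k)))

namespace Marked

variable {X} {k l : ℕ}

/-- The marked point given by a point of a simplex. -/
def mk {n : ℕ} (x : X.simplex n) (γ : Fin k ↪o Fin (n + 1)) (t : TopSimplex n)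
    (ht : ∀ j, 0 < t (γ j)) : X.Marked k :=
  Quot.mk _ ⟨⟨n, x, γ⟩, ⟨t, ht⟩⟩

theorem mk_face {n : ℕ} (i : Fin (n + 2)) (x : X.simplex (n + 1)) (γ : Fin k ↪o Fin (n + 1))
    (t : TopSimplex n) (ht : ∀ j, 0 < t (γ j))
    (ht' : ∀ j, 0 < stdSimplex.map i.succAbove t (γ.trans (Fin.succAboveOrderEmb i) j)) :
    mk (X.face i x) γ t ht =
      mk x (γ.trans (Fin.succAboveOrderEmb i)) (stdSimplex.map i.succAbove t) ht' :=
  Quot.sound (.face i x γ t ht ht')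

theorem continuous_mk {n : ℕ} (x : X.simplex n) (γ : Fin k ↪o Fin (n + 1)) :
    Continuous fun t : {t : TopSimplex n // ∀ j, 0 < t (γ j)} => mk x γ t.1 t.2 :=
  continuous_quot_mk.comp
    (continuous_sigmaMk (σ := fun p : (Σ n : ℕ, X.simplex n × (Fin k ↪o Fin (n + 1))) =>
      {t : TopSimplex p.1 // ∀ j, 0 < t (p.2.2 j)}) (i := ⟨n, x, γ⟩))

theorem isOpen_iff {s : Set (X.Marked k)} : IsOpen s ↔ ∀ (n : ℕ) (x : X.simplex n)
    (γ : Fin k ↪o Fin (n + 1)),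
      IsOpen {t : {t : TopSimplex n // ∀ j, 0 < t (γ j)} | mk x γ t.1 t.2 ∈ s} := by
  refine (isQuotientMap_quot_mk (r := X.MarkedGlue k)).isOpen_preimage.symm.trans
    (isOpen_sigma_iff.trans ?_)
  exact ⟨fun h n x γ => h ⟨n, x, γ⟩, fun h p => h p.1 p.2.1 p.2.2⟩

/-- The underlying point of the realization. -/
def proj : X.Marked k → X.Realization :=
  Quot.lift (fun a => Quot.mk _ ⟨⟨a.1.1, a.1.2.1⟩, a.2.1⟩) (by
    rintro _ _ ⟨i, x, γ, t, ht, ht'⟩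
    exact Quot.sound (.face i x t))

theorem continuous_proj : Continuous (proj : X.Marked k → X.Realization) := by
  refine continuous_quot_lift _ (continuous_sigma fun p => ?_)
  exact continuous_quot_mk.comp ((continuous_sigmaMk
    (σ := fun p : (Σ n : ℕ, X.simplex n) => TopSimplex p.1) (i := ⟨p.1, p.2.1⟩)).comp
      continuous_subtype_val)

/-- Forgetting some of the marks. -/
def pull (δ : Fin l ↪o Fin k) : C(X.Marked k, X.Marked l) where
  toFun := Quot.lift (fun a => mk a.1.2.1 (δ.trans a.1.2.2) a.2.1 fun j => a.2.2 (δ j)) (by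
    rintro _ _ ⟨i, x, γ, t, ht, ht'⟩
    exact mk_face i x (δ.trans γ) t _ _)
  continuous_toFun := by
    refine continuous_quot_lift _ (continuous_sigma fun p => ?_)
    exact (continuous_mk p.2.1 (δ.trans p.2.2)).comp
      (Continuous.subtype_mk (f := fun t : {t : TopSimplex p.1 // ∀ j, 0 < t (p.2.2 j)} => t.1)
        continuous_subtype_val fun t j => t.2 (δ j))

theorem pull_mk (δ : Fin l ↪o Fin k) {n : ℕ} (x : X.simplex n) (γ : Fin k ↪o Fin (n + 1))
    (t : TopSimplex n) (ht : ∀ j, 0 < t (γ j)) :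
    pull δ (mk x γ t ht) = mk x (δ.trans γ) t fun j => ht (δ j) := rfl

theorem ind {motive : X.Marked k → Prop} (h : ∀ (n : ℕ) (x : X.simplex n)
    (γ : Fin k ↪o Fin (n + 1)) (t : TopSimplex n) (ht : ∀ j, 0 < t (γ j)), motive (mk x γ t ht))
    (c : X.Marked k) : motive c :=
  Quot.ind (fun a => h a.1.1 a.1.2.1 a.1.2.2 a.2.1 a.2.2) c

theorem proj_pull (δ : Fin l ↪o Fin k) (c : X.Marked k) : proj (pull δ c) = proj c := by
  induction c using ind
  rfl

theorem pull_pull {m : ℕ} (δ : Fin m ↪o Fin l) (δ' : Fin l ↪o Fin k) (c : X.Marked k) :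
    pull δ (pull δ' c) = pull (δ.trans δ') c := by
  induction c using ind
  rfl

/-- The ranks of the marked vertices in the carrier. -/
noncomputable def rank : X.Marked k → Fin k → ℕ :=
  Quot.lift (fun a j => TopSimplex.rank 0 a.2.1 (a.1.2.2 j)) (by
    rintro _ _ ⟨i, x, γ, t, ht, ht'⟩
    exact funext fun j => (rank_map_succAbove le_rfl i t (γ j)).symm)

theorem rank_pull (δ : Fin l ↪o Fin k) (c : X.Marked k) (j : Fin l) :
    rank (pull δ c) j = rank c (δ j) := by
  induction c using ind
  rfl

theorem strictMono_rank (c : X.Marked k) : StrictMono (rank c) := by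
  induction c using ind with
  | h n x γ t ht => exact fun i j h => rank_lt_rank (ht i) (γ.strictMono h)

/-- The marked points such that no weight is `ε`, the marked vertices have weight more than `ε`,
and `m` counts the vertices of weight more than `ε` before a marked vertex. -/
def sheet (ε : Set.Ioi (0 : ℝ)) (m : Fin k → ℕ) : Set (X.Marked k) :=
  Quot.lift (fun a => (∀ i, a.2.1 i ≠ ε.1) ∧ ∀ j, ε.1 < a.2.1 (a.1.2.2 j) ∧
    TopSimplex.rank ε.1 a.2.1 (a.1.2.2 j) = m j) (by
    rintro _ _ ⟨i, x, γ, t, ht, ht'⟩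
    refine propext (and_congr ?_ (forall_congr' fun j => ?_))
    · change (∀ a, t a ≠ ε.1) ↔ ∀ a, stdSimplex.map i.succAbove t a ≠ ε.1
      rw [Fin.forall_iff_succAbove i]
      have hε : (0 : ℝ) ≠ ε.1 := (show (0 : ℝ) < ε.1 from ε.2).ne
      simp only [map_succAbove_apply, map_succAbove_self, ne_eq, hε, not_false_eq_true, true_and]
    · change ε.1 < t (γ j) ∧ TopSimplex.rank ε.1 t (γ j) = m j ↔
        ε.1 < stdSimplex.map i.succAbove t (i.succAbove (γ j)) ∧
          TopSimplex.rank ε.1 (stdSimplex.map i.succAbove t) (i.succAbove (γ j)) = m j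
      rw [map_succAbove_apply, rank_map_succAbove (show (0 : ℝ) < ε.1 from ε.2).le])

/-- The rank itself is not locally constant: vertices of weight `0` can acquire small positive
weight nearby. Counting above a threshold `ε > 0` ignores them, and the sheets are the local
sections of `proj`. -/
theorem isOpen_sheet (ε : Set.Ioi (0 : ℝ)) (m : Fin k → ℕ) :
    IsOpen (sheet ε m : Set (X.Marked k)) :=
  isOpen_iff.2 fun _ _ γ => (isOpen_rank_eq ε.1 γ m).preimage continuous_subtype_val

/-- A marked point can be represented in any simplex that contains the underlying point. -/
theorem exists_mk_of_proj_eq {n : ℕ} (x : X.simplex n) (t : TopSimplex n) (c : X.Marked k)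
    (h : proj c = Quot.mk _ ⟨⟨n, x⟩, t⟩) : ∃ γ ht, c = mk x γ t ht := by
  -- Marks move along each gluing in both directions. Passing down to a face is possible because the
  -- omitted vertex has weight `0` and is therefore not marked.
  let r : X.Cells → X.Cells → Prop := fun a b =>
    ∀ (γ : Fin k ↪o Fin (a.1.1 + 1)) (ht : ∀ j, 0 < a.2 (γ j)),
      ∃ γ' ht', mk a.1.2 γ a.2 ht = mk b.1.2 γ' b.2 ht'
  have key : ∀ a b, Relation.EqvGen X.Glue a b → r a b ∧ r b a := by
    intro a b hab
    induction hab with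
    | rel a b h =>
      obtain ⟨i, x, t⟩ := h
      constructor
      · intro γ ht
        exact ⟨γ.trans (Fin.succAboveOrderEmb i),
          fun j => (map_succAbove_apply i t (γ j)).symm ▸ ht j, mk_face i x γ t ht _⟩
      · intro γ ht
        have hγ : ∀ j, γ j ≠ i := by
          intro j hj
          have h : 0 < stdSimplex.map i.succAbove t (γ j) := ht j
          rw [hj, map_succAbove_self] at h
          exact lt_irrefl _ h
        obtain ⟨γ, rfl⟩ := OrderEmbedding.exists_trans_succAbove γ hγ
        exact ⟨γ, fun j => map_succAbove_apply i t (γ j) ▸ ht j, (mk_face i x γ t _ ht).symm⟩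
    | refl a => exact ⟨fun γ ht => ⟨γ, ht, rfl⟩, fun γ ht => ⟨γ, ht, rfl⟩⟩
    | symm a b _ ih => exact ih.symm
    | trans a b c _ _ ih ih' =>
      have tr : ∀ {a b c}, r a b → r b c → r a c := by
        intro a b c h h' γ ht
        obtain ⟨γ', ht', e⟩ := h γ ht
        obtain ⟨γ'', ht'', e'⟩ := h' γ' ht'
        exact ⟨γ'', ht'', e.trans e'⟩
      exact ⟨tr ih.1 ih'.1, tr ih'.2 ih.2⟩
  induction c using ind with
  | h n' x' γ t' ht => exact (key _ _ (Quot.eqvGen_exact h)).1 γ ht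

theorem eq_of_rank_eq {c c' : X.Marked k} (h : proj c = proj c') (hr : rank c = rank c') :
    c = c' := by
  induction c' using ind with
  | h n x γ t ht =>
    obtain ⟨γ', ht', rfl⟩ := exists_mk_of_proj_eq x t c h
    obtain rfl : γ' = γ := by
      ext j
      exact congrArg Fin.val (rank_inj (ht' j) (ht j) (congrFun hr j))
    rfl

theorem eq_of_mem_sheet {c c' : X.Marked k} (h : proj c = proj c') {ε : Set.Ioi (0 : ℝ)}
    {m : Fin k → ℕ} (hc : c ∈ sheet ε m) (hc' : c' ∈ sheet ε m) : c = c' := by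
  induction c' using ind with
  | h n x γ t ht =>
    obtain ⟨γ', ht', rfl⟩ := exists_mk_of_proj_eq x t c h
    obtain rfl : γ' = γ := by
      ext j
      exact congrArg Fin.val (rank_inj (hc.2 j).1 (hc'.2 j).1 ((hc.2 j).2.trans (hc'.2 j).2.symm))
    rfl

/-- The order of two marks over the same point can be read off from the sheet numbers, which are
locally constant although the ranks are not. -/
theorem rank_lt_rank_iff_of_mem_sheet {c c' : X.Marked k} (h : proj c = proj c')
    {ε : Set.Ioi (0 : ℝ)} {m m' : Fin k → ℕ} (hc : c ∈ sheet ε m) (hc' : c' ∈ sheet ε m')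
    (j : Fin k) : rank c j < rank c' j ↔ m j < m' j := by
  induction c' using ind with
  | h n x γ t ht =>
    obtain ⟨γ', ht', rfl⟩ := exists_mk_of_proj_eq x t c h
    refine (TopSimplex.rank_lt_rank_iff (ht' j) (ht j)).trans ?_
    rw [← (hc.2 j).2, ← (hc'.2 j).2]
    exact (TopSimplex.rank_lt_rank_iff (hc.2 j).1 (hc'.2 j).1).symm

/-- Any `ε` below all positive weights of `p` works. It does not depend on `k` or `c`, so that all
lifts of `p` can be compared with a common threshold. -/
theorem exists_mem_sheet (p : X.Realization) : ∃ ε : Set.Ioi (0 : ℝ), ∀ (k : ℕ) (c : X.Marked k),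
    proj c = p → ∃ m, c ∈ sheet ε m := by
  induction p using Quot.ind with
  | mk a =>
    obtain ⟨⟨n, x⟩, t⟩ := a
    obtain ⟨ε, hε, h⟩ := exists_pos_lt t
    refine ⟨⟨ε, hε⟩, fun k c hc => ?_⟩
    obtain ⟨γ, ht, rfl⟩ := exists_mk_of_proj_eq x t c hc
    refine ⟨fun j => TopSimplex.rank ε t (γ j), fun i hi => ?_, fun j => ⟨h _ (ht j), rfl⟩⟩
    exact (h i (hi ▸ hε)).ne' hi

/-- In each simplex the preimage of an image is the union over all choices `γ` of marked vertices of
open subsets of the open sets where these vertices have positive weight. -/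
theorem isOpenMap_proj : IsOpenMap (proj : X.Marked k → X.Realization) := by
  intro s hs
  refine (isQuotientMap_quot_mk (r := X.Glue)).isOpen_preimage.1 (isOpen_sigma_iff.2 ?_)
  rintro ⟨n, x⟩
  have h : {t : TopSimplex n | ∃ c ∈ s, proj c = Quot.mk X.Glue ⟨⟨n, x⟩, t⟩} =
      ⋃ γ : Fin k ↪o Fin (n + 1), Subtype.val ''
        {t : {t : TopSimplex n // ∀ j, 0 < t (γ j)} | mk x γ t.1 t.2 ∈ s} := by
    ext t
    simp only [Set.mem_ofPred_eq, Set.mem_image, Set.mem_iUnion]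
    constructor
    · rintro ⟨c, hc, h⟩
      obtain ⟨γ, ht, rfl⟩ := exists_mk_of_proj_eq x t c h
      exact ⟨γ, ⟨t, ht⟩, hc, rfl⟩
    · rintro ⟨γ, ⟨t, ht⟩, hc, rfl⟩
      exact ⟨_, hc, rfl⟩
  change IsOpen {t : TopSimplex n | ∃ c ∈ s, proj c = Quot.mk X.Glue ⟨⟨n, x⟩, t⟩}
  rw [h]
  refine isOpen_iUnion fun γ => ?_
  have ho : IsOpen {t : TopSimplex n | ∀ j, 0 < t (γ j)} := by
    rw [Set.ofPred_forall]
    exact isOpen_iInter_of_finite fun j => isOpen_lt continuous_const (continuous_coord _)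
  exact ho.isOpenMap_subtype_val _ (isOpen_iff.1 hs n x γ)

/-- A lift of a continuous map is continuous if it stays locally in a sheet. -/
theorem continuous_of_eventually_mem_sheet {Z : Type*} [TopologicalSpace Z] (τ : Z → X.Marked k)
    (hτ : Continuous fun z => proj (τ z))
    (h : ∀ z, ∃ ε m, ∀ᶠ y in nhds z, τ y ∈ sheet ε m) : Continuous τ := by
  rw [continuous_iff_continuousAt]
  intro z
  obtain ⟨ε, m, hm⟩ := h z
  refine tendsto_nhds.2 fun O hO hz => ?_
  have ho : IsOpen (proj '' (O ∩ sheet ε m)) := isOpenMap_proj _ (hO.inter (isOpen_sheet ε m))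
  filter_upwards [hm, hτ.continuousAt.eventually (ho.mem_nhds ⟨τ z, ⟨hz, hm.self_of_nhds⟩, rfl⟩)]
    with y hy ⟨c, hc, hcy⟩
  change τ y ∈ O
  exact (eq_of_mem_sheet hcy hc.2 hy : c = τ y) ▸ (show c ∈ O from hc.1)

theorem exists_proj_eq (p : X.Realization) : ∃ c : X.Marked 1, proj c = p := by
  induction p using Quot.ind with
  | mk a =>
    obtain ⟨⟨n, x⟩, t⟩ := a
    obtain ⟨i, hi⟩ := exists_coord_pos t
    exact ⟨mk x (OrderEmbedding.ofStrictMono (fun _ : Fin 1 => i) (Subsingleton.strictMono _)) t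
      fun _ => hi, rfl⟩

/-- The image of a sheet is open and `proj` is injective on the sheet, so a map into this image
lifts pointwise to the sheet, and the lift is continuous. -/
theorem exists_section (p : X.Realization) : ∃ W : Set X.Realization, IsOpen W ∧ p ∈ W ∧
    ∀ (Z : Type) [TopologicalSpace Z] (σ : C(Z, X.Realization)), (∀ z, σ z ∈ W) →
      ∃ s : C(Z, X.Marked 1), ∀ z, proj (s z) = σ z := by
  obtain ⟨c, hc⟩ := exists_proj_eq p
  obtain ⟨ε, hε⟩ := exists_mem_sheet p
  obtain ⟨m, hm⟩ := hε 1 c hc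
  refine ⟨proj '' sheet ε m, isOpenMap_proj _ (isOpen_sheet ε m), ⟨c, hm, hc⟩, fun Z _ σ hσ => ?_⟩
  choose s hs hs' using hσ
  refine ⟨⟨s, continuous_of_eventually_mem_sheet s ?_ fun z =>
    ⟨ε, m, Filter.Eventually.of_forall hs⟩⟩, hs'⟩
  simp only [hs']
  exact σ.continuous

/-- On a connected space the order of two lifts is thus decided at a single point; this is what
makes the set of lifts totally ordered. -/
theorem isClopen_rank_lt {Z : Type*} [TopologicalSpace Z] (s s' : C(Z, X.Marked k))
    (h : ∀ z, proj (s z) = proj (s' z)) (j : Fin k) :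
    IsClopen {z | rank (s z) j < rank (s' z) j} := by
  have key : ∀ z, ∀ᶠ y in nhds z,
      (rank (s y) j < rank (s' y) j ↔ rank (s z) j < rank (s' z) j) := by
    intro z
    obtain ⟨ε, hε⟩ := exists_mem_sheet (proj (s z))
    obtain ⟨m, hm⟩ := hε k (s z) rfl
    obtain ⟨m', hm'⟩ := hε k (s' z) (h z).symm
    filter_upwards [s.continuous.continuousAt.eventually ((isOpen_sheet ε m).mem_nhds hm),
      s'.continuous.continuousAt.eventually ((isOpen_sheet ε m').mem_nhds hm')] with y hy hy'
    rw [rank_lt_rank_iff_of_mem_sheet (h y) hy hy', rank_lt_rank_iff_of_mem_sheet (h z) hm hm']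
  constructor
  · rw [← isOpen_compl_iff, isOpen_iff_mem_nhds]
    intro z hz
    filter_upwards [key z] with y hy
    exact fun h => hz (hy.1 h)
  · rw [isOpen_iff_mem_nhds]
    intro z hz
    filter_upwards [key z] with y hy
    exact hy.2 hz

theorem rank_lt_of_exists {Z : Type*} [TopologicalSpace Z] [PreconnectedSpace Z]
    {s s' : C(Z, X.Marked k)} (h : ∀ z, proj (s z) = proj (s' z)) {j : Fin k} {z₀ : Z}
    (h₀ : rank (s z₀) j < rank (s' z₀) j) (z : Z) : rank (s z) j < rank (s' z) j := by
  have hz : z ∈ {z | rank (s z) j < rank (s' z) j} := by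
    rw [(isClopen_rank_lt s s' h j).eq_univ ⟨z₀, h₀⟩]
    trivial
  exact hz

theorem eq_of_rank_apply_eq {Z : Type*} [TopologicalSpace Z] [PreconnectedSpace Z]
    {s s' : C(Z, X.Marked k)} (h : ∀ z, proj (s z) = proj (s' z)) {z₀ : Z}
    (h₀ : rank (s z₀) = rank (s' z₀)) : s = s' := by
  ext z
  refine eq_of_rank_eq (h z) (funext fun j => ?_)
  rcases lt_trichotomy (rank (s z) j) (rank (s' z) j) with h' | h' | h'
  · exact absurd (rank_lt_of_exists h h' z₀) (congrFun h₀ j).not_lt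
  · exact h'
  · exact absurd (rank_lt_of_exists (fun z => (h z).symm) h' z₀) (congrFun h₀ j).not_gt

end Marked

end DeltaSet

/-! ### Exactness of the rows: coning with the lowest lift -/

namespace DeltaSet

section cone

variable (R : DeltaSet.{0}) (L : ∀ k, Set (R.simplex k))

open scoped Classical in
/-- The homomorphism on chains that maps the first face of a simplex in `L` to this simplex, and
simplices in `L` to zero. -/
noncomputable def unface (k : ℕ) : (R.simplex k →₀ ℤ) →+ (R.simplex (k + 1) →₀ ℤ) :=
  Finsupp.freeLift fun τ =>
    if h : ∃ ρ ∈ L (k + 1), R.face 0 ρ = τ then Finsupp.single h.choose 1 else 0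

variable {R L}

theorem unface_face {k : ℕ}
    (inj : ∀ ρ ∈ L (k + 1), ∀ ρ' ∈ L (k + 1), R.face 0 ρ = R.face 0 ρ' → ρ = ρ')
    {ρ : R.simplex (k + 1)} (hρ : ρ ∈ L (k + 1)) :
    R.unface L k (Finsupp.single (R.face 0 ρ) 1) = Finsupp.single ρ 1 := by
  have h : ∃ ρ' ∈ L (k + 1), R.face 0 ρ' = R.face 0 ρ := ⟨ρ, hρ, rfl⟩
  rw [unface, Finsupp.freeLift_single, dif_pos h,
    inj _ h.choose_spec.1 ρ hρ h.choose_spec.2]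

theorem unface_of_mem {k : ℕ} (notMem : ∀ ρ ∈ L (k + 1), R.face 0 ρ ∉ L k)
    {τ : R.simplex k} (hτ : τ ∈ L k) : R.unface L k (Finsupp.single τ 1) = 0 := by
  rw [unface, Finsupp.freeLift_single, dif_neg]
  rintro ⟨ρ, hρ, rfl⟩
  exact notMem ρ hρ hτ

/-- `L` consists of the simplices that contain the cone point, and `unface` adds the cone point if
it is absent. For `τ ∈ L` only face 0 survives `unface` and returns `τ`. For `τ = d₀ ρ` the identity
`d_j d₀ = d₀ d_{j+1}` makes all terms cancel except `d₀ ρ`. -/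
theorem exact_boundary_of_unface
    (cover : ∀ k, ∀ τ : R.simplex k, τ ∈ L k ∨ ∃ ρ ∈ L (k + 1), R.face 0 ρ = τ)
    (inj : ∀ k, ∀ ρ ∈ L (k + 1), ∀ ρ' ∈ L (k + 1), R.face 0 ρ = R.face 0 ρ' → ρ = ρ')
    (notMem : ∀ k, ∀ ρ ∈ L (k + 1), R.face 0 ρ ∉ L k)
    (face_mem : ∀ k, ∀ ρ ∈ L (k + 1), ∀ j : Fin (k + 1), R.face j.succ ρ ∈ L k) (k : ℕ) :
    Function.Exact (R.boundary (k + 1)) (R.boundary k) := by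
  refine AddMonoidHom.exact_of_contraction _ _ (R.unface L (k + 1)) (R.unface L k)
    (R.boundary_boundary k) fun z => ?_
  refine Finsupp.addHom_eq_of_single (f := (R.boundary (k + 1)).comp (R.unface L (k + 1)) +
    (R.unface L k).comp (R.boundary k)) (g := AddMonoidHom.id _) (fun τ => ?_) z
  simp only [AddMonoidHom.add_apply, AddMonoidHom.comp_apply, AddMonoidHom.id_apply]
  rcases cover (k + 1) τ with hτ | ⟨ρ, hρ, rfl⟩
  · rw [unface_of_mem (notMem _) hτ, map_zero, zero_add, boundary_single, Fin.sum_univ_succ,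
      map_add, map_zsmul, unface_face (inj k) hτ, map_sum, Finset.sum_eq_zero, add_zero]
    · simp
    · intro j _
      rw [map_zsmul, unface_of_mem (notMem k) (face_mem k τ hτ j), smul_zero]
  · rw [unface_face (inj _) hρ, boundary_single, boundary_single, Fin.sum_univ_succ, map_sum,
      add_assoc, ← Finset.sum_add_distrib, Finset.sum_eq_zero, add_zero]
    · simp
    · intro j _
      rw [map_zsmul, ← Fin.castSucc_zero, ← R.face_face 0 j (Fin.zero_le j),
        unface_face (inj k) (face_mem _ ρ hρ j), Fin.val_succ, pow_succ, mul_neg, mul_one, neg_smul,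
        neg_add_cancel]

/-- In degree 0 the remaining face of the edge added to a vertex is the cone point `low`, which
depends only on the augmentation. -/
theorem exact_boundary_augmentation_of_unface {A : Type} (aug : R.simplex 0 → A)
    (low : A → R.simplex 0) (aug_face : ∀ ρ : R.simplex 1, aug (R.face 0 ρ) = aug (R.face 1 ρ))
    (low_aug : ∀ τ ∈ L 0, low (aug τ) = τ)
    (cover : ∀ τ : R.simplex 0, τ ∈ L 0 ∨ ∃ ρ ∈ L 1, R.face 0 ρ = τ)
    (inj : ∀ ρ ∈ L 1, ∀ ρ' ∈ L 1, R.face 0 ρ = R.face 0 ρ' → ρ = ρ')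
    (notMem : ∀ ρ ∈ L 1, R.face 0 ρ ∉ L 0)
    (face_mem : ∀ ρ ∈ L 1, R.face 1 ρ ∈ L 0) :
    Function.Exact (R.boundary 0) (Finsupp.mapDomain.addMonoidHom (M := ℤ) aug) := by
  have hb : ∀ ρ : R.simplex 1, R.boundary 0 (Finsupp.single ρ 1) =
      Finsupp.single (R.face 0 ρ) 1 - Finsupp.single (R.face 1 ρ) 1 := by
    intro ρ
    rw [boundary_single]
    refine (Fin.sum_univ_two _).trans ?_
    simp [sub_eq_add_neg]
  have hs : ∀ τ : R.simplex 0, Finsupp.mapDomain.addMonoidHom (M := ℤ) aug (Finsupp.single τ 1) =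
      Finsupp.single (aug τ) 1 := fun τ => Finsupp.mapDomain_single
  have hs' : ∀ σ : A, Finsupp.mapDomain.addMonoidHom (M := ℤ) low (Finsupp.single σ 1) =
      Finsupp.single (low σ) 1 := fun τ => Finsupp.mapDomain_single
  refine AddMonoidHom.exact_of_contraction _ _ (R.unface L 0)
    (Finsupp.mapDomain.addMonoidHom low) (fun z => ?_) fun z => ?_
  · refine Finsupp.addHom_eq_of_single (f := (Finsupp.mapDomain.addMonoidHom (M := ℤ) aug).comp
      (R.boundary 0)) (g := 0) (fun τ => ?_) z
    rw [AddMonoidHom.comp_apply, hb, map_sub, hs, hs, aug_face, sub_self]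
    rfl
  · refine Finsupp.addHom_eq_of_single (f := (R.boundary 0).comp (R.unface L 0) +
      (Finsupp.mapDomain.addMonoidHom low).comp (Finsupp.mapDomain.addMonoidHom aug))
      (g := AddMonoidHom.id _) (fun τ => ?_) z
    simp only [AddMonoidHom.add_apply, AddMonoidHom.comp_apply, AddMonoidHom.id_apply]
    rw [hs, hs']
    rcases cover τ with hτ | ⟨ρ, hρ, rfl⟩
    · rw [unface_of_mem notMem hτ, map_zero, zero_add, low_aug τ hτ]
    · rw [unface_face inj hρ, hb, aug_face, low_aug _ (face_mem ρ hρ), sub_add_cancel]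

end cone

namespace Marked

variable {X : DeltaSet.{0}} {k : ℕ}

/-- The inclusion of the first index. -/
def first (k : ℕ) : Fin 1 ↪o Fin (k + 1) :=
  OrderEmbedding.ofStrictMono (fun _ => 0) (Subsingleton.strictMono _)

theorem mem_sheet_of_pull {ε : Set.Ioi (0 : ℝ)} {m₀ : Fin 1 → ℕ} {m : Fin (k + 1) → ℕ}
    {c : X.Marked (k + 2)} (h₀ : pull (first _) c ∈ sheet ε m₀)
    (h : pull (Fin.succAboveOrderEmb 0) c ∈ sheet ε m) :
    c ∈ sheet ε (Fin.cons (m₀ 0) m : Fin (k + 2) → ℕ) := by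
  induction c using ind with
  | h n x γ t ht =>
    refine ⟨h.1, fun j => ?_⟩
    induction j using Fin.cases with
    | zero => exact h₀.2 0
    | succ j => exact h.2 j

theorem eq_of_pull_eq {c c' : X.Marked (k + 2)} (h₀ : rank c 0 = rank c' 0)
    (h : pull (Fin.succAboveOrderEmb 0) c = pull (Fin.succAboveOrderEmb 0) c') : c = c' := by
  have hp := congrArg proj h
  rw [proj_pull, proj_pull] at hp
  refine eq_of_rank_eq hp (funext fun j => ?_)
  induction j using Fin.cases with
  | zero => exact h₀
  | succ j =>
    have := congrFun (congrArg rank h) j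
    rw [rank_pull, rank_pull] at this
    exact this

theorem exists_pull_eq (c₀ : X.Marked 1) (c : X.Marked (k + 1)) (hp : proj c₀ = proj c)
    (hr : rank c₀ 0 < rank c 0) :
    ∃ c' : X.Marked (k + 2), pull (first _) c' = c₀ ∧ pull (Fin.succAboveOrderEmb 0) c' = c := by
  induction c using ind with
  | h n x γ t ht =>
    obtain ⟨γ₀, ht₀, rfl⟩ := exists_mk_of_proj_eq x t c₀ hp
    have hlt : γ₀ 0 < γ 0 := (TopSimplex.rank_lt_rank_iff (ht₀ 0) (ht 0)).1 hr
    let γ' : Fin (k + 2) ↪o Fin (n + 1) :=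
      OrderEmbedding.ofStrictMono (Fin.cons (γ₀ 0) γ : Fin (k + 2) → Fin (n + 1)) (by
        rw [Fin.strictMono_iff_lt_succ]
        intro i
        induction i using Fin.cases with
        | zero => exact hlt
        | succ i => exact γ.strictMono (Fin.castSucc_lt_succ (i := i)))
    refine ⟨mk x γ' t fun j => ?_, ?_, rfl⟩
    · induction j using Fin.cases with
      | zero => exact ht₀ 0
      | succ j => exact ht j
    · rw [pull_mk]
      congr 1
      ext j
      rw [Subsingleton.elim j 0]
      rfl

variable {Z : Type} [TopologicalSpace Z]

/-- The maps of a space to the spaces of marked points, with the faces that forget a mark. -/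
noncomputable abbrev maps (X : DeltaSet.{0}) (Z : Type) [TopologicalSpace Z] : DeltaSet.{0} where
  simplex k := C(Z, X.Marked (k + 1))
  face j τ := (pull (Fin.succAboveOrderEmb j)).comp τ
  face_face i j h τ := by
    ext z
    change pull _ (pull _ _) = pull _ (pull _ _)
    rw [pull_pull, pull_pull]
    refine congrArg (fun δ => pull δ (τ z)) (RelEmbedding.ext fun a => ?_)
    exact congrFun (Fin.succ_succAbove_comp_succAbove h) a

/-- The map to the realization that underlies a map to the space of marked points. -/
noncomputable def project (τ : C(Z, X.Marked k)) : C(Z, X.Realization) :=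
  ⟨fun z => proj (τ z), continuous_proj.comp τ.continuous⟩

/-- Prepends a lower lift to a tuple of lifts. The combined lift is continuous because common sheets
of the two parts give a sheet of the whole. -/
theorem exists_cons (s : C(Z, X.Marked 1)) (τ : C(Z, X.Marked (k + 1)))
    (hp : ∀ z, proj (s z) = proj (τ z)) (hr : ∀ z, rank (s z) 0 < rank (τ z) 0) :
    ∃ ρ : C(Z, X.Marked (k + 2)), (pull (first _)).comp ρ = s ∧
      (pull (Fin.succAboveOrderEmb 0)).comp ρ = τ := by
  choose ρ hρ hρ' using fun z => exists_pull_eq (s z) (τ z) (hp z) (hr z)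
  have hproj : ∀ z, proj (ρ z) = proj (τ z) := fun z => by rw [← hρ' z, proj_pull]
  refine ⟨⟨ρ, continuous_of_eventually_mem_sheet ρ ?_ fun z => ?_⟩, ContinuousMap.ext hρ,
    ContinuousMap.ext hρ'⟩
  · simp only [hproj]
    exact continuous_proj.comp τ.continuous
  · obtain ⟨ε, hε⟩ := exists_mem_sheet (proj (s z))
    obtain ⟨m₀, hm₀⟩ := hε _ (s z) rfl
    obtain ⟨m, hm⟩ := hε _ (τ z) (hp z).symm
    refine ⟨ε, Fin.cons (m₀ 0) m, ?_⟩
    filter_upwards [s.continuous.continuousAt.eventually ((isOpen_sheet ε m₀).mem_nhds hm₀),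
      τ.continuous.continuousAt.eventually ((isOpen_sheet ε m).mem_nhds hm)] with y hy hy'
    rw [← hρ y] at hy
    rw [← hρ' y] at hy'
    exact mem_sheet_of_pull hy hy'

/-- Among the lifts of a map to maps with one mark there is a lowest one. -/
theorem exists_lowest (z₀ : Z) : ∃ low : C(Z, X.Realization) → C(Z, X.Marked 1),
    ∀ s : C(Z, X.Marked 1), project (low (project s)) = project s ∧
      rank (low (project s) z₀) 0 ≤ rank (s z₀) 0 := by
  have h : ∀ σ : C(Z, X.Realization), ∃ l : C(Z, X.Marked 1), ∀ s : C(Z, X.Marked 1),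
      project s = σ → project l = σ ∧ rank (l z₀) 0 ≤ rank (s z₀) 0 := by
    intro σ
    by_cases hσ : ∃ s : C(Z, X.Marked 1), project s = σ
    · let S : Set C(Z, X.Marked 1) := {s | project s = σ}
      have hS : S.Nonempty := hσ
      refine ⟨Function.argminOn (fun s : C(Z, X.Marked 1) => rank (s z₀) 0) S hS, fun s hs =>
        ⟨Function.argminOn_mem (fun s : C(Z, X.Marked 1) => rank (s z₀) 0) S hS,
          Function.argminOn_le (fun s : C(Z, X.Marked 1) => rank (s z₀) 0) S hs⟩⟩
    -- A map without lifts gets an arbitrary value, since `low` must be defined on all maps; it is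
    -- only applied to projections of lifts.
    · obtain ⟨c, -⟩ := exists_proj_eq (σ z₀)
      exact ⟨ContinuousMap.const Z c, fun s hs => absurd ⟨s, hs⟩ hσ⟩
  choose low hlow using h
  exact ⟨low, fun s => hlow _ s rfl⟩

/-- Over a fixed map the lifts with `k + 1` marks are the increasing `(k + 1)`-tuples in a totally
ordered set of lifts, that is, the simplices of a full simplex; the lowest lift is the cone point.
-/
theorem exact_boundary_maps [PreconnectedSpace Z] (z₀ : Z) :
    (∀ k, Function.Exact ((maps X Z).boundary (k + 1)) ((maps X Z).boundary k)) ∧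
      Function.Exact ((maps X Z).boundary 0) (Finsupp.mapDomain.addMonoidHom (M := ℤ)
        (project : C(Z, X.Marked 1) → C(Z, X.Realization))) := by
  obtain ⟨low, hlow⟩ := exists_lowest (X := X) z₀
  let F : ∀ k, C(Z, X.Marked (k + 1)) → C(Z, X.Marked 1) := fun k τ => (pull (first k)).comp τ
  have hF : ∀ k (τ : C(Z, X.Marked (k + 1))), project (F k τ) = project τ := fun k τ =>
    ContinuousMap.ext fun z => proj_pull _ _
  have hFr : ∀ k (τ : C(Z, X.Marked (k + 1))) z, rank (F k τ z) 0 = rank (τ z) 0 :=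
    fun k τ z => rank_pull _ _ _
  -- The tuples whose first mark is the lowest lift. A tuple outside `L` has a first mark above it
  -- at `z₀`, hence everywhere, so the lowest lift can be prepended.
  let L : ∀ k, Set ((maps X Z).simplex k) := fun k => {τ | low (project τ) = F k τ}
  have hproj : ∀ k (ρ : C(Z, X.Marked (k + 2))) j,
      project ((pull (Fin.succAboveOrderEmb j)).comp ρ) = project ρ := fun k τ j =>
    ContinuousMap.ext fun z => proj_pull _ _
  have cover : ∀ k, ∀ τ : (maps X Z).simplex k,
      τ ∈ L k ∨ ∃ ρ ∈ L (k + 1), (maps X Z).face 0 ρ = τ := by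
    intro k (τ : C(Z, X.Marked (k + 1)))
    have h := hlow (F k τ)
    rw [hF] at h
    have hp : ∀ z, proj (low (project τ) z) = proj (F k τ z) := fun z =>
      DFunLike.congr_fun (h.1.trans (hF k τ).symm) z
    rcases h.2.lt_or_eq with h' | h'
    · have hlt := rank_lt_of_exists hp h'
      obtain ⟨ρ, hρ, hρ'⟩ := exists_cons (low (project τ)) τ (fun z => DFunLike.congr_fun h.1 z)
        (fun z => (hlt z).trans_eq (hFr k τ z))
      refine Or.inr ⟨ρ, ?_, hρ'⟩
      change low (project ρ) = F (k + 1) ρ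
      rw [← hproj k ρ 0, hρ']
      exact hρ.symm
    · refine Or.inl (eq_of_rank_apply_eq hp (z₀ := z₀) (funext fun j => ?_))
      rw [Subsingleton.elim j 0]
      exact h'
  have face_mem : ∀ k, ∀ ρ ∈ L (k + 1), ∀ j : Fin (k + 1), (maps X Z).face j.succ ρ ∈ L k := by
    intro k (ρ : C(Z, X.Marked (k + 2))) hρ j
    change low (project ((pull (Fin.succAboveOrderEmb j.succ)).comp ρ)) =
      F k ((pull (Fin.succAboveOrderEmb j.succ)).comp ρ)
    rw [hproj]
    refine (show low (project ρ) = F (k + 1) ρ from hρ).trans (ContinuousMap.ext fun z => ?_)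
    change pull _ _ = pull _ (pull _ _)
    rw [pull_pull]
    congr 1
  have rank_eq : ∀ k (ρ : C(Z, X.Marked (k + 2))), ρ ∈ L (k + 1) →
      ∀ z, rank (ρ z) 0 = rank (low (project ρ) z) 0 := by
    intro k ρ hρ z
    rw [show low (project ρ) = F (k + 1) ρ from hρ, hFr]
  have inj : ∀ k, ∀ ρ ∈ L (k + 1), ∀ ρ' ∈ L (k + 1),
      (maps X Z).face 0 ρ = (maps X Z).face 0 ρ' → ρ = ρ' := by
    intro k (ρ : C(Z, X.Marked (k + 2))) hρ (ρ' : C(Z, X.Marked (k + 2))) hρ' h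
    have h' : (pull (Fin.succAboveOrderEmb 0)).comp ρ = (pull (Fin.succAboveOrderEmb 0)).comp ρ' := h
    refine ContinuousMap.ext fun z => eq_of_pull_eq ?_ (DFunLike.congr_fun h' z)
    rw [rank_eq k ρ hρ, rank_eq k ρ' hρ', ← hproj k ρ 0, ← hproj k ρ' 0, h']
  have notMem : ∀ k, ∀ ρ ∈ L (k + 1), (maps X Z).face 0 ρ ∉ L k := by
    intro k (ρ : C(Z, X.Marked (k + 2))) hρ h
    have h' : low (project ((pull (Fin.succAboveOrderEmb 0)).comp ρ)) =
      F k ((pull (Fin.succAboveOrderEmb 0)).comp ρ) := h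
    -- If both `ρ` and its face 0 began with the lowest lift, the first two marks of `ρ` would have
    -- equal rank.
    have h1 := rank_eq k ρ hρ z₀
    rw [← hproj k ρ 0, h', hFr] at h1
    change _ = rank (pull _ (ρ z₀)) 0 at h1
    rw [rank_pull] at h1
    exact (strictMono_rank (ρ z₀) (Fin.succ_pos 0)).ne h1
  refine ⟨exact_boundary_of_unface cover inj notMem face_mem,
    exact_boundary_augmentation_of_unface _ low (fun ρ => ?_) (fun τ hτ => ?_) (cover 0) (inj 0)
      (notMem 0) fun ρ hρ => face_mem 0 ρ hρ 0⟩
  · exact (hproj 0 ρ 0).trans (hproj 0 ρ 1).symm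
  · refine Eq.trans hτ (ContinuousMap.ext fun z => ?_)
    change pull (first 0) _ = _
    generalize (show C(Z, X.Marked 1) from τ) z = c
    induction c using ind with
    | h n x γ t ht =>
      rw [pull_mk]
      congr 1
      ext j
      rw [Subsingleton.elim j 0]
      rfl

end Marked

end DeltaSet

/-! ### Exactness of the columns: spaces that contract to a discrete set -/

namespace TopSimplex

variable {n q : ℕ}

/-- The point of the segment from `t` to `u` with parameter `s`. -/
noncomputable def mix (s : unitInterval) (t u : TopSimplex n) : TopSimplex n :=
  ⟨fun k => (1 - s.1) * t k + s.1 * u k, fun k => add_nonneg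
    (mul_nonneg (sub_nonneg.2 s.2.2) (t.2.1 k)) (mul_nonneg s.2.1 (u.2.1 k)), by
    rw [Finset.sum_add_distrib, ← Finset.mul_sum, ← Finset.mul_sum, stdSimplex.sum_eq_one,
      stdSimplex.sum_eq_one]
    ring⟩

theorem mix_apply (s : unitInterval) (t u : TopSimplex n) (k : Fin (n + 1)) :
    mix s t u k = (1 - s.1) * t k + s.1 * u k := rfl

theorem mix_zero (t u : TopSimplex n) : mix 0 t u = t := by
  ext k
  simp [mix_apply]

theorem mix_one (t u : TopSimplex n) : mix 1 t u = u := by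
  ext k
  simp [mix_apply]

theorem map_mix {m : ℕ} (f : Fin (n + 1) → Fin (m + 1)) (s : unitInterval) (t u : TopSimplex n) :
    stdSimplex.map f (mix s t u) = mix s (stdSimplex.map f t) (stdSimplex.map f u) := by
  ext k
  simp only [mix_apply, map_apply_eq_sum, Finset.mul_sum, ← Finset.sum_add_distrib]
  refine Finset.sum_congr rfl fun i _ => ?_
  split_ifs <;> simp

theorem continuous_mix : Continuous fun p : unitInterval × TopSimplex n × TopSimplex n =>
    mix p.1 p.2.1 p.2.2 := by
  refine Continuous.subtype_mk (continuous_pi fun k => ?_) _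
  have h1 : Continuous fun p : unitInterval × TopSimplex n × TopSimplex n => p.1.1 :=
    continuous_subtype_val.comp continuous_fst
  have h2 : Continuous fun p : unitInterval × TopSimplex n × TopSimplex n => p.2.1 k :=
    (continuous_coord k).comp (continuous_fst.comp continuous_snd)
  have h3 : Continuous fun p : unitInterval × TopSimplex n × TopSimplex n => p.2.2 k :=
    (continuous_coord k).comp (continuous_snd.comp continuous_snd)
  exact ((continuous_const.sub h1).mul h2).add (h1.mul h3)

/-- The standard simplex as a join of its first vertex and the opposite face. -/
noncomputable def join (q : ℕ) : C(unitInterval × TopSimplex q, TopSimplex (q + 1)) where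
  toFun p := mix p.1 (stdSimplex.faceMap 0 p.2) (stdSimplex.vertex 0)
  continuous_toFun := continuous_mix.comp (continuous_fst.prodMk
    (((stdSimplex.faceMap 0).continuous.comp continuous_snd).prodMk continuous_const))

theorem join_apply_zero (s : unitInterval) (t : TopSimplex q) : join q (s, t) 0 = s.1 := by
  have h : stdSimplex.map (Fin.succAbove 0) t 0 = 0 := map_succAbove_self 0 t
  change (1 - s.1) * stdSimplex.map (Fin.succAbove 0) t 0 + s.1 * _ = _
  rw [h]
  simp

theorem join_apply_succ (s : unitInterval) (t : TopSimplex q) (i : Fin (q + 1)) :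
    join q (s, t) i.succ = (1 - s.1) * t i := by
  have h : stdSimplex.map (Fin.succAbove 0) t i.succ = t i := map_succAbove_apply 0 t i
  change (1 - s.1) * stdSimplex.map (Fin.succAbove 0) t i.succ + s.1 * _ = _
  rw [h]
  simp

theorem surjective_join (q : ℕ) : Function.Surjective (join q) := by
  intro u
  have hs : u 0 + ∑ i : Fin (q + 1), u i.succ = 1 :=
    (Fin.sum_univ_succ _).symm.trans (stdSimplex.sum_eq_one u)
  have hnn : ∀ i : Fin (q + 1), 0 ≤ u i.succ := fun i => u.2.1 _
  have h1 : u 0 ≤ 1 := by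
    have := Finset.sum_nonneg fun (i : Fin (q + 1)) (_ : i ∈ Finset.univ) => hnn i
    linarith
  let s : unitInterval := ⟨u 0, u.2.1 0, h1⟩
  rcases h1.lt_or_eq with h | h
  · have hpos : 0 < 1 - u 0 := sub_pos.2 h
    refine ⟨(s, ⟨fun i => u i.succ / (1 - u 0), fun i => div_nonneg (hnn i) hpos.le, ?_⟩), ?_⟩
    · rw [← Finset.sum_div, div_eq_one_iff_eq hpos.ne']
      linarith
    · ext i
      induction i using Fin.cases with
      | zero => exact join_apply_zero _ _
      | succ i =>
        rw [join_apply_succ]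
        exact mul_div_cancel₀ _ hpos.ne'
  · refine ⟨(s, stdSimplex.barycenter), ?_⟩
    have h0 : ∀ i : Fin (q + 1), u i.succ = 0 := by
      have : ∑ i : Fin (q + 1), u i.succ = 0 := by linarith
      intro i
      exact (Finset.sum_eq_zero_iff_of_nonneg fun i _ => hnn i).1 this i (Finset.mem_univ i)
    ext i
    induction i using Fin.cases with
    | zero => exact join_apply_zero _ _
    | succ i =>
      rw [join_apply_succ, h0]
      change (1 - u 0) * _ = 0
      rw [h, sub_self, zero_mul]

theorem isQuotientMap_join (q : ℕ) : Topology.IsQuotientMap (join q) :=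
  (join q).continuous.isClosedMap.isQuotientMap (join q).continuous (surjective_join q)

theorem eq_or_eq_of_join_eq {a b : unitInterval × TopSimplex q} (h : join q a = join q b) :
    a = b ∨ a.1 = 1 ∧ b.1 = 1 := by
  obtain ⟨s, t⟩ := a
  obtain ⟨s', t'⟩ := b
  have h0 := DFunLike.congr_fun h 0
  rw [join_apply_zero, join_apply_zero] at h0
  obtain rfl : s = s' := Subtype.ext h0
  by_cases hs : s = 1
  · exact Or.inr ⟨hs, hs⟩
  · refine Or.inl (Prod.ext rfl ?_)
    ext i
    have hi := DFunLike.congr_fun h i.succ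
    rw [join_apply_succ, join_apply_succ] at hi
    exact mul_left_cancel₀ (sub_ne_zero.2 fun h => hs (Subtype.ext h.symm)) hi

theorem join_zero (t : TopSimplex q) : join q (0, t) = stdSimplex.faceMap 0 t :=
  mix_zero _ _

theorem join_faceMap (i : Fin (q + 2)) (s : unitInterval) (t : TopSimplex q) :
    join (q + 1) (s, stdSimplex.faceMap i t) = stdSimplex.faceMap i.succ (join q (s, t)) := by
  change mix s (stdSimplex.map _ (stdSimplex.map _ t)) _ = stdSimplex.map _ (mix s _ _)
  rw [map_mix]
  congr 1
  · change _ = stdSimplex.map _ (stdSimplex.map _ t)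
    rw [stdSimplex.map_comp_apply, stdSimplex.map_comp_apply,
      Fin.succ_succAbove_comp_succAbove (Fin.zero_le i), Fin.castSucc_zero]
  · rw [stdSimplex.map_vertex]
    rfl

theorem join_zero_one (t : TopSimplex 0) : join 0 (1, t) = stdSimplex.faceMap 1 t := by
  refine (mix_one _ _).trans ?_
  rw [Subsingleton.elim t (stdSimplex.vertex 0)]
  exact (stdSimplex.map_vertex (S := ℝ) (Fin.succAbove (1 : Fin 2)) (0 : Fin 1)).symm

end TopSimplex

namespace TopologicalSpace

open TopSimplex

variable {E B : Type} [TopologicalSpace E]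

/-- The homotopy along `τ` ends at a single point, because `ℓ` is constant on the connected simplex.
So it factors through the join, whose cone point is vertex 0, reached at parameter `1`. -/
theorem exists_cone (ℓ : E → B) (hℓ : IsLocallyConstant ℓ) (c : B → E)
    (H : C(unitInterval × E, E)) (H_one : ∀ e, H (1, e) = c (ℓ e)) (q : ℕ)
    (τ : C(TopSimplex q, E)) : ∃ ρ : C(TopSimplex (q + 1), E),
    ∀ s t, ρ (join q (s, t)) = H (s, τ t) := by
  let g : C(unitInterval × TopSimplex q, E) :=
    H.comp ((ContinuousMap.id _).prodMap τ)
  have hτ : ∀ t t', ℓ (τ t) = ℓ (τ t') := fun t t' =>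
    (hℓ.comp_continuous τ.continuous).apply_eq_of_preconnectedSpace t t'
  have hg : Function.FactorsThrough g (join q) := by
    intro a b hab
    rcases eq_or_eq_of_join_eq hab with rfl | ⟨ha, hb⟩
    · rfl
    · change H (a.1, τ a.2) = H (b.1, τ b.2)
      rw [ha, hb, H_one, H_one, hτ a.2 b.2]
  exact ⟨(isQuotientMap_join q).lift g hg, fun s t =>
    DFunLike.congr_fun ((isQuotientMap_join q).lift_comp g hg) (s, t)⟩

/-- The singular chain complex of a space that contracts to a discrete set. -/
theorem exact_boundary_singular_of_contraction (ℓ : E → B) (hℓ : IsLocallyConstant ℓ) (c : B → E)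
    (H : C(unitInterval × E, E)) (H_zero : ∀ e, H (0, e) = e) (H_one : ∀ e, H (1, e) = c (ℓ e)) :
    (∀ q, Function.Exact ((singular E).boundary (q + 1)) ((singular E).boundary q)) ∧
      Function.Exact ((singular E).boundary 0) (Finsupp.mapDomain.addMonoidHom (M := ℤ)
        fun τ : C(TopSimplex 0, E) => ℓ (τ (stdSimplex.vertex 0))) := by
  -- The cone operator satisfies `d₀ K = id` and `d_{i+1} K = K d_i`, which makes it a contracting
  -- homotopy. On 0-simplices `d₁ K` is instead the constant simplex at the end of the contraction.
  choose K hK using exists_cone ℓ hℓ c H H_one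
  have K_zero : ∀ q (τ : C(TopSimplex q, E)), (singular E).face 0 (K q τ : (singular E).simplex (q + 1)) = τ := by
    intro q τ
    refine ContinuousMap.ext fun t => ?_
    rw [ContinuousMap.comp_apply, ← join_zero, hK, H_zero]
  have K_succ : ∀ q (τ : C(TopSimplex (q + 1), E)) (i : Fin (q + 2)),
      (singular E).face i.succ (K (q + 1) τ : (singular E).simplex (q + 2)) =
        K q ((singular E).face i τ) := by
    intro q τ i
    refine ContinuousMap.ext fun u => ?_
    obtain ⟨⟨s, t⟩, rfl⟩ := surjective_join q u
    rw [ContinuousMap.comp_apply, ← join_faceMap, hK, hK]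
    rfl
  have K_one : ∀ τ : C(TopSimplex 0, E), (singular E).face 1 (K 0 τ : (singular E).simplex 1) =
      ContinuousMap.const _ (c (ℓ (τ (stdSimplex.vertex 0)))) := by
    intro τ
    refine ContinuousMap.ext fun t => ?_
    rw [ContinuousMap.comp_apply, ← join_zero_one, hK, H_one,
      Subsingleton.elim t (stdSimplex.vertex 0)]
    rfl
  let h : ∀ q, ((singular E).simplex q →₀ ℤ) →+ ((singular E).simplex (q + 1) →₀ ℤ) :=
    fun q => Finsupp.mapDomain.addMonoidHom (K q)
  have hs : ∀ q (τ : (singular E).simplex q), h q (Finsupp.single τ 1) =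
      Finsupp.single (K q τ : (singular E).simplex (q + 1)) 1 :=
    fun q τ => Finsupp.mapDomain_single
  constructor
  · intro q
    refine AddMonoidHom.exact_of_contraction _ _ (h (q + 1)) (h q)
      ((singular E).boundary_boundary q) fun z => ?_
    refine Finsupp.addHom_eq_of_single (f := ((singular E).boundary (q + 1)).comp (h (q + 1)) +
      (h q).comp ((singular E).boundary q)) (g := AddMonoidHom.id _) (fun τ => ?_) z
    simp only [AddMonoidHom.add_apply, AddMonoidHom.comp_apply, AddMonoidHom.id_apply]
    rw [hs, (singular E).boundary_single, (singular E).boundary_single, Fin.sum_univ_succ, map_sum]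
    refine (add_assoc _ _ _).trans ((congrArg₂ (· + ·) ?_ (Finset.sum_add_distrib.symm.trans
      (Finset.sum_eq_zero fun i _ => ?_))).trans (add_zero (Finsupp.single τ 1)))
    · rw [K_zero]
      simp
    · rw [map_zsmul, hs, K_succ, Fin.val_succ, pow_succ, mul_neg, mul_one, neg_smul,
        neg_add_cancel]
  · have hb : ∀ ρ : (singular E).simplex 1, (singular E).boundary 0 (Finsupp.single ρ 1) =
        Finsupp.single ((singular E).face 0 ρ) 1 - Finsupp.single ((singular E).face 1 ρ) 1 := by
      intro ρ
      rw [(singular E).boundary_single]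
      refine (Fin.sum_univ_two _).trans ?_
      simp [sub_eq_add_neg]
    let b : ((singular E).simplex 0 →₀ ℤ) →+ (B →₀ ℤ) := Finsupp.mapDomain.addMonoidHom (M := ℤ)
        fun τ : C(TopSimplex 0, E) => ℓ (τ (stdSimplex.vertex 0))
    have hbs : ∀ τ : (singular E).simplex 0, b (Finsupp.single τ 1) =
        Finsupp.single (ℓ ((show C(TopSimplex 0, E) from τ) (stdSimplex.vertex 0))) 1 :=
      fun τ => Finsupp.mapDomain_single
    let h' : (B →₀ ℤ) →+ ((singular E).simplex 0 →₀ ℤ) := Finsupp.mapDomain.addMonoidHom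
      fun y : B => (ContinuousMap.const (TopSimplex 0) (c y) : (singular E).simplex 0)
    have hs' : ∀ y : B, h' (Finsupp.single y 1) =
        Finsupp.single (ContinuousMap.const (TopSimplex 0) (c y) : (singular E).simplex 0) 1 :=
      fun y => Finsupp.mapDomain_single
    refine AddMonoidHom.exact_of_contraction _ b (h 0) h' (fun z => ?_) fun z => ?_
    · refine Finsupp.addHom_eq_of_single (f := b.comp ((singular E).boundary 0)) (g := 0)
        (fun τ => ?_) z
      rw [AddMonoidHom.comp_apply, hb, map_sub, hbs, hbs, AddMonoidHom.zero_apply, sub_eq_zero]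
      congr 1
      exact (hℓ.comp_continuous (ContinuousMap.continuous
        (show C(TopSimplex 1, E) from τ))).apply_eq_of_preconnectedSpace _ _
    · refine Finsupp.addHom_eq_of_single (f := ((singular E).boundary 0).comp (h 0) + h'.comp b)
        (g := AddMonoidHom.id _) (fun τ => ?_) z
      simp only [AddMonoidHom.add_apply, AddMonoidHom.comp_apply, AddMonoidHom.id_apply]
      rw [hs, hbs, hs', hb]
      rw [K_zero, K_one, sub_add_cancel]

end TopologicalSpace

/-! ### Restricting simplices of the nerve to faces -/

namespace Semigroup

variable {S : Type} [Semigroup S]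

/-- The product of the entries of a sequence at the places `i, …, i + d`. -/
def intervalMul (f : ℕ → S) (i : ℕ) : ℕ → S
  | 0 => f i
  | d + 1 => intervalMul f i d * f (i + d + 1)

theorem intervalMul_mul (f : ℕ → S) (i d e : ℕ) :
    intervalMul f i d * intervalMul f (i + d + 1) e = intervalMul f i (d + e + 1) := by
  induction e with
  | zero => rfl
  | succ e ih =>
    change _ * (intervalMul f (i + d + 1) e * _) = intervalMul f i (d + e + 1) * _
    rw [← mul_assoc, ih]
    congr 2
    omega

section

variable [Nonempty S] {n k l : ℕ}

/-- The product of the entries of a tuple between two vertices. -/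
noncomputable def edge (x : Fin n → S) (i j : Fin (n + 1)) : S :=
  -- The last argument `d` of `intervalMul` multiplies `d + 1` entries, so the edge from `i` to `j`
  -- needs `j - i - 1`. The arbitrary entries beyond `n` do not enter when `i < j`.
  intervalMul (fun m => if h : m < n then x ⟨m, h⟩ else Classical.arbitrary S) i (j - i - 1)

theorem edge_castSucc_succ (x : Fin n → S) (i : Fin n) : edge x i.castSucc i.succ = x i := by
  have h : (i.succ : ℕ) - i.castSucc - 1 = 0 := by simp
  rw [edge, h]
  exact dif_pos i.2

theorem edge_mul_edge (x : Fin n → S) {i j m : Fin (n + 1)} (h : i < j) (h' : j < m) :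
    edge x i j * edge x j m = edge x i m := by
  have h1 : (j : ℕ) = i + (j - i - 1) + 1 := by omega
  have h2 : (m : ℕ) - i - 1 = (j - i - 1) + (m - j - 1) + 1 := by omega
  rw [edge, edge, edge, h2, ← intervalMul_mul, ← h1]

/-- A multiplicative function on pairs `i < j` is determined by its values on consecutive pairs.
This gives the transitivity of restriction. -/
theorem eq_edge {x : Fin n → S} {F : Fin (n + 1) → Fin (n + 1) → S}
    (hF : ∀ i j m, i < j → j < m → F i j * F j m = F i m) (hx : ∀ i, F i.castSucc i.succ = x i)
    {i j : Fin (n + 1)} (h : i < j) : F i j = edge x i j := by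
  have key : ∀ d : ℕ, ∀ j : Fin (n + 1), (j : ℕ) = i + d + 1 → F i j = edge x i j := by
    intro d
    induction d with
    | zero =>
      intro j hj
      obtain ⟨a, rfl⟩ : ∃ a : Fin n, i = a.castSucc := ⟨⟨i, by omega⟩, rfl⟩
      obtain rfl : j = a.succ := Fin.ext (by simpa using hj)
      rw [hx, edge_castSucc_succ]
    | succ d ih =>
      intro j hj
      obtain ⟨a, rfl⟩ : ∃ a : Fin n, j = a.succ := ⟨⟨i + d + 1, by omega⟩, Fin.ext hj⟩
      have ha : (a.castSucc : ℕ) = i + d + 1 := Nat.succ.inj hj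
      have h1 : i < a.castSucc := Fin.lt_def.2 (by omega)
      rw [← hF i a.castSucc a.succ h1 a.castSucc_lt_succ, ih _ ha, hx,
        ← edge_castSucc_succ x a, edge_mul_edge x h1 a.castSucc_lt_succ]
  exact key (j - i - 1) j (by omega)

/-- The restriction of a tuple, regarded as a simplex of the nerve, to a face. -/
noncomputable def restrict (x : Fin n → S) (γ : Fin (k + 1) ↪o Fin (n + 1)) : Fin k → S :=
  fun a => edge x (γ a.castSucc) (γ a.succ)

theorem edge_restrict (x : Fin n → S) (γ : Fin (k + 1) ↪o Fin (n + 1)) {i j : Fin (k + 1)}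
    (h : i < j) : edge x (γ i) (γ j) = edge (restrict x γ) i j :=
  eq_edge (F := fun i j => edge x (γ i) (γ j))
    (fun _ _ _ h h' => edge_mul_edge x (γ.strictMono h) (γ.strictMono h')) (fun _ => rfl) h

theorem restrict_restrict (x : Fin n → S) (γ : Fin (k + 1) ↪o Fin (n + 1))
    (δ : Fin (l + 1) ↪o Fin (k + 1)) : restrict (restrict x γ) δ = restrict x (δ.trans γ) :=
  funext fun a => (edge_restrict x γ (δ.strictMono a.castSucc_lt_succ)).symm

theorem nerveFace_eq_restrict (x : Fin (n + 1) → S) (i : Fin (n + 2)) :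
    nerveFace S i x = restrict x (Fin.succAboveOrderEmb i) := by
  funext a
  change _ = edge x (i.succAbove a.castSucc) (i.succAbove a.succ)
  induction i using Fin.cases with
  | zero =>
    rw [nerveFace_zero, Fin.succAbove_zero, ← Fin.castSucc_succ, edge_castSucc_succ]
  | succ i =>
    rw [nerveFace_succ]
    rcases lt_trichotomy (a : ℕ) i with h | h | h
    · rw [Fin.contractNth_apply_of_lt _ _ _ _ h,
        Fin.succAbove_of_castSucc_lt i.succ a.castSucc (Fin.lt_def.2 (by simp; omega)),
        Fin.succAbove_of_castSucc_lt i.succ a.succ (Fin.lt_def.2 (by simpa using h)),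
        Fin.castSucc_succ, edge_castSucc_succ]
    · rw [Fin.contractNth_apply_of_eq _ _ _ _ h,
        Fin.succAbove_of_castSucc_lt i.succ a.castSucc (Fin.lt_def.2 (by simp; omega)),
        Fin.succAbove_of_le_castSucc i.succ a.succ (Fin.le_def.2 (by simp; omega)),
        ← edge_mul_edge x (j := a.succ.castSucc) (Fin.lt_def.2 (by simp)) (Fin.lt_def.2 (by simp)),
        edge_castSucc_succ, Fin.castSucc_succ, edge_castSucc_succ]
    · rw [Fin.contractNth_apply_of_gt _ _ _ _ h,
        Fin.succAbove_of_le_castSucc i.succ a.castSucc (Fin.le_def.2 (by simp; omega)),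
        Fin.succAbove_of_le_castSucc i.succ a.succ (Fin.le_def.2 (by simp; omega)),
        ← Fin.castSucc_succ, edge_castSucc_succ]

theorem restrict_nerveFace (i : Fin (n + 2)) (x : Fin (n + 1) → S)
    (γ : Fin (k + 1) ↪o Fin (n + 1)) :
    restrict (nerveFace S i x) γ = restrict x (γ.trans (Fin.succAboveOrderEmb i)) := by
  rw [nerveFace_eq_restrict, restrict_restrict]

theorem restrict_id (x : Fin n → S) (γ : Fin (n + 1) ↪o Fin (n + 1)) : restrict x γ = x := by
  obtain rfl : γ = RelEmbedding.refl _ := 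
    RelEmbedding.ext fun a => congrFun γ.strictMono.eq_id a
  exact funext fun a => edge_castSucc_succ x a

end

end Semigroup

/-! ### Contracting marked points to barycenters of their marked faces -/

namespace DeltaSet.Marked

open Semigroup TopSimplex

variable {S : Type} [Semigroup S] [Nonempty S] {k l : ℕ}

theorem map_apply_apply {n m : ℕ} (α : Fin (n + 1) ↪o Fin (m + 1)) (t : TopSimplex n)
    (i : Fin (n + 1)) : stdSimplex.map α t (α i) = t i := by
  rw [map_apply_eq_sum]
  simp

theorem mk_congr {X : DeltaSet.{0}} {n : ℕ} (x : X.simplex n) {γ γ' : Fin k ↪o Fin (n + 1)}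
    {t t' : TopSimplex n} (hγ : γ = γ') (h : t = t') (ht : ∀ j, 0 < t (γ j))
    (ht' : ∀ j, 0 < t' (γ' j)) : mk x γ t ht = mk x γ' t' ht' := by
  subst hγ h
  rfl

theorem mk_restrict_self {n : ℕ} (γ : Fin l ↪o Fin (n + 1)) (t : TopSimplex n)
    (ht : ∀ j, 0 < t (γ j)) (x : Fin n → S) (α : Fin (n + 1) ↪o Fin (n + 1))
    (ht' : ∀ j, 0 < stdSimplex.map α t (γ.trans α j)) :
    mk (X := nerve S) (restrict x α) γ t ht =
      mk (X := nerve S) x (γ.trans α) (stdSimplex.map α t) ht' := by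
  obtain rfl : α = RelEmbedding.refl _ :=
    RelEmbedding.ext fun a => congrFun α.strictMono.eq_id a
  have h : restrict x (RelEmbedding.refl _) = x := restrict_id x _
  have e : stdSimplex.map (RelEmbedding.refl (· ≤ · : Fin (n + 1) → Fin (n + 1) → Prop)) t = t :=
    stdSimplex.map_id_apply t
  refine Eq.trans ?_ (mk_congr (X := nerve S) x (γ := γ) rfl e.symm ht ht')
  congr 1

/-- A marked point of a face, as a marked point of the simplex. -/
theorem mk_restrict (γ : Fin l ↪o Fin (k + 1)) (t : TopSimplex k) (ht : ∀ j, 0 < t (γ j)) :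
    ∀ {n : ℕ} (x : Fin n → S) (α : Fin (k + 1) ↪o Fin (n + 1))
      (ht' : ∀ j, 0 < stdSimplex.map α t (γ.trans α j)),
      mk (X := nerve S) (restrict x α) γ t ht =
        mk (X := nerve S) x (γ.trans α) (stdSimplex.map α t) ht' := by
  intro n
  induction n with
  | zero =>
    intro x α ht'
    obtain rfl : k = 0 := by
      have := Fintype.card_le_of_embedding α.toEmbedding
      simpa using this
    exact mk_restrict_self γ t ht x α ht'
  | succ n ih =>
    intro x α ht'
    by_cases hα : Function.Surjective α
    · have hk : k = n + 1 := by
        have := Fintype.card_of_bijective ⟨α.injective, hα⟩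
        simpa using this
      subst hk
      exact mk_restrict_self γ t ht x α ht'
    -- A proper face misses some vertex `i`, so it factors through the face opposite to `i`, where
    -- one elementary gluing and the induction hypothesis apply.
    · obtain ⟨i, hi⟩ := not_forall.1 hα
      obtain ⟨β, rfl⟩ := α.exists_trans_succAbove fun j hj => hi ⟨j, hj⟩
      have hpos : ∀ j, 0 < stdSimplex.map β t (γ.trans β j) := fun j =>
        (map_apply_apply β t (γ j)).symm ▸ ht j
      have e : stdSimplex.map i.succAbove (stdSimplex.map β t) =
          stdSimplex.map (β.trans (Fin.succAboveOrderEmb i)) t := by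
        rw [stdSimplex.map_comp_apply]
        rfl
      have h := ih (nerveFace S i x) β hpos
      rw [restrict_nerveFace] at h
      exact h.trans ((mk_face (X := nerve S) i x (γ.trans β) _ hpos (e ▸ ht')).trans
        (mk_congr (X := nerve S) x rfl e _ _))

/-- The face spanned by the marked vertices. -/
noncomputable def label : (nerve S).Marked (k + 1) → (nerve S).simplex k :=
  Quot.lift (fun a => restrict (S := S) a.1.2.1 a.1.2.2) (by
    rintro _ _ ⟨i, x, γ, t, ht, ht'⟩
    exact restrict_nerveFace i x γ)

/-- The label depends on the simplex and on the choice of marked vertices, but not on the weights.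
-/
theorem isLocallyConstant_label :
    IsLocallyConstant (label : (nerve S).Marked (k + 1) → (nerve S).simplex k) := by
  intro s
  refine isOpen_iff.2 fun n x γ => ?_
  by_cases h : restrict (S := S) x γ ∈ s
  · convert! isOpen_univ
    exact Set.eq_univ_of_forall fun t => h
  · convert! isOpen_empty
    exact Set.eq_empty_of_forall_notMem fun t => h

theorem label_pull (j : Fin (k + 2)) (c : (nerve S).Marked (k + 2)) :
    label (pull (Fin.succAboveOrderEmb j) c) = (nerve S).face j (label c) := by
  induction c using ind with
  | h n x γ t ht =>
    exact ((nerveFace_eq_restrict _ j).trans (restrict_restrict _ _ _)).symm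

theorem barycenter_pos {n : ℕ} (i : Fin (n + 1)) : 0 < (stdSimplex.barycenter : TopSimplex n) i := by
  refine lt_of_lt_of_eq ?_ (stdSimplex.barycenter_apply (𝕜 := ℝ) i).symm
  positivity

/-- The barycenter of a simplex with all vertices marked. -/
noncomputable def centerPoint (y : (nerve S).simplex k) : (nerve S).Marked (k + 1) :=
  mk y (RelEmbedding.refl _) stdSimplex.barycenter fun j => barycenter_pos j

theorem mix_pos {n : ℕ} (γ : Fin (k + 1) ↪o Fin (n + 1)) (s : unitInterval) (t : TopSimplex n)
    (ht : ∀ j, 0 < t (γ j)) (j : Fin (k + 1)) :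
    0 < mix s t (stdSimplex.map γ stdSimplex.barycenter) (γ j) := by
  rw [mix_apply, map_apply_apply]
  rcases s.2.2.lt_or_eq with h | h
  · exact add_pos_of_pos_of_nonneg (mul_pos (sub_pos.2 h) (ht j))
      (mul_nonneg s.2.1 (barycenter_pos j).le)
  · rw [h, sub_self, zero_mul, zero_add, one_mul]
    exact barycenter_pos j

theorem continuous_mk_mix {X : DeltaSet.{0}} {n : ℕ} (x : X.simplex n)
    (γ : Fin (k + 1) ↪o Fin (n + 1)) :
    Continuous fun p : {t : TopSimplex n // ∀ j, 0 < t (γ j)} × unitInterval =>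
      mk x γ (mix p.2 p.1.1 (stdSimplex.map γ stdSimplex.barycenter))
        (mix_pos γ p.2 p.1.1 p.1.2) := by
  have h : Continuous fun p : {t : TopSimplex n // ∀ j, 0 < t (γ j)} × unitInterval =>
      mix p.2 p.1.1 (stdSimplex.map γ stdSimplex.barycenter) :=
    continuous_mix.comp (continuous_snd.prodMk
      ((continuous_subtype_val.comp continuous_fst).prodMk continuous_const))
  exact (continuous_mk x γ).comp (h.subtype_mk fun p => mix_pos γ p.2 p.1.1 p.1.2)

/-- The straight line to the barycenter of the marked face keeps the marked weights positive and
respects the gluing. At its end the point lies in the marked face, where it is the center point of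
the label by `mk_restrict`. Currying defines the homotopy on the quotient as a map into paths, and
local compactness of the interval makes the uncurried map continuous. -/
theorem exists_contraction : ∃ H : C(unitInterval × (nerve S).Marked (k + 1),
    (nerve S).Marked (k + 1)), (∀ c, H (0, c) = c) ∧ ∀ c, H (1, c) = centerPoint (label c) := by
  let h : (nerve S).Marked (k + 1) → C(unitInterval, (nerve S).Marked (k + 1)) :=
    Quot.lift (fun a => ⟨fun s => mk a.1.2.1 a.1.2.2
      (mix s a.2.1 (stdSimplex.map a.1.2.2 stdSimplex.barycenter)) (mix_pos a.1.2.2 s a.2.1 a.2.2),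
      (continuous_mk_mix a.1.2.1 a.1.2.2).comp (continuous_const.prodMk continuous_id)⟩) (by
      rintro _ _ ⟨i, x, γ, t, ht, ht'⟩
      refine ContinuousMap.ext fun s => ?_
      have e : stdSimplex.map i.succAbove (mix s t (stdSimplex.map γ stdSimplex.barycenter)) =
          mix s (stdSimplex.map i.succAbove t)
            (stdSimplex.map (γ.trans (Fin.succAboveOrderEmb i)) stdSimplex.barycenter) := by
        rw [map_mix, stdSimplex.map_comp_apply]
        rfl
      have hpos := mix_pos (γ.trans (Fin.succAboveOrderEmb i)) s _ ht'
      exact (mk_face i x γ _ (mix_pos γ s t ht) (e ▸ hpos)).trans (mk_congr x rfl e _ _))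
  have hc : Continuous h := by
    refine continuous_quot_lift _ (continuous_sigma fun p => ?_)
    exact ContinuousMap.continuous_of_continuous_uncurry _ (continuous_mk_mix p.2.1 p.2.2)
  refine ⟨⟨fun p => h p.2 p.1, ?_⟩, fun c => ?_, fun c => ?_⟩
  · exact (ContinuousMap.continuous_uncurry_of_continuous ⟨h, hc⟩).comp continuous_swap
  · induction c using ind with
    | h n x γ t ht => exact mk_congr x rfl (mix_zero _ _) _ _
  · induction c using ind with
    | h n x γ t ht =>
      have hpos : ∀ j, 0 < stdSimplex.map γ (stdSimplex.barycenter : TopSimplex k) (γ j) :=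
        fun j => (barycenter_pos j).trans_eq (map_apply_apply γ _ j).symm
      refine (mk_congr x rfl (mix_one _ _) (mix_pos γ 1 t ht) hpos).trans ?_
      exact (mk_restrict (RelEmbedding.refl _) stdSimplex.barycenter (fun j => barycenter_pos j)
        x γ hpos).symm

end DeltaSet.Marked

/-! ### Comparison of singular homology with the chains of the nerve -/

theorem Finsupp.mapDomain_mem_supportedIn_range {X Y : Type*} (f : X → Y) (z : X →₀ ℤ) :
    Finsupp.mapDomain.addMonoidHom (M := ℤ) f z ∈ Finsupp.supportedIn (Set.range f) := by
  refine Finsupp.map_mem_of_mem_supportedIn _ _ (fun x _ => ?_) (Finsupp.mem_supportedIn_support z)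
  rw [Finsupp.mapDomain.addMonoidHom_apply, Finsupp.mapDomain_single]
  exact Finsupp.single_mem_supportedIn 1 ⟨x, rfl⟩

theorem Finsupp.mem_range_mapDomain {X Y : Type*} (f : X → Y) {z : Y →₀ ℤ}
    (hz : z ∈ Finsupp.supportedIn (Set.range f)) :
    z ∈ (Finsupp.mapDomain.addMonoidHom (M := ℤ) f).range := by
  refine Finsupp.map_mem_of_mem_supportedIn (AddMonoidHom.id _) _ ?_ hz
  rintro _ ⟨x, rfl⟩
  exact ⟨Finsupp.single x 1, Finsupp.mapDomain_single⟩

namespace DeltaSet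

open Marked TopologicalSpace Semigroup

/-- The singular homology of the realization of the nerve of a semigroup, in positive degrees, is
the homology of the chains of the nerve. -/
theorem nonempty_singular_homology_equiv (S : Type) [Semigroup S] [Nonempty S] (n : ℕ) :
    Nonempty (MiddleHomology ((singular (nerve S).Realization).boundary (n + 1))
        ((singular (nerve S).Realization).boundary n) ≃+
      MiddleHomology ((nerve S).boundary (n + 1)) ((nerve S).boundary n)) := by
  let v : TopSimplex 0 := stdSimplex.vertex 0
  have hrow := fun q => exact_boundary_maps (X := nerve S) (Z := TopSimplex q)
    stdSimplex.barycenter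
  choose H H_zero H_one using fun k => exists_contraction (S := S) (k := k)
  have hcol := fun k => exact_boundary_singular_of_contraction label isLocallyConstant_label
    centerPoint (H k) (H_zero k) (H_one k)
  -- Entry `(k, q)` is the group of singular `q`-chains of `Marked (k + 1)`. The augmentation to
  -- singular chains of the realization reaches only the liftable simplices, hence the variant with
  -- `small`.
  refine nonempty_homology_equiv_of_doubleComplex_of_small n
    (D := fun k q => C(TopSimplex q, (nerve S).Marked (k + 1)) →₀ ℤ)
    (A := fun q => C(TopSimplex q, (nerve S).Realization) →₀ ℤ)
    (B := fun k => (nerve S).simplex k →₀ ℤ)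
    (fun k q => (singular ((nerve S).Marked (k + 1))).boundary q)
    (fun k q => (maps (nerve S) (TopSimplex q)).boundary k)
    (fun q => (singular (nerve S).Realization).boundary q)
    (fun k => (nerve S).boundary k)
    (fun q => Finsupp.mapDomain.addMonoidHom project)
    (fun k => Finsupp.mapDomain.addMonoidHom fun τ => label (τ v))
    ?_ ?_ ?_ ?_ ?_ (fun q => (hrow q).2) (fun k q => (hrow q).1 k) ?_ (fun k => (hcol k).2)
    (fun k q => (hcol k).1 q)
  · intro k q z
    refine map_alternatingSum (A := C(TopSimplex (q + 1), (nerve S).Marked (k + 2)) →₀ ℤ)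
      (A' := C(TopSimplex q, (nerve S).Marked (k + 2)) →₀ ℤ)
      (B := C(TopSimplex (q + 1), (nerve S).Marked (k + 1)) →₀ ℤ)
      (B' := C(TopSimplex q, (nerve S).Marked (k + 1)) →₀ ℤ) _ _
      ((singular ((nerve S).Marked (k + 2))).boundary q)
      ((singular ((nerve S).Marked (k + 1))).boundary q) (fun j z => ?_) z
    exact (mapDomain_boundary (singular ((nerve S).Marked (k + 2)))
      (singular ((nerve S).Marked (k + 1)))
      (fun _ τ => (pull (Fin.succAboveOrderEmb j)).comp τ) (fun _ _ _ => rfl) q z).symm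
  · exact fun q z => (mapDomain_boundary (singular ((nerve S).Marked 1))
      (singular (nerve S).Realization) (fun _ => project) (fun _ _ _ => rfl) q z).symm
  · exact fun k z => (mapDomain_boundary (maps (nerve S) (TopSimplex 0)) (nerve S)
      (fun _ τ => label (τ v)) (fun _ j τ => label_pull j (τ v)) k z).symm
  · exact (singular (nerve S).Realization).boundary_boundary
  · intro q z hz
    have h : ∃ w, z - (singular (nerve S).Realization).boundary (q + 1) w ∈ Finsupp.supportedIn
        (Set.range (project : C(TopSimplex (q + 1), (nerve S).Marked 1) → _)) := by
      refine exists_sub_boundary_mem (Y := (nerve S).Realization)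
        (fun q => Set.range (project : C(TopSimplex q, (nerve S).Marked 1) → _)) ?_ (fun y => ?_)
        q z ?_
      · rintro q r _ ⟨τ, rfl⟩ f
        exact ⟨τ.comp f, rfl⟩
      · obtain ⟨W, hW, hy, h⟩ := exists_section y
        refine ⟨W, hW, hy, fun q σ hσ => ?_⟩
        obtain ⟨s, hs⟩ := h _ σ hσ
        exact ⟨s, ContinuousMap.ext hs⟩
      · obtain ⟨u, hu⟩ := hz
        rw [← hu]
        exact Finsupp.mapDomain_mem_supportedIn_range _ u
    obtain ⟨w, hw⟩ := h
    exact ⟨w, Finsupp.mem_range_mapDomain _ hw⟩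
  · intro k z
    refine (Finsupp.mem_range_mapDomain (fun τ : C(TopSimplex 0, (nerve S).Marked (k + 1)) =>
      label (τ v)) (z := z) ?_)
    refine Finsupp.supportedIn_mono ?_ (Finsupp.mem_supportedIn_support z)
    intro y _
    -- Every simplex of the nerve is the label of its own barycenter with all vertices marked.
    exact ⟨ContinuousMap.const _ (centerPoint y), restrict_id (S := S) y _⟩

end DeltaSet

/-! ### Conclusion -/

instance : Nonempty S6 := ⟨S6.y⟩

theorem Semigroup.nonempty_classifyingSpaceHomology_equiv (S : Type) [Semigroup S] [Nonempty S]
    (n : ℕ) : Nonempty (classifyingSpaceHomology S (n + 1) ≃+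
      MiddleHomology ((nerve S).boundary (n + 1)) ((nerve S).boundary n)) := by
  obtain ⟨e⟩ := TopologicalSpace.nonempty_singularHomology_equiv (classifyingSpace S) n
  obtain ⟨f⟩ := DeltaSet.nonempty_singular_homology_equiv S n
  exact ⟨e.trans f⟩

theorem mainTheorem11 :
    -- the complex `0 ← ℤ ← P ← ℤS¹ ← C 0 ← C 1 ← ⋯` is a projective resolution of `ℤ`
    ((Module.Projective S6.Ring1 S6.P ∧ Module.Projective S6.Ring1 S6.Ring1 ∧
        ∀ n : ℕ, Module.Projective S6.Ring1 (S6.C n)) ∧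
      Function.Surjective S6.eps ∧
      Function.Exact S6.d1 S6.eps ∧
      Function.Exact S6.d2C S6.d1 ∧
      Function.Exact (S6.dC 0) S6.d2C ∧
      ∀ n : ℕ, Function.Exact (S6.dC (n + 1)) (S6.dC n)) ∧
    -- the integral homology of the classifying space
    Subsingleton (Semigroup.classifyingSpaceHomology S6 1) ∧
    ∀ i : ℕ, 2 ≤ i →
      Nonempty (Semigroup.classifyingSpaceHomology S6 i ≃ₗ[ℤ] (Fin (2 ^ (i - 2)) → ℤ)) := by
  refine ⟨⟨⟨S6.projective_P, inferInstance, S6.projective_C⟩, S6.eps_surjective, S6.exact_d1_eps,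
    S6.exact_d2C_d1, S6.exact_dC_d2C, S6.exact_dC_dC⟩, ?_, fun i hi => ?_⟩
  · obtain ⟨e⟩ := Semigroup.nonempty_classifyingSpaceHomology_equiv S6 0
    have := S6.subsingleton_nerve_homology_one
    exact e.injective.subsingleton
  · obtain ⟨n, rfl⟩ := Nat.exists_eq_add_of_le' hi
    obtain ⟨e⟩ := Semigroup.nonempty_classifyingSpaceHomology_equiv S6 (n + 1)
    obtain ⟨f⟩ := S6.nonempty_nerve_homology_equiv n
    let g : Semigroup.classifyingSpaceHomology S6 (n + 2) ≃+ (Fin (2 ^ n) → ℤ) := e.trans f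
    exact ⟨g.toLinearEquiv fun c x => map_intCast_smul g ℤ ℤ c x⟩
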